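/- Let $G=SL(2,\mathbb R)$, let $P$ be the subgroup of lower triangular matrices, and for $\lambda\in\mathbb C$, $\varepsilon\in\{\pm1\}$ let $\mathcal L_\lambda^\varepsilon\to G/P$ be the homogeneous line bundle associated with the character $\begin{pmatrix}a&0\\c&a^{-1}\end{pmatrix}\mapsto|a|^{-\lambda}(\operatorname{sgn}a)^{(1-\varepsilon)/2}$. In the Bruhat coordinate $x\in\mathbb R\subset G/P$, the group $G$ acts on its smooth sections by $f(x)\mapsto|cx+d|^{-\lambda}\operatorname{sgn}(cx+d)^{(1-\varepsilon)/2}f\!\left(\frac{ax+b}{cx+d}\right)$, $g^{-1}=\begin{pmatrix}a&b\\c&d\end{pmatrix}$. Write $\mathcal L_\lambda=\mathcal L_\lambda^{+}$ and $\mathcal L=\mathcal L_1^{-}$. The space of distribution sections $\mathcal D'(G/P,\mathcal L_\lambda^\varepsilon)$ is the topological dual of $C^\infty(G/P,\mathcal L_{2-\lambda}^\varepsilon)$, and $\mathcal D'(G/P\times G/P,\mathcal L\boxtimes\mathcal L)$ is the topological dual of $C^\infty(G/P\times G/P,\mathcal L\boxtimes\mathcal L)$, sections being regarded as distribution sections by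 integration in the coordinates. For real $t$ put $t_+^\mu=t^\mu$ if $t>0$ and $t_+^\mu=0$ otherwise, $t_-^\mu=(-t)_+^\mu$, and $$K_\pm^\mu(\zeta_1,\zeta_2;\zeta)=\Bigl(\frac{(\zeta_1-\zeta)(\zeta_2-\zeta)}{\zeta_1-\zeta_2}\Bigr)_\pm^\mu .$$ For each sign there is a closed discrete set $S\subset\mathbb C$, disjoint from the strip $-1<\operatorname{Re}\mu<0$, such that the following hold. (1) The operators $$(T_\mu^\pm f)(\zeta)=\frac{-1}{2\pi\sqrt{-1}}\int_{\mathbb R^2}f(\zeta_1,\zeta_2)\,K_\mp^\mu(\zeta_1,\zeta_2;\zeta)\,\frac{d\zeta_1\,d\zeta_2}{\zeta_1-\zeta_2},$$ where the integral converges absolutely for $-1<\operatorname{Re}\mu<0$, extend to a meromorphic family, with poles contained in $S$, of continuous $G$-intertwining operators $T_\mu^\pm\colon C^\infty(G/P\times G/P,\mathcal L\boxtimes\mathcal L)\to C^\infty(G/P,\mathcal L_{-2\mu})$ ($\mu\notin S$), $G$ acting diagonally on the source. (2) For $\mu\notin S$ the dual operator of $T_\mu^\pm$, multiplied by $-2\pi\sqrt{-1}$,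 $$H_\mu^\pm\colon\mathcal D'(G/P,\mathcal L_{2\mu+2})\to\mathcal D'(G/P\times G/P,\mathcal L\boxtimes\mathcal L),\qquad \langle H_\mu^\pm h,f\rangle=-2\pi\sqrt{-1}\,\langle h,T_\mu^\pm f\rangle,$$ is a continuous (for the strong dual topologies) $G$-intertwining operator. (3) The operators $H_\mu^\pm$ form a meromorphic family with poles contained in $S$: if the spaces $\mathcal D'(G/P,\mathcal L_{2\mu+2})$, $\mu\in\mathbb C$, are identified with one another by means of their $SO(2)$-invariant trivialization, then for every $h$ in this common space and every $f\in C^\infty(G/P\times G/P,\mathcal L\boxtimes\mathcal L)$ the function $\mu\mapsto\langle H_\mu^\pm h,f\rangle$ is holomorphic on $\mathbb C\setminus S$ and has at most poles at the points of $S$, of orders bounded at each point independently of $h$ and $f$. The meromorphy in (1) is understood in the same way, for the functions $\mu\mapsto\langle h,T_\mu^\pm f\rangle$. (4) $H_\mu^\pm$ is given by $$(H_\mu^\pm h)(\zeta_1,\zeta_2)=\frac1{\zeta_1-\zeta_2}\int_{\mathbb R}h(\zeta)\,K_\mp^\mu(\zeta_1,\zeta_2;\zeta)\,d\zeta ,$$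 that is: if $-1<\operatorname{Re}\mu<0$ and $h\in C^\infty(G/P,\mathcal L_{2\mu+2})$, the integral converges absolutely for all $\zeta_1\ne\zeta_2$, and $\langle H_\mu^\pm h,f\rangle$ is the (absolutely convergent) integral over $\mathbb R^2$ of its right-hand side times $f$, for all $f\in C^\infty(G/P\times G/P,\mathcal L\boxtimes\mathcal L)$; for general $\mu$ and $h$ the formula is understood by meromorphic continuation and duality, as in (2) and (3). -/

import Mathlib

open Set Filter Topology MeasureTheory
open scoped ContDiff MatrixGroups

noncomputable section

namespace Holographic

/-! ### Smooth functions on an open set, with the usual Fréchet topology -/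

section SmoothFunctions

variable {E : Type*} [NormedAddCommGroup E] [NormedSpace ℝ E]

/-- The space `C^∞(U)` of complex-valued smooth functions on the open set `U`; as functions on the
ambient space they are normalized to vanish outside `U`. -/
structure SmoothFun (U : TopologicalSpace.Opens E) where
  toFun : E → ℂ
  contDiffOn' : ContDiffOn ℝ ∞ toFun U
  eq_zero' : ∀ x, x ∉ U → toFun x = 0

variable {U : TopologicalSpace.Opens E}

namespace SmoothFun

instance : FunLike (SmoothFun U) E ℂ where
  coe := toFun
  coe_injective f g h := by cases f; cases g; congr

theorem contDiffOn (f : SmoothFun U) : ContDiffOn ℝ ∞ f U := f.contDiffOn'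

theorem eq_zero (f : SmoothFun U) {x : E} (hx : x ∉ U) : f x = 0 := f.eq_zero' x hx

instance : Zero (SmoothFun U) := ⟨⟨0, contDiffOn_const, fun _ _ => rfl⟩⟩

instance : Add (SmoothFun U) :=
  ⟨fun f g => ⟨fun x => f x + g x, f.contDiffOn.add g.contDiffOn,
    fun x hx => by simp [f.eq_zero hx, g.eq_zero hx]⟩⟩

instance : Neg (SmoothFun U) :=
  ⟨fun f => ⟨fun x => -f x, f.contDiffOn.neg, fun x hx => by simp [f.eq_zero hx]⟩⟩

instance : Sub (SmoothFun U) :=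
  ⟨fun f g => ⟨fun x => f x - g x, f.contDiffOn.sub g.contDiffOn,
    fun x hx => by simp [f.eq_zero hx, g.eq_zero hx]⟩⟩

instance {R : Type*} [Semiring R] [Module R ℂ] [SMulCommClass ℝ R ℂ] [ContinuousConstSMul R ℂ] :
    SMul R (SmoothFun U) :=
  ⟨fun c f => ⟨fun x => c • f x, f.contDiffOn.const_smul c,
    fun x hx => by simp [f.eq_zero hx]⟩⟩

instance : AddCommGroup (SmoothFun U) :=
  DFunLike.coe_injective.addCommGroup (fun f : SmoothFun U => (f : E → ℂ)) rfl
    (fun _ _ => rfl) (fun _ => rfl) (fun _ _ => rfl) (fun _ _ => rfl) (fun _ _ => rfl)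

instance : Module ℂ (SmoothFun U) :=
  DFunLike.coe_injective.module ℂ
    ({ toFun := fun f => (f : E → ℂ), map_zero' := rfl, map_add' := fun _ _ => rfl } :
      SmoothFun U →+ (E → ℂ)) (fun _ _ => rfl)

@[simp] theorem add_apply (f g : SmoothFun U) (x : E) : (f + g) x = f x + g x := rfl

@[simp] theorem smul_apply (c : ℂ) (f : SmoothFun U) (x : E) : (c • f) x = c * f x := rfl

@[simp] theorem coe_mk (f : E → ℂ) (h1 : ContDiffOn ℝ ∞ f U) (h2 : ∀ x, x ∉ U → f x = 0) :
    ((⟨f, h1, h2⟩ : SmoothFun U) : E → ℂ) = f := rfl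

/-- The topology of `C^∞(U)`: uniform convergence of all derivatives on compact subsets of `U`. -/
instance : TopologicalSpace (SmoothFun U) :=
  ⨅ k : ℕ, TopologicalSpace.induced
    (fun f : SmoothFun U =>
      UniformOnFun.ofFun {K : Set E | IsCompact K ∧ K ⊆ U} (iteratedFDerivWithin ℝ k f U))
    inferInstance

theorem tendsto_iff {ι : Type*} {p : Filter ι} {F : ι → SmoothFun U} {f : SmoothFun U} :
    Tendsto F p (𝓝 f) ↔ ∀ (k : ℕ) (K : Set E), IsCompact K → K ⊆ U →
      TendstoUniformlyOn (fun i => iteratedFDerivWithin ℝ k (F i) U)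
        (iteratedFDerivWithin ℝ k f U) p K := by
  rw [nhds_iInf, tendsto_iInf]
  refine forall_congr' fun k => ?_
  rw [nhds_induced, tendsto_comap_iff, UniformOnFun.tendsto_iff_tendstoUniformlyOn]
  exact ⟨fun h K h1 h2 => h K ⟨h1, h2⟩, fun h K hK => h K hK.1 hK.2⟩

/-- Pullback of smooth functions by a linear automorphism that preserves `U`. -/
def comp (A : E ≃L[ℝ] E) (hA : ∀ x, A x ∈ U ↔ x ∈ U) : SmoothFun U →L[ℂ] SmoothFun U where
  toFun f := ⟨fun x => f (A x),
    f.contDiffOn.comp A.contDiff.contDiffOn (fun x hx => (hA x).2 hx),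
    fun x hx => f.eq_zero (fun h => hx ((hA x).1 h))⟩
  map_add' _ _ := rfl
  map_smul' _ _ := rfl
  cont := by
    rw [continuous_iff_continuousAt]
    intro f
    have hf := tendsto_iff.1 (tendsto_id : Tendsto id (𝓝 f) (𝓝 f))
    refine tendsto_iff.2 fun k K hK hKU => ?_
    have hpre : A ⁻¹' (U : Set E) = U := Set.ext hA
    have key : ∀ g : SmoothFun U, ∀ x ∈ K,
        iteratedFDerivWithin ℝ k (fun y => g (A y)) U x =
          (iteratedFDerivWithin ℝ k g U (A x)).compContinuousLinearMap
            (fun _ => (A : E →L[ℝ] E)) := by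
      intro g x hx
      have := A.iteratedFDerivWithin_comp_right g U.isOpen.uniqueDiffOn
        (x := x) ((hA x).2 (hKU hx)) k
      rw [hpre] at this
      exact this
    have h1 := hf k (A '' K) (hK.image A.continuous) (by
      rintro _ ⟨x, hx, rfl⟩; exact (hA x).2 (hKU hx))
    have h2 : TendstoUniformlyOn
        (fun (g : SmoothFun U) x => iteratedFDerivWithin ℝ k g U (A x))
        (fun x => iteratedFDerivWithin ℝ k f U (A x)) (𝓝 f) K := by
      intro u hu
      filter_upwards [h1 u hu] with g hg x hx using hg _ (mem_image_of_mem _ hx)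
    have h3 := (ContinuousLinearMap.uniformContinuous
      (ContinuousMultilinearMap.compContinuousLinearMapL (𝕜 := ℝ) (F := ℂ)
        (fun _ : Fin k => (A : E →L[ℝ] E)))).comp_tendstoUniformlyOn h2
    refine (h3.congr ?_).congr_right ?_
    · exact Eventually.of_forall fun g x hx => (key g x hx).symm
    · intro x hx
      exact (key f x hx).symm

/-- Multiplication by a smooth function. -/
def mul (m : SmoothFun U) : SmoothFun U →L[ℂ] SmoothFun U where
  toFun f := ⟨fun x => m x * f x, m.contDiffOn.mul f.contDiffOn,
    fun x hx => by simp [f.eq_zero hx]⟩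
  map_add' f g := DFunLike.ext _ _ fun x => mul_add _ _ _
  map_smul' c f := DFunLike.ext _ _ fun x => mul_left_comm _ _ _
  cont := by
    rw [continuous_iff_continuousAt]
    intro f
    have hf := tendsto_iff.1 (tendsto_id : Tendsto id (𝓝 f) (𝓝 f))
    refine tendsto_iff.2 fun k K hK hKU => ?_
    have hu : UniqueDiffOn ℝ (U : Set E) := U.isOpen.uniqueDiffOn
    have sub : ∀ (j : ℕ) (g h : SmoothFun U), ∀ x ∈ K,
        iteratedFDerivWithin ℝ j (fun y => g y - h y) U x =
          iteratedFDerivWithin ℝ j g U x - iteratedFDerivWithin ℝ j h U x := by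
      intro j g h x hx
      have hj : ((j : ℕ∞) : WithTop ℕ∞) ≤ ∞ := by exact_mod_cast le_top
      exact iteratedFDerivWithin_sub_apply ((g.contDiffOn.of_le hj) x (hKU hx))
        ((h.contDiffOn.of_le hj) x (hKU hx)) hu (hKU hx)
    have bd : ∀ i : ℕ, ∃ C : ℝ, 0 ≤ C ∧ ∀ x ∈ K, ‖iteratedFDerivWithin ℝ i m U x‖ ≤ C := by
      intro i
      have hi : ((i : ℕ∞) : WithTop ℕ∞) ≤ ∞ := by exact_mod_cast le_top
      obtain ⟨C, hC⟩ := hK.exists_bound_of_continuousOn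
        ((m.contDiffOn.continuousOn_iteratedFDerivWithin hi hu).mono hKU)
      exact ⟨max C 0, le_max_right _ _, fun x hx => (hC x hx).trans (le_max_left _ _)⟩
    choose C hC0 hC using bd
    rw [Metric.tendstoUniformlyOn_iff]
    intro ε hε
    set B : ℝ := ∑ i ∈ Finset.range (k + 1), (k.choose i : ℝ) * C i with hB
    have hB0 : 0 ≤ B := Finset.sum_nonneg fun i _ => mul_nonneg (by positivity) (hC0 i)
    have hδ : 0 < ε / (B + 1) := by positivity
    have ev : ∀ᶠ g : SmoothFun U in 𝓝 f, ∀ j ∈ Finset.range (k + 1), ∀ x ∈ K,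
        dist (iteratedFDerivWithin ℝ j f U x) (iteratedFDerivWithin ℝ j g U x)
          < ε / (B + 1) := by
      rw [Finset.eventually_all]
      intro j _
      exact Metric.tendstoUniformlyOn_iff.1 (hf j K hK hKU) _ hδ
    filter_upwards [ev] with g hg x hx
    have e1 : iteratedFDerivWithin ℝ k (fun y => m y * f y) U x -
        iteratedFDerivWithin ℝ k (fun y => m y * g y) U x =
        iteratedFDerivWithin ℝ k (fun y => m y * (f y - g y)) U x := by
      have hk : ((k : ℕ∞) : WithTop ℕ∞) ≤ ∞ := by exact_mod_cast le_top
      rw [← iteratedFDerivWithin_sub_apply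
        (((m.contDiffOn.mul f.contDiffOn).of_le hk) x (hKU hx))
        (((m.contDiffOn.mul g.contDiffOn).of_le hk) x (hKU hx)) hu (hKU hx)]
      congr 1
      funext y
      exact (mul_sub _ _ _).symm
    have hk : ((k : ℕ∞) : WithTop ℕ∞) ≤ ∞ := by exact_mod_cast le_top
    have e2 := norm_iteratedFDerivWithin_mul_le m.contDiffOn
      (f.contDiffOn.sub g.contDiffOn) hu (hKU hx) (n := k) hk
    have e3 : ‖iteratedFDerivWithin ℝ k (fun y => m y * (f y - g y)) U x‖ ≤
        B * (ε / (B + 1)) := by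
      refine e2.trans ?_
      rw [hB, Finset.sum_mul]
      refine Finset.sum_le_sum fun i hi => ?_
      have hki : k - i ∈ Finset.range (k + 1) := by simp
      have h4 := hg (k - i) hki x hx
      rw [dist_eq_norm, ← sub (k - i) f g x hx] at h4
      have := hC i x hx
      have := hC0 i
      gcongr
    show dist (iteratedFDerivWithin ℝ k (fun y => m y * f y) U x)
      (iteratedFDerivWithin ℝ k (fun y => m y * g y) U x) < ε
    rw [dist_eq_norm, e1]
    refine e3.trans_lt ?_
    rw [mul_div_assoc', div_lt_iff₀ (by positivity)]
    nlinarith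

end SmoothFun

end SmoothFunctions

/-! ### Sections of the homogeneous line bundles over `G/P` and `G/P × G/P`

Here `G = SL(2, ℝ)` and `P` is the group of lower triangular matrices. Since the stabilizer in `G` of
the vector `e₂ = (0, 1)` is the unipotent radical of `P`, a smooth function `F` on `G` with
`F (g p) = χ(p)⁻¹ F g` is the same thing as a smooth function `Φ` on `ℝ² ∖ {0}`, `F g = Φ (g e₂)`, that
is homogeneous in the sense of `Sec` below. The Bruhat coordinate `x ∈ ℝ ⊂ G/P` corresponds to the
vector `(x, 1)`. -/

/-- The plane `ℝ²`. -/
abbrev Plane := Fin 2 → ℝ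

/-- `ℝ² ∖ {0}`. -/
def punctured : TopologicalSpace.Opens Plane := ⟨{v | v ≠ 0}, isOpen_ne⟩

/-- `(ℝ² ∖ {0}) × (ℝ² ∖ {0})`. -/
def puncturedProd : TopologicalSpace.Opens (Plane × Plane) :=
  ⟨{p | p.1 ≠ 0 ∧ p.2 ≠ 0},
    (isOpen_ne.preimage continuous_fst).inter (isOpen_ne.preimage continuous_snd)⟩

/-- `|t|^(-lam) (sgn t)^((1-ε)/2)`, the value of the character `χ_lam^ε` of `P` at a matrix with
diagonal entries `t, t⁻¹`. -/
def character (ε : ℤˣ) (lam : ℂ) (t : ℝ) : ℂ :=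
  ((|t| : ℝ) : ℂ) ^ (-lam) * if ε = 1 then 1 else (Real.sign t : ℂ)

/-- `C^∞(G/P, L_lam^ε)`. -/
def Sec (ε : ℤˣ) (lam : ℂ) : Submodule ℂ (SmoothFun punctured) where
  carrier := {f | ∀ t : ℝ, t ≠ 0 → ∀ v : Plane, f (t • v) = character ε lam t * f v}
  zero_mem' := fun t _ v => (mul_zero _).symm
  add_mem' := fun {f g} hf hg t ht v => by
    rw [SmoothFun.add_apply, SmoothFun.add_apply, hf t ht v, hg t ht v, mul_add]
  smul_mem' := fun c f hf t ht v => by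
    rw [SmoothFun.smul_apply, SmoothFun.smul_apply, hf t ht v, mul_left_comm]

/-- `C^∞(G/P × G/P, L_lam^ε ⊠ L_lam^ε)`. -/
def Sec₂ (ε : ℤˣ) (lam : ℂ) : Submodule ℂ (SmoothFun puncturedProd) where
  carrier := {f | ∀ s t : ℝ, s ≠ 0 → t ≠ 0 → ∀ v w : Plane,
    f (s • v, t • w) = character ε lam s * character ε lam t * f (v, w)}
  zero_mem' := fun s t _ _ v w => (mul_zero _).symm
  add_mem' := fun {f g} hf hg s t hs ht v w => by
    rw [SmoothFun.add_apply, SmoothFun.add_apply, hf s t hs ht v w, hg s t hs ht v w, mul_add]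
  smul_mem' := fun c f hf s t hs ht v w => by
    rw [SmoothFun.smul_apply, SmoothFun.smul_apply, hf s t hs ht v w, mul_left_comm]

/-- The expression of a section over `G/P` in the Bruhat coordinate. -/
def coord {ε : ℤˣ} {lam : ℂ} (f : Sec ε lam) (x : ℝ) : ℂ := f.1 ![x, 1]

/-- The expression of a section over `G/P × G/P` in the Bruhat coordinates. -/
def coord₂ {ε : ℤˣ} {lam : ℂ} (f : Sec₂ ε lam) (x y : ℝ) : ℂ := f.1 (![x, 1], ![y, 1])

/-- Transport of a section along an equality of parameters (the underlying function is the same). -/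
def Sec.cast {ε : ℤˣ} {lam lam' : ℂ} (h : lam = lam') (f : Sec ε lam) : Sec ε lam' :=
  ⟨f.1, h ▸ f.2⟩

/-- Transport of a section along an equality of parameters (the underlying function is the same). -/
def Sec₂.cast {ε : ℤˣ} {lam lam' : ℂ} (h : lam = lam') (f : Sec₂ ε lam) : Sec₂ ε lam' :=
  ⟨f.1, h ▸ f.2⟩

/-! ### The action of `G` -/

/-- The linear automorphism `v ↦ g⁻¹ v` of the plane. -/
def invMap (g : SL(2, ℝ)) : Plane ≃L[ℝ] Plane :=
  (Matrix.SpecialLinearGroup.toLin' g⁻¹).toContinuousLinearEquiv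

theorem invMap_apply (g : SL(2, ℝ)) (v : Plane) : invMap g v = (g⁻¹).1.mulVec v := rfl

theorem invMap_mem (g : SL(2, ℝ)) (v : Plane) : invMap g v ∈ punctured ↔ v ∈ punctured :=
  not_congr (map_eq_zero_iff _ (invMap g).injective)

/-- The action `(g f)(v) = f (g⁻¹ v)` of `G` on `C^∞(G/P, L_lam^ε)`. -/
def Sec.act {ε : ℤˣ} {lam : ℂ} (g : SL(2, ℝ)) : Sec ε lam →L[ℂ] Sec ε lam :=
  ((SmoothFun.comp (invMap g) (invMap_mem g)).comp (Sec ε lam).subtypeL).codRestrict _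
    (fun f t ht v => by
      show f.1 (invMap g (t • v)) = _ * f.1 (invMap g v)
      rw [map_smul]
      exact f.2 t ht _)

/-- The diagonal action `(g f)(v, w) = f (g⁻¹ v, g⁻¹ w)` of `G` on
`C^∞(G/P × G/P, L_lam^ε ⊠ L_lam^ε)`. -/
def Sec₂.act {ε : ℤˣ} {lam : ℂ} (g : SL(2, ℝ)) : Sec₂ ε lam →L[ℂ] Sec₂ ε lam :=
  ((SmoothFun.comp ((invMap g).prodCongr (invMap g))
    (fun p => and_congr (invMap_mem g p.1) (invMap_mem g p.2))).comp
      (Sec₂ ε lam).subtypeL).codRestrict _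
    (fun f s t hs ht v w => by
      show f.1 (invMap g (s • v), invMap g (t • w)) = _ * f.1 (invMap g v, invMap g w)
      rw [map_smul, map_smul]
      exact f.2 s t hs ht _ _)

/-- In the Bruhat coordinate the action is the multiplier representation
`|cx+d|^(-lam) (sgn (cx+d))^((1-ε)/2) f ((ax+b)/(cx+d))`, where `g⁻¹ = (a b; c d)`. -/
theorem coord_act {ε : ℤˣ} {lam : ℂ} (g : SL(2, ℝ)) (f : Sec ε lam) (x : ℝ)
    (h : (g⁻¹).1 1 0 * x + (g⁻¹).1 1 1 ≠ 0) :
    coord (Sec.act g f) x =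
      character ε lam ((g⁻¹).1 1 0 * x + (g⁻¹).1 1 1) *
        coord f (((g⁻¹).1 0 0 * x + (g⁻¹).1 0 1) / ((g⁻¹).1 1 0 * x + (g⁻¹).1 1 1)) := by
  unfold coord
  rw [← f.2 _ h]
  show f.1 (invMap g ![x, 1]) = _
  congr 1
  rw [invMap_apply]
  generalize (g⁻¹).1 = A at h ⊢
  ext i
  fin_cases i
  · simp [Matrix.mulVec, dotProduct, Fin.sum_univ_two, mul_div_cancel₀ _ h]
  · simp [Matrix.mulVec, dotProduct, Fin.sum_univ_two]

/-! ### Distribution sections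

The dual bundle of `L_lam^ε` tensored with the density bundle `L_2^+` is `L_{2-lam}^ε`, so that
`D'(G/P, L_lam^ε)` is the topological dual of `C^∞(G/P, L_{2-lam}^ε)`, and similarly over
`G/P × G/P`. -/

/-- `D'(G/P, L_lam^ε)`, with the topology of the strong dual. -/
abbrev DistSec (ε : ℤˣ) (lam : ℂ) : Type := Sec ε (2 - lam) →L[ℂ] ℂ

/-- `D'(G/P × G/P, L_lam^ε ⊠ L_lam^ε)`, with the topology of the strong dual. -/
abbrev DistSec₂ (ε : ℤˣ) (lam : ℂ) : Type := Sec₂ ε (2 - lam) →L[ℂ] ℂ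

/-- The action of `G` on distribution sections. -/
def DistSec.act {ε : ℤˣ} {lam : ℂ} (g : SL(2, ℝ)) (u : DistSec ε lam) : DistSec ε lam :=
  u.comp (Sec.act g⁻¹)

/-- The diagonal action of `G` on distribution sections over `G/P × G/P`. -/
def DistSec₂.act {ε : ℤˣ} {lam : ℂ} (g : SL(2, ℝ)) (u : DistSec₂ ε lam) : DistSec₂ ε lam :=
  u.comp (Sec₂.act g⁻¹)

theorem continuousOn_sec {ε : ℤˣ} {lam : ℂ} (f : Sec ε lam) :
    ContinuousOn f.1 (punctured : Set Plane) := f.1.contDiffOn.continuousOn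

/-- The Euclidean unit circle. -/
def unitCircle : Set Plane := {v | v 0 ^ 2 + v 1 ^ 2 = 1}

theorem unitCircle_subset : unitCircle ⊆ (punctured : Set Plane) := by
  rintro v hv (rfl : v = 0)
  simp [unitCircle] at hv

theorem isCompact_unitCircle : IsCompact unitCircle := by
  refine Metric.isCompact_of_isClosed_isBounded
    (isClosed_eq (by fun_prop) continuous_const) ?_
  refine (Metric.isBounded_closedBall (x := (0 : Plane)) (r := 1)).subset fun v hv => ?_
  rw [mem_closedBall_zero_iff, pi_norm_le_iff_of_nonneg zero_le_one]
  have hv' : v 0 ^ 2 + v 1 ^ 2 = 1 := hv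
  intro i
  rw [Real.norm_eq_abs, ← sq_le_one_iff_abs_le_one]
  fin_cases i
  · show v 0 ^ 2 ≤ 1
    nlinarith [sq_nonneg (v 1)]
  · show v 1 ^ 2 ≤ 1
    nlinarith [sq_nonneg (v 0)]

/-- The product of a section of `L_lam^ε` and a section of `L_{2-lam}^ε` is a density. -/
theorem coord_mul_coord {ε : ℤˣ} {lam : ℂ} (h : Sec ε lam) (f : Sec ε (2 - lam)) (x : ℝ) :
    ∃ v ∈ unitCircle, coord h x * coord f x = ((1 + x ^ 2)⁻¹ : ℝ) * (h.1 v * f.1 v) := by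
  set r : ℝ := Real.sqrt (1 + x ^ 2) with hr
  have hpos : 0 < 1 + x ^ 2 := by positivity
  have hr0 : 0 < r := Real.sqrt_pos.2 hpos
  have hr2 : r ^ 2 = 1 + x ^ 2 := Real.sq_sqrt hpos.le
  refine ⟨r⁻¹ • ![x, 1], ?_, ?_⟩
  · show (r⁻¹ • ![x, 1]) 0 ^ 2 + (r⁻¹ • ![x, 1]) 1 ^ 2 = 1
    simp only [Pi.smul_apply, smul_eq_mul, Matrix.cons_val_zero, Matrix.cons_val_one, mul_pow,
      inv_pow, hr2]
    field_simp
    ring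
  · have e : (![x, 1] : Plane) = r • (r⁻¹ • ![x, 1]) := by
      rw [smul_smul, mul_inv_cancel₀ hr0.ne', one_smul]
    unfold coord
    generalize r⁻¹ • ![x, 1] = w at e
    rw [e, h.2 r hr0.ne', f.2 r hr0.ne']
    have hc : character ε lam r * character ε (2 - lam) r = ((1 + x ^ 2)⁻¹ : ℝ) := by
      have h1 : (r : ℂ) ≠ 0 := by exact_mod_cast hr0.ne'
      unfold character
      rw [abs_of_pos hr0, Real.sign_of_pos hr0]
      simp only [Complex.ofReal_one, ite_self, mul_one]
      rw [← Complex.cpow_add _ _ h1, ← hr2]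
      have : -lam + -(2 - lam) = ((-2 : ℤ) : ℂ) := by push_cast; ring
      rw [this, Complex.cpow_intCast]
      push_cast
      rfl
    rw [← hc]
    ring

theorem continuous_coord {ε : ℤˣ} {lam : ℂ} (f : Sec ε lam) : Continuous (coord f) := by
  refine (continuousOn_sec f).comp_continuous (f := fun x : ℝ => ![x, 1]) (by fun_prop) fun x => ?_
  intro h
  have := congrFun h 1
  simp at this

theorem exists_bound {ε : ℤˣ} {lam : ℂ} (f : Sec ε lam) :
    ∃ C : ℝ, 0 ≤ C ∧ ∀ v ∈ unitCircle, ‖f.1 v‖ ≤ C := by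
  obtain ⟨C, hC⟩ := isCompact_unitCircle.exists_bound_of_continuousOn
    ((continuousOn_sec f).mono unitCircle_subset)
  exact ⟨max C 0, le_max_right _ _, fun v hv => (hC v hv).trans (le_max_left _ _)⟩

theorem integrable_coord_mul {ε : ℤˣ} {lam : ℂ} (h : Sec ε lam) (f : Sec ε (2 - lam)) :
    Integrable fun x => coord h x * coord f x := by
  obtain ⟨C, hC0, hC⟩ := exists_bound h
  obtain ⟨D, hD0, hD⟩ := exists_bound f
  refine (integrable_inv_one_add_sq.mul_const (C * D)).mono'
    ((continuous_coord h).mul (continuous_coord f)).aestronglyMeasurable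
    (Eventually.of_forall fun x => ?_)
  obtain ⟨v, hv, e⟩ := coord_mul_coord h f x
  have hp : 0 ≤ (1 + x ^ 2)⁻¹ := by positivity
  rw [e, norm_mul, norm_mul, Complex.norm_real, Real.norm_eq_abs, abs_of_nonneg hp]
  have h1 := hC v hv
  have h2 := hD v hv
  gcongr

/-- The embedding `C^∞(G/P, L_lam^ε) ⊂ D'(G/P, L_lam^ε)` given by `⟨h, f⟩ = ∫ h(x) f(x) dx` in the
Bruhat coordinate. -/
def DistSec.ofSection {ε : ℤˣ} {lam : ℂ} (h : Sec ε lam) : DistSec ε lam where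
  toFun f := ∫ x : ℝ, coord h x * coord f x
  map_add' f g := by
    rw [← integral_add (integrable_coord_mul h f) (integrable_coord_mul h g)]
    refine integral_congr_ae (Eventually.of_forall fun x => ?_)
    exact mul_add _ _ _
  map_smul' c f := by
    rw [RingHom.id_apply, ← integral_smul]
    refine integral_congr_ae (Eventually.of_forall fun x => ?_)
    exact mul_left_comm _ _ _
  cont := by
    obtain ⟨C, hC0, hC⟩ := exists_bound h
    rw [continuous_iff_continuousAt]
    intro f
    rw [ContinuousAt, Metric.tendsto_nhds]
    intro δ hδ
    have hI : 0 ≤ ∫ x : ℝ, (1 + x ^ 2)⁻¹ := integral_nonneg fun x => by positivity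
    set I : ℝ := ∫ x : ℝ, (1 + x ^ 2)⁻¹ with hIdef
    have hη : 0 < δ / (C * I + 1) := by positivity
    have hf := SmoothFun.tendsto_iff.1
      ((continuous_subtype_val (p := fun f => f ∈ Sec ε (2 - lam))).tendsto f) 0 unitCircle
      isCompact_unitCircle unitCircle_subset
    filter_upwards [Metric.tendstoUniformlyOn_iff.1 hf _ hη] with g hg
    rw [dist_comm, dist_eq_norm,
      ← integral_sub (integrable_coord_mul h f) (integrable_coord_mul h g)]
    have hb : ∀ v ∈ unitCircle, ‖(f - g).1 v‖ ≤ δ / (C * I + 1) := by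
      intro v hv
      have h1 := (hg v hv).le
      rw [dist_eq_norm, ← iteratedFDerivWithin_sub_apply
        ((f.1.contDiffOn.of_le (by exact_mod_cast le_top)) v (unitCircle_subset hv))
        ((g.1.contDiffOn.of_le (by exact_mod_cast le_top)) v (unitCircle_subset hv))
        punctured.isOpen.uniqueDiffOn (unitCircle_subset hv), norm_iteratedFDerivWithin_zero] at h1
      exact h1
    have e : ∀ x, coord h x * coord f x - coord h x * coord g x = coord h x * coord (f - g) x :=
      fun x => (mul_sub _ _ _).symm
    have hle : ‖∫ x : ℝ, (coord h x * coord f x - coord h x * coord g x)‖ ≤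
        ∫ x : ℝ, (1 + x ^ 2)⁻¹ * (C * (δ / (C * I + 1))) := by
      refine norm_integral_le_of_norm_le (integrable_inv_one_add_sq.mul_const _)
        (Eventually.of_forall fun x => ?_)
      rw [e]
      obtain ⟨v, hv, e'⟩ := coord_mul_coord h (f - g) x
      have hp : 0 ≤ (1 + x ^ 2)⁻¹ := by positivity
      rw [e', norm_mul, norm_mul, Complex.norm_real, Real.norm_eq_abs, abs_of_nonneg hp]
      have h1 := hC v hv
      have h2 := hb v hv
      gcongr
    refine hle.trans_lt ?_
    rw [integral_mul_const, ← hIdef, mul_div_assoc', mul_div_assoc', div_lt_iff₀ (by positivity)]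
    nlinarith

/-! ### Change of parameter

The function `r(v)^s`, `r` the Euclidean norm on `ℝ²`, is `SO(2)`-invariant and homogeneous. It
trivializes the line bundles `L_lam^+` simultaneously (compact picture), and lets one speak of
holomorphic dependence on the parameter of the bundle. -/

/-- The function `v ↦ r(v)^s` on `ℝ² ∖ {0}`. -/
def normPow (s : ℂ) : SmoothFun punctured where
  toFun v := if v = 0 then 0 else ((v 0 ^ 2 + v 1 ^ 2 : ℝ) : ℂ) ^ (s / 2)
  contDiffOn' := by
    have pos : ∀ v : Plane, v ≠ 0 → 0 < v 0 ^ 2 + v 1 ^ 2 := by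
      intro v hv
      by_contra h
      push Not at h
      have h0 : v 0 = 0 := by nlinarith [sq_nonneg (v 0), sq_nonneg (v 1)]
      have h1 : v 1 = 0 := by nlinarith [sq_nonneg (v 0), sq_nonneg (v 1)]
      exact hv (by ext i; fin_cases i <;> assumption)
    have h1 : ContDiffOn ℝ ∞ (fun v : Plane =>
        Complex.exp ((Real.log (v 0 ^ 2 + v 1 ^ 2) : ℂ) * (s / 2))) punctured := by
      refine Complex.contDiff_exp.comp_contDiffOn (ContDiffOn.mul ?_ contDiffOn_const)
      refine Complex.ofRealCLM.contDiff.comp_contDiffOn (ContDiffOn.log ?_ ?_)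
      · exact ContDiff.contDiffOn (by fun_prop)
      · exact fun v hv => (pos v hv).ne'
    refine h1.congr fun v hv => ?_
    have hv' : v ≠ 0 := hv
    rw [if_neg hv', Complex.cpow_def_of_ne_zero (by exact_mod_cast (pos v hv').ne'),
      Complex.ofReal_log (pos v hv').le]
  eq_zero' v hv := if_pos (not_not.1 hv)

theorem normPow_smul (s : ℂ) {t : ℝ} (ht : t ≠ 0) (v : Plane) :
    normPow s (t • v) = ((|t| : ℝ) : ℂ) ^ s * normPow s v := by
  show (if t • v = 0 then 0 else (((t • v) 0 ^ 2 + (t • v) 1 ^ 2 : ℝ) : ℂ) ^ (s / 2)) =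
    _ * (if v = 0 then 0 else ((v 0 ^ 2 + v 1 ^ 2 : ℝ) : ℂ) ^ (s / 2))
  by_cases hv : v = 0
  · simp [hv]
  · rw [if_neg hv, if_neg (smul_ne_zero ht hv)]
    have e : (t • v) 0 ^ 2 + (t • v) 1 ^ 2 = |t| ^ 2 * (v 0 ^ 2 + v 1 ^ 2) := by
      rw [sq_abs]; simp only [Pi.smul_apply, smul_eq_mul]; ring
    rw [e, Complex.ofReal_mul, Complex.mul_cpow_ofReal_nonneg (by positivity) (by positivity)]
    congr 1
    rw [Complex.ofReal_pow, ← Complex.cpow_nat_mul' (x := ((|t| : ℝ) : ℂ)) (n := 2)]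
    · congr 1; push_cast; ring
    · rw [Complex.arg_ofReal_of_nonneg (abs_nonneg t)]; simp [Real.pi_pos]
    · rw [Complex.arg_ofReal_of_nonneg (abs_nonneg t)]; simp [Real.pi_pos.le]

/-- The isomorphism `f ↦ r^(lam - lam') f` of `C^∞(G/P, L_lam^ε)` onto `C^∞(G/P, L_lam'^ε)`. -/
def Sec.twist {ε : ℤˣ} {lam : ℂ} (lam' : ℂ) : Sec ε lam →L[ℂ] Sec ε lam' :=
  ((SmoothFun.mul (normPow (lam - lam'))).comp (Sec ε lam).subtypeL).codRestrict _
    (fun f t ht v => by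
      show normPow (lam - lam') (t • v) * f.1 (t • v) = _ * (normPow (lam - lam') v * f.1 v)
      have h0 : ((|t| : ℝ) : ℂ) ≠ 0 := by exact_mod_cast (abs_pos.2 ht).ne'
      have e : character ε lam' t = ((|t| : ℝ) : ℂ) ^ (lam - lam') * character ε lam t := by
        unfold character
        rw [← mul_assoc, ← Complex.cpow_add _ _ h0]
        congr 2
        ring
      rw [normPow_smul _ ht, f.2 t ht v, e]
      ring)

/-- The isomorphism `u ↦ r^(lam - lam') u` of `D'(G/P, L_lam^ε)` onto `D'(G/P, L_lam'^ε)`. -/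
def DistSec.twist {ε : ℤˣ} {lam : ℂ} (lam' : ℂ) (u : DistSec ε lam) : DistSec ε lam' :=
  u.comp (Sec.twist (2 - lam))

/-- `F i` (`i` in an index set) is a meromorphic family of functions on `ℂ`: all `F i` are
holomorphic off `S`, and at each point they have at most a pole, of an order bounded independently
of `i`. The values at the points of `S` play no role. -/
def IsMeromorphicFamily {ι : Type*} (S : Set ℂ) (F : ι → ℂ → ℂ) : Prop :=
  (∀ i, DifferentiableOn ℂ (F i) Sᶜ) ∧
    ∀ s ∈ S, ∃ n : ℕ, ∀ i, AnalyticAt ℂ (fun z => (z - s) ^ n * F i z) s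

/-! ### The kernel -/

/-- `t_+^mu` (for `σ = 1`) and `t_-^mu` (for `σ = -1`). -/
def halfPow (σ : ℤˣ) (t : ℝ) (mu : ℂ) : ℂ :=
  if 0 < ((σ : ℤ) : ℝ) * t then ((((σ : ℤ) : ℝ) * t : ℝ) : ℂ) ^ mu else 0

/-- `K_±^mu(x, y; z) = ((x - z)(y - z)/(x - y))_±^mu`. -/
def K (σ : ℤˣ) (mu : ℂ) (x y z : ℝ) : ℂ := halfPow σ ((x - z) * (y - z) / (x - y)) mu

/-- The strip in which all the integrals below converge absolutely. -/
def strip : Set ℂ := {mu | -1 < mu.re ∧ mu.re < 0}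

/-- `T` is the family of symmetry breaking operators
`T_mu^σ : C^∞(G/P × G/P, L ⊠ L) → C^∞(G/P, L_{-2mu})`, where `L = L_1^-`: for `mu` in the strip it is
the integral operator with kernel `-(2πi)⁻¹ K_{-σ}^mu(x, y; z)/(x - y)`; it depends meromorphically
on `mu`, with poles in `S`; and it is `G`-intertwining. -/
structure IsSymmetryBreakingFamily (σ : ℤˣ) (S : Set ℂ)
    (T : ∀ mu : ℂ, Sec₂ (-1) 1 →L[ℂ] Sec 1 (-2 * mu)) : Prop where
  integrable : ∀ mu ∈ strip, ∀ (f : Sec₂ (-1) 1) (z : ℝ),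
    Integrable (fun p : ℝ × ℝ => coord₂ f p.1 p.2 * K (-σ) mu p.1 p.2 z / ((p.1 - p.2 : ℝ) : ℂ))
  formula : ∀ mu ∈ strip, ∀ (f : Sec₂ (-1) 1) (z : ℝ),
    coord (T mu f) z = -1 / (2 * Real.pi * Complex.I) *
      ∫ p : ℝ × ℝ, coord₂ f p.1 p.2 * K (-σ) mu p.1 p.2 z / ((p.1 - p.2 : ℝ) : ℂ)
  meromorphic : IsMeromorphicFamily S
    (fun (i : (Sec 1 0 →L[ℂ] ℂ) × Sec₂ (-1) 1) mu => i.1 (Sec.twist 0 (T mu i.2)))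
  equivariant : ∀ mu ∉ S, ∀ (g : SL(2, ℝ)) (f : Sec₂ (-1) 1),
    T mu (Sec₂.act g f) = Sec.act g (T mu f)

theorem one_eq_two_sub_one : (1 : ℂ) = 2 - 1 := by norm_num

theorem neg_two_mul_eq (mu : ℂ) : -2 * mu = 2 - (2 * mu + 2) := by ring

/-- `H` consists of the dual operators of the operators `T`, multiplied by `-2πi`:
`⟨H_mu h, f⟩ = -2πi ⟨h, T_mu f⟩` for all `h` in `D'(G/P, L_{2mu+2})`, the dual of
`C^∞(G/P, L_{-2mu})`, and all `f` in `C^∞(G/P × G/P, L ⊠ L)`. -/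
def IsDualFamily (S : Set ℂ) (T : ∀ mu : ℂ, Sec₂ (-1) 1 →L[ℂ] Sec 1 (-2 * mu))
    (H : ∀ mu : ℂ, DistSec 1 (2 * mu + 2) →L[ℂ] DistSec₂ (-1) 1) : Prop :=
  ∀ mu ∉ S, ∀ (h : DistSec 1 (2 * mu + 2)) (f : Sec₂ (-1) 1),
    H mu h (Sec₂.cast one_eq_two_sub_one f) =
      -(2 * Real.pi * Complex.I) * h (Sec.cast (neg_two_mul_eq mu) (T mu f))

/-- The function `(x - y)⁻¹ ∫ h(z) K_{-σ}^mu(x, y; z) dz`. -/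
def holographicIntegral (σ : ℤˣ) (mu : ℂ) (h : Sec 1 (2 * mu + 2)) (x y : ℝ) : ℂ :=
  1 / ((x - y : ℝ) : ℂ) * ∫ z : ℝ, coord h z * K (-σ) mu x y z

end Holographic

end

open Holographic

/-! A section is a homogeneous function on the punctured plane, and every u ≠ 0 gives an affine
coordinate of the projective line with the line through u at infinity: p ↦ `lineMap p u` = rot u + p
u. For u = (z, 1) it is related to the Bruhat coordinate by x = z + (1 + z²)/(p - z). This
substitution turns (x - z)(y - z)/(x - y) into |u|²/(q - p), so that the three singular loci of the
kernel merge into a power of q - p. Writing τ = ±1 for the sign of the half power and c(s) = `corr τ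
f u s` for the integral of f(`lineMap p u`, `lineMap q u`) over the pairs with q - p = τ s, the
operator becomes a Mellin transform, τ |u|^(2+2mu) ∫_0^∞ s^(-mu-1) c(s) ds, up to the constant
-1/(2πi) (`breakingIntegrand_inversion`, `integral_breakingIntegrand`).

In the strip, `lineMap p` is √(1+p²) times a rotation, so homogeneity makes the operator an average
of f over pairs of rotations of u with an integrable weight. Such averages are smooth in u, and each
seminorm is bounded by the L¹ norm of the weight (`exists_norm_avg_le`). This gives continuity of
the operators and, by differentiating the weight, weak holomorphy in mu (`hasDerivAt_avgOp`).

For the continuation the integral is cut at s = 1. Near 0, c is differentiable with c' again of the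
form `corr`, and integration by parts moves Re mu to the right. At infinity the leading terms to
expect are s⁻¹ and s⁻¹ log s, both killed by the square of s d/ds + 1. This Euler operator comes
from a differential operator on f (`mul_deriv_corr`), and its square is, under the integral, a
derivative plus s⁻¹ times another `corr` (`corr_opE_opE`), which moves Re mu to the left at the
price of (mu+1)⁻². The differential operators involve u only through the coefficients u_i u_j/|u|²,
so each step stays among continuous operators between sections, and all poles are integers.

The inverse of g carries the coordinate at u affinely to the coordinate at g⁻¹u, with ratio
|u|²/|g⁻¹u|². Hence c is rescaled and the power of |u| restores invariance in the strip
(`mellinOp_act`); the identity theorem on the connected complement of the integers does the rest.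
The holographic operators are transposes and inherit continuity, equivariance and meromorphy. Their
integral formula is Fubini's theorem: the absolute integral of the kernel against f is O((1+z²)^(Re
mu)) and h(z) is O((1+z²)^(-Re mu-1)). -/

noncomputable section

namespace Holographic

/-! ### Calculus in `C^∞(U)` and continuity criteria -/

namespace SmoothFun

variable {E F : Type*} [NormedAddCommGroup E] [NormedSpace ℝ E]
  [NormedAddCommGroup F] [NormedSpace ℝ F]
  {U : TopologicalSpace.Opens E} {V : TopologicalSpace.Opens F}

/-- The smooth function on `U` with the values of `g`. -/
def ofContDiffOn (g : E → ℂ) (hg : ContDiffOn ℝ ∞ g U) : SmoothFun U where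
  toFun := (U : Set E).indicator g
  contDiffOn' := hg.congr fun _ hx => indicator_of_mem hx g
  eq_zero' _ hx := indicator_of_notMem hx g

theorem ofContDiffOn_apply {g : E → ℂ} (hg : ContDiffOn ℝ ∞ g U) {x : E} (hx : x ∈ U) :
    ofContDiffOn g hg x = g x := indicator_of_mem hx g

theorem ext_on {f g : SmoothFun U} (h : ∀ x ∈ U, f x = g x) : f = g :=
  DFunLike.ext _ _ fun x => by
    by_cases hx : x ∈ U
    · exact h x hx
    · rw [f.eq_zero hx, g.eq_zero hx]

theorem differentiableAt (f : SmoothFun U) {x : E} (hx : x ∈ U) : DifferentiableAt ℝ f x :=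
  (f.contDiffOn.contDiffAt (U.isOpen.mem_nhds hx)).differentiableAt (by simp)

theorem contDiffOn_fderiv (f : SmoothFun U) : ContDiffOn ℝ ∞ (fderiv ℝ f) U :=
  f.contDiffOn.fderiv_of_isOpen U.isOpen (by simp)

theorem iteratedFDerivWithin_sub (f g : SmoothFun U) (k : ℕ) {x : E} (hx : x ∈ U) :
    iteratedFDerivWithin ℝ k (f - g : SmoothFun U) U x =
      iteratedFDerivWithin ℝ k f U x - iteratedFDerivWithin ℝ k g U x := by
  have hk : ((k : ℕ∞) : WithTop ℕ∞) ≤ ∞ := by exact_mod_cast le_top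
  exact iteratedFDerivWithin_sub_apply ((f.contDiffOn.of_le hk) x hx)
    ((g.contDiffOn.of_le hk) x hx) U.isOpen.uniqueDiffOn hx

theorem tendsto_iff_norm {ι : Type*} {p : Filter ι} {F : ι → SmoothFun U} {f : SmoothFun U} :
    Tendsto F p (𝓝 f) ↔ ∀ (k : ℕ) (K : Set E), IsCompact K → K ⊆ U → ∀ ε > 0, ∀ᶠ i in p,
      ∀ x ∈ K, ‖iteratedFDerivWithin ℝ k (F i - f : SmoothFun U) U x‖ < ε := by
  rw [tendsto_iff]
  refine forall_congr' fun k => forall_congr' fun K => forall_congr' fun _ => forall_congr' fun hKU => ?_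
  rw [Metric.tendstoUniformlyOn_iff]
  refine forall_congr' fun ε => forall_congr' fun _ => eventually_congr (Eventually.of_forall fun i => ?_)
  refine forall_congr' fun x => forall_congr' fun hx => ?_
  rw [dist_comm, dist_eq_norm, iteratedFDerivWithin_sub _ _ _ (hKU hx)]

theorem iteratedFDerivWithin_add (f g : SmoothFun U) (k : ℕ) {x : E} (hx : x ∈ U) :
    iteratedFDerivWithin ℝ k (f + g : SmoothFun U) U x =
      iteratedFDerivWithin ℝ k f U x + iteratedFDerivWithin ℝ k g U x := by
  have hk : ((k : ℕ∞) : WithTop ℕ∞) ≤ ∞ := by exact_mod_cast le_top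
  exact iteratedFDerivWithin_add_apply ((f.contDiffOn.of_le hk) x hx)
    ((g.contDiffOn.of_le hk) x hx) U.isOpen.uniqueDiffOn hx

theorem iteratedFDerivWithin_smul (c : ℂ) (f : SmoothFun U) (k : ℕ) {x : E} (hx : x ∈ U) :
    iteratedFDerivWithin ℝ k (c • f : SmoothFun U) U x =
      c • iteratedFDerivWithin ℝ k f U x := by
  have hk : ((k : ℕ∞) : WithTop ℕ∞) ≤ ∞ := by exact_mod_cast le_top
  exact iteratedFDerivWithin_const_smul_apply (R := ℂ) (a := c) ((f.contDiffOn.of_le hk) x hx)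
    U.isOpen.uniqueDiffOn hx

instance : ContinuousAdd (SmoothFun U) where
  continuous_add := by
    rw [continuous_iff_continuousAt]
    rintro ⟨f, g⟩
    refine tendsto_iff_norm.2 fun k K hK hKU ε hε => ?_
    have h1 := tendsto_iff_norm.1 (continuous_fst.tendsto (f, g)) k K hK hKU (ε / 2) (half_pos hε)
    have h2 := tendsto_iff_norm.1 (continuous_snd.tendsto (f, g)) k K hK hKU (ε / 2) (half_pos hε)
    filter_upwards [h1, h2] with q hq1 hq2 x hx
    have e : q.1 + q.2 - (f + g) = (q.1 - f) + (q.2 - g) := by abel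
    change ‖iteratedFDerivWithin ℝ k (q.1 + q.2 - (f + g) : SmoothFun U) U x‖ < ε
    rw [e, iteratedFDerivWithin_add _ _ _ (hKU hx)]
    exact (norm_add_le _ _).trans_lt (by linarith [hq1 x hx, hq2 x hx])

instance : ContinuousConstSMul ℂ (SmoothFun U) where
  continuous_const_smul c := by
    rw [continuous_iff_continuousAt]
    intro f
    refine tendsto_iff_norm.2 fun k K hK hKU ε hε => ?_
    have hδ : 0 < ε / (‖c‖ + 1) := by positivity
    filter_upwards [tendsto_iff_norm.1 (tendsto_id (x := 𝓝 f)) k K hK hKU _ hδ] with g hg x hx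
    rw [← smul_sub, iteratedFDerivWithin_smul _ _ _ (hKU hx), norm_smul]
    have h1 := hg x hx
    rw [lt_div_iff₀ (by positivity)] at h1
    rw [id_eq] at h1
    nlinarith [norm_nonneg (iteratedFDerivWithin ℝ k (g - f : SmoothFun U) U x)]

instance : IsTopologicalAddGroup (SmoothFun U) where
  continuous_neg := by simpa using continuous_const_smul (T := SmoothFun U) (-1 : ℂ)

/-- The directional derivative of a smooth function. -/
def dirDeriv (e : E) (f : SmoothFun U) : SmoothFun U :=
  ofContDiffOn (fun x => fderiv ℝ f x e) (f.contDiffOn_fderiv.clm_apply contDiffOn_const)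

theorem dirDeriv_apply (e : E) (f : SmoothFun U) {x : E} (hx : x ∈ U) :
    dirDeriv e f x = fderiv ℝ f x e := ofContDiffOn_apply _ hx

theorem fderiv_add_apply (f g : SmoothFun U) {x : E} (hx : x ∈ U) :
    fderiv ℝ (f + g : SmoothFun U) x = fderiv ℝ f x + fderiv ℝ g x :=
  fderiv_add (f.differentiableAt hx) (g.differentiableAt hx)

theorem fderiv_smul_apply (c : ℂ) (f : SmoothFun U) {x : E} (hx : x ∈ U) :
    fderiv ℝ (c • f : SmoothFun U) x = c • fderiv ℝ f x :=
  fderiv_const_smul (f.differentiableAt hx) c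

theorem dirDeriv_add (e : E) (f g : SmoothFun U) :
    dirDeriv e (f + g) = dirDeriv e f + dirDeriv e g :=
  ext_on fun x hx => by
    rw [add_apply, dirDeriv_apply e _ hx, dirDeriv_apply e _ hx, dirDeriv_apply e _ hx,
      fderiv_add_apply f g hx]
    rfl

theorem dirDeriv_smul (e : E) (c : ℂ) (f : SmoothFun U) :
    dirDeriv e (c • f) = c • dirDeriv e f :=
  ext_on fun x hx => by
    rw [smul_apply, dirDeriv_apply e _ hx, dirDeriv_apply e _ hx, fderiv_smul_apply c f hx]
    rfl

theorem norm_iteratedFDerivWithin_dirDeriv_le (e : E) (f : SmoothFun U) (k : ℕ) {x : E}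
    (hx : x ∈ U) : ‖iteratedFDerivWithin ℝ k (dirDeriv e f) U x‖ ≤
      ‖e‖ * ‖iteratedFDerivWithin ℝ (k + 1) f U x‖ := by
  have hu := U.isOpen.uniqueDiffOn (𝕜 := ℝ)
  have hk : ((k : ℕ∞) : WithTop ℕ∞) ≤ ∞ := by exact_mod_cast le_top
  have h1 : EqOn (dirDeriv e f) (fun y => fderivWithin ℝ f U y e) U := fun y hy => by
    simp only [dirDeriv_apply e f hy, fderivWithin_of_isOpen U.isOpen hy]
  rw [iteratedFDerivWithin_congr h1 hx, ← norm_iteratedFDerivWithin_fderivWithin hu hx]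
  have h2 : ContDiffOn ℝ ∞ (fderivWithin ℝ f U) U :=
    f.contDiffOn.fderivWithin hu (by simp)
  exact norm_iteratedFDerivWithin_clm_apply_const ((h2 x hx).of_le hk) hu hx le_rfl

/-- The derivative of f is the sum of the directional derivatives along the basis times the dual
functionals, and fixed bounded linear maps cost only their norms. Estimates of all derivatives can
then be proved by induction on the order, replacing f by its directional derivatives. -/
theorem exists_norm_iteratedFDerivWithin_succ_le [FiniteDimensional ℝ E] {κ : Type*} [Fintype κ]
    (b : Module.Basis κ ℝ E) : ∃ c : κ → ℝ, (∀ i, 0 ≤ c i) ∧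
      ∀ (f : SmoothFun U) (k : ℕ), ∀ x ∈ U, ‖iteratedFDerivWithin ℝ (k + 1) f U x‖ ≤
        ∑ i, c i * ‖iteratedFDerivWithin ℝ k (dirDeriv (b i) f) U x‖ := by
  set Φ : κ → ℂ →L[ℝ] E →L[ℝ] ℂ := fun i =>
    ContinuousLinearMap.smulRightL ℝ E ℂ (b.coord i).toContinuousLinearMap with hΦ
  refine ⟨fun i => ‖Φ i‖, fun i => norm_nonneg (Φ i), fun f k x hx => ?_⟩
  have hu := U.isOpen.uniqueDiffOn (𝕜 := ℝ)
  have hk : ((k : ℕ∞) : WithTop ℕ∞) ≤ ∞ := by exact_mod_cast le_top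
  have h1 : EqOn (fderivWithin ℝ f U) (fun y => ∑ i, Φ i (dirDeriv (b i) f y)) U := fun y hy => by
    ext z
    rw [fderivWithin_of_isOpen U.isOpen hy, sum_apply]
    conv_lhs => rw [← b.sum_repr z, map_sum]
    refine Finset.sum_congr rfl fun i _ => ?_
    simp [hΦ, dirDeriv_apply _ _ hy]
  have h0 : ∀ i, ContDiffOn ℝ k (dirDeriv (b i) f) U := fun i =>
    (dirDeriv (b i) f).contDiffOn.of_le hk
  rw [← norm_iteratedFDerivWithin_fderivWithin hu hx, iteratedFDerivWithin_congr h1 hx,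
    iteratedFDerivWithin_fun_sum_apply hu hx
      (f := fun i y => Φ i (dirDeriv (b i) f y))
      (fun i _ => ((Φ i).contDiff.comp_contDiffOn (h0 i)) x hx)]
  refine (norm_sum_le _ _).trans (Finset.sum_le_sum fun i _ => ?_)
  have h3 := (Φ i).iteratedFDerivWithin_comp_left (h0 i x hx) hu hx le_rfl
  change ‖iteratedFDerivWithin ℝ k (Φ i ∘ dirDeriv (b i) f) U x‖ ≤ _
  rw [h3]
  exact ContinuousLinearMap.norm_compContinuousMultilinearMap_le _ _

/-- A linear map into `C^∞(U)` is continuous if the derivatives of its values are controlled by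
those of the argument. -/
theorem continuous_of_bound {X : Submodule ℂ (SmoothFun V)} (T : X →ₗ[ℂ] SmoothFun U)
    (h : ∀ (k : ℕ) (K : Set E), IsCompact K → K ⊆ U → ∃ (C : ℝ) (n : ℕ) (L : Set F),
      IsCompact L ∧ L ⊆ V ∧ ∀ (f : X) (c : ℝ), 0 ≤ c →
        (∀ j ≤ n, ∀ y ∈ L, ‖iteratedFDerivWithin ℝ j f.1 V y‖ ≤ c) →
        ∀ x ∈ K, ‖iteratedFDerivWithin ℝ k (T f) U x‖ ≤ C * c) : Continuous T := by
  rw [continuous_iff_continuousAt]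
  intro f
  refine tendsto_iff_norm.2 fun k K hK hKU ε hε => ?_
  obtain ⟨C, n, L, hL, hLV, hC⟩ := h k K hK hKU
  have hf := tendsto_iff_norm.1 ((continuous_subtype_val (p := fun f => f ∈ X)).tendsto f)
  have hδ : 0 < ε / (|C| + 1) := by positivity
  have ev : ∀ᶠ g : X in 𝓝 f, ∀ j ∈ Finset.range (n + 1), ∀ y ∈ L,
      ‖iteratedFDerivWithin ℝ j (g.1 - f.1 : SmoothFun V) V y‖ < ε / (|C| + 1) := by
    rw [Finset.eventually_all]
    exact fun j _ => hf j L hL hLV _ hδ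
  filter_upwards [ev] with g hg x hx
  rw [← map_sub]
  refine (hC (g - f) _ hδ.le (fun j hj y hy => (hg j (by simp; omega) y hy).le) x hx).trans_lt ?_
  rw [mul_div_assoc', div_lt_iff₀ (by positivity)]
  nlinarith [le_abs_self C]

/-- The directional derivative, as a continuous operator. -/
def dirDerivL (e : E) : SmoothFun U →L[ℂ] SmoothFun U where
  toFun := dirDeriv e
  map_add' := dirDeriv_add e
  map_smul' := dirDeriv_smul e
  cont := by
    have h := continuous_of_bound (X := (⊤ : Submodule ℂ (SmoothFun U)))
      ({ toFun := fun f => dirDeriv e f.1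
         map_add' := fun f g => dirDeriv_add e f.1 g.1
         map_smul' := fun c f => dirDeriv_smul e c f.1 } : _ →ₗ[ℂ] SmoothFun U)
      (fun k K hK hKU => ⟨‖e‖, k + 1, K, hK, hKU, fun f c _ hf x hx =>
        (norm_iteratedFDerivWithin_dirDeriv_le e f.1 k (hKU hx)).trans
          (mul_le_mul_of_nonneg_left (hf _ le_rfl x hx) (norm_nonneg _))⟩)
    exact h.comp (continuous_id.subtype_mk fun _ => Submodule.mem_top)

theorem contDiffOn_fderiv_apply (Y : E →L[ℝ] E) (f : SmoothFun U) :
    ContDiffOn ℝ ∞ (fun x => fderiv ℝ f x (Y x)) U :=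
  f.contDiffOn_fderiv.clm_apply Y.contDiff.contDiffOn

/-- The derivative of smooth functions along a linear vector field. -/
def alongLinear [FiniteDimensional ℝ E] (Y : E →L[ℝ] E) : SmoothFun U →L[ℂ] SmoothFun U where
  toFun f := ofContDiffOn _ (contDiffOn_fderiv_apply Y f)
  map_add' f g := ext_on fun x hx => by
    simp only [add_apply, ofContDiffOn_apply _ hx, fderiv_add_apply f g hx]
    rfl
  map_smul' c f := ext_on fun x hx => by
    simp only [RingHom.id_apply, smul_apply, ofContDiffOn_apply _ hx, fderiv_smul_apply c f hx]
    rfl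
  cont := by
    -- In a basis the operator is a finite sum of constant-direction derivatives multiplied by the
    -- smooth coordinates of Y x, and both ingredients are already continuous.
    set b := Module.finBasis ℝ E
    have hm : ∀ i, ContDiffOn ℝ ∞ (fun x : E => ((b.coord i (Y x) : ℝ) : ℂ)) U := fun i =>
      (Complex.ofRealCLM.contDiff.comp
        ((b.coord i).toContinuousLinearMap.contDiff.comp Y.contDiff)).contDiffOn
    have h : Continuous fun f : SmoothFun U =>
        ∑ i, mul (ofContDiffOn _ (hm i)) (dirDerivL (b i) f) :=
      continuous_finsetSum _ fun i _ => ((mul _).continuous.comp (dirDerivL (b i)).continuous)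
    refine h.congr fun f => ext_on fun x hx => ?_
    rw [ofContDiffOn_apply _ hx]
    have e : ∀ g : SmoothFun U, (AddMonoidHom.mk' (fun g : SmoothFun U => g x)
      (fun _ _ => rfl)) g = g x := fun _ => rfl
    rw [← e, map_sum]
    conv_rhs => rw [← b.sum_repr (Y x), map_sum]
    refine Finset.sum_congr rfl fun i _ => ?_
    change ofContDiffOn _ (hm i) x * dirDeriv (b i) f x = _
    rw [ofContDiffOn_apply _ hx, dirDeriv_apply _ _ hx]
    simp

theorem alongLinear_apply [FiniteDimensional ℝ E] (Y : E →L[ℝ] E) (f : SmoothFun U) {x : E}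
    (hx : x ∈ U) : alongLinear Y f x = fderiv ℝ f x (Y x) :=
  ofContDiffOn_apply (contDiffOn_fderiv_apply Y f) hx

end SmoothFun

/-! ### Rotations of the plane -/

/-- The square of the Euclidean norm. -/
def normSq (v : Plane) : ℝ := v 0 ^ 2 + v 1 ^ 2

theorem normSq_nonneg (v : Plane) : 0 ≤ normSq v := by unfold normSq; positivity

theorem normSq_pos {v : Plane} (hv : v ≠ 0) : 0 < normSq v := by
  refine (normSq_nonneg v).lt_of_ne fun h => hv ?_
  unfold normSq at h
  have h0 : v 0 = 0 := by nlinarith [sq_nonneg (v 0), sq_nonneg (v 1)]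
  have h1 : v 1 = 0 := by nlinarith [sq_nonneg (v 0), sq_nonneg (v 1)]
  ext i; fin_cases i <;> assumption

theorem normSq_smul (t : ℝ) (v : Plane) : normSq (t • v) = t ^ 2 * normSq v := by
  simp only [normSq, Pi.smul_apply, smul_eq_mul]; ring

theorem continuous_normSq : Continuous normSq := by unfold normSq; fun_prop

theorem norm_sq_le_normSq (v : Plane) : ‖v‖ ^ 2 ≤ normSq v := by
  have h : ‖v‖ ≤ √(normSq v) := by
    refine (pi_norm_le_iff_of_nonneg (Real.sqrt_nonneg _)).2 fun i => ?_
    rw [Real.norm_eq_abs]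
    refine Real.abs_le_sqrt ?_
    unfold normSq
    fin_cases i <;> simp <;> positivity
  calc ‖v‖ ^ 2 ≤ √(normSq v) ^ 2 := by gcongr
    _ = _ := Real.sq_sqrt (normSq_nonneg v)

theorem normSq_le (v : Plane) : normSq v ≤ 2 * ‖v‖ ^ 2 := by
  have h : ∀ i, v i ^ 2 ≤ ‖v‖ ^ 2 := fun i => by
    rw [← sq_abs (v i)]
    have := norm_le_pi_norm v i
    rw [Real.norm_eq_abs] at this
    gcongr
  unfold normSq
  linarith [h 0, h 1]

/-- The clockwise rotation by a right angle. -/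
def rot : Plane →L[ℝ] Plane :=
  LinearMap.toContinuousLinearMap
    { toFun := fun v => ![v 1, -v 0]
      map_add' := fun v w => by ext i; fin_cases i <;> simp; ring
      map_smul' := fun c v => by ext i; fin_cases i <;> simp }

@[simp] theorem rot_zero (v : Plane) : rot v 0 = v 1 := rfl
@[simp] theorem rot_one (v : Plane) : rot v 1 = -v 0 := rfl

/-- For `u ≠ 0` the map `p ↦ lineMap p u` is an affine coordinate of the projective line centred
at `u`. -/
def lineMap (p : ℝ) : Plane →L[ℝ] Plane := rot + p • ContinuousLinearMap.id ℝ Plane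

theorem lineMap_apply (p : ℝ) (v : Plane) : lineMap p v = rot v + p • v := rfl

@[simp] theorem lineMap_zero (p : ℝ) (v : Plane) : lineMap p v 0 = v 1 + p * v 0 := rfl
@[simp] theorem lineMap_one (p : ℝ) (v : Plane) : lineMap p v 1 = -v 0 + p * v 1 := rfl

theorem normSq_lineMap (p : ℝ) (v : Plane) : normSq (lineMap p v) = (1 + p ^ 2) * normSq v := by
  simp only [normSq, lineMap_zero, lineMap_one]; ring

/-- `(1 + p²)^(-1/2)`. -/
def decay (p : ℝ) : ℝ := (√(1 + p ^ 2))⁻¹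

theorem decay_pos (p : ℝ) : 0 < decay p := by unfold decay; positivity

theorem decay_sq (p : ℝ) : decay p ^ 2 = (1 + p ^ 2)⁻¹ := by
  rw [decay, inv_pow, Real.sq_sqrt (by positivity)]

theorem continuous_decay : Continuous decay := by
  unfold decay
  exact (by fun_prop : Continuous fun p : ℝ => √(1 + p ^ 2)).inv₀ fun p => by positivity

/-- The rotation that is positively proportional to `lineMap p`. -/
def unitMap (p : ℝ) : Plane →L[ℝ] Plane := decay p • lineMap p

theorem unitMap_apply (p : ℝ) (v : Plane) : unitMap p v = decay p • lineMap p v := rfl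

@[simp] theorem normSq_unitMap (p : ℝ) (v : Plane) : normSq (unitMap p v) = normSq v := by
  rw [unitMap_apply, normSq_smul, normSq_lineMap, decay_sq, inv_mul_cancel_left₀ (by positivity)]

theorem continuous_unitMap : Continuous unitMap := by
  unfold unitMap lineMap
  have := continuous_decay
  fun_prop

theorem ne_zero_iff_normSq {v : Plane} : v ≠ 0 ↔ 0 < normSq v :=
  ⟨normSq_pos, by rintro h rfl; simp [normSq] at h⟩

theorem unitMap_ne_zero (p : ℝ) {v : Plane} (hv : v ≠ 0) : unitMap p v ≠ 0 := by
  rw [ne_zero_iff_normSq, normSq_unitMap]; exact normSq_pos hv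

theorem lineMap_ne_zero (p : ℝ) {v : Plane} (hv : v ≠ 0) : lineMap p v ≠ 0 := by
  rw [ne_zero_iff_normSq, normSq_lineMap]
  have := normSq_pos hv
  positivity

theorem norm_unitMap_apply_le (p : ℝ) (v : Plane) : ‖unitMap p v‖ ≤ 2 * ‖v‖ := by
  have h := (norm_sq_le_normSq (unitMap p v)).trans
    ((normSq_unitMap p v).le.trans (normSq_le v))
  refine abs_le_of_sq_le_sq' ?_ (by positivity) |>.2
  nlinarith [sq_nonneg ‖v‖]

/-- The pair of rotations `unitMap p`, `unitMap q`. -/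
def unitPair (p q : ℝ) : Plane →L[ℝ] Plane × Plane := (unitMap p).prod (unitMap q)

theorem unitPair_apply (p q : ℝ) (v : Plane) : unitPair p q v = (unitMap p v, unitMap q v) := rfl

theorem continuous_unitPair : Continuous fun x : ℝ × ℝ => unitPair x.1 x.2 := by
  unfold unitPair
  exact (ContinuousLinearMap.prodₗᵢ ℝ (E := Plane) (F := Plane) (G := Plane) (𝕜 := ℝ)).continuous.comp
    ((continuous_unitMap.comp continuous_fst).prodMk (continuous_unitMap.comp continuous_snd))

theorem unitPair_mem (p q : ℝ) {v : Plane} (hv : v ∈ punctured) :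
    unitPair p q v ∈ puncturedProd := ⟨unitMap_ne_zero p hv, unitMap_ne_zero q hv⟩

theorem norm_unitPair_le (p q : ℝ) : ‖unitPair p q‖ ≤ 2 :=
  ContinuousLinearMap.opNorm_le_bound _ (by norm_num) fun v =>
    max_le (norm_unitMap_apply_le p v) (norm_unitMap_apply_le q v)

/-- A closed annulus. -/
def annulus (a b : ℝ) : Set Plane := {v | a ≤ normSq v ∧ normSq v ≤ b}

theorem annulus_subset {a b : ℝ} (ha : 0 < a) : annulus a b ⊆ punctured :=
  fun _ hv => ne_zero_iff_normSq.2 (ha.trans_le hv.1)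

theorem isCompact_annulus (a b : ℝ) : IsCompact (annulus a b) := by
  refine Metric.isCompact_of_isClosed_isBounded
    ((isClosed_le continuous_const continuous_normSq).inter
      (isClosed_le continuous_normSq continuous_const)) ?_
  refine (Metric.isBounded_closedBall (x := (0 : Plane)) (r := 1 + b)).subset fun v hv => ?_
  rw [mem_closedBall_zero_iff]
  nlinarith [norm_sq_le_normSq v, hv.2, norm_nonneg v]

theorem exists_subset_annulus {K : Set Plane} (hK : IsCompact K) (hKU : K ⊆ punctured) :
    ∃ a b : ℝ, 0 < a ∧ K ⊆ annulus a b := by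
  rcases K.eq_empty_or_nonempty with rfl | hne
  · exact ⟨1, 1, one_pos, empty_subset _⟩
  obtain ⟨x, hx, h1⟩ := hK.exists_isMinOn hne continuous_normSq.continuousOn
  obtain ⟨y, -, h2⟩ := hK.exists_isMaxOn hne continuous_normSq.continuousOn
  exact ⟨_, _, normSq_pos (hKU hx), fun z hz => ⟨h1 hz, h2 hz⟩⟩

theorem isCompact_annulus_prod (a b : ℝ) : IsCompact (annulus a b ×ˢ annulus a b) :=
  (isCompact_annulus a b).prod (isCompact_annulus a b)

theorem annulus_prod_subset {a b : ℝ} (ha : 0 < a) :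
    annulus a b ×ˢ annulus a b ⊆ (puncturedProd : Set (Plane × Plane)) :=
  fun _ hx => ⟨annulus_subset ha hx.1, annulus_subset ha hx.2⟩

theorem unitPair_mem_annulus (p q : ℝ) {a b : ℝ} {v : Plane} (hv : v ∈ annulus a b) :
    unitPair p q v ∈ annulus a b ×ˢ annulus a b := by
  simpa [unitPair_apply, annulus] using hv

/-! ### Averages of smooth functions over pairs of rotations -/

section Average

variable {Ω : Type*} [MeasurableSpace Ω] {m : Measure Ω} {p q : Ω → ℝ} {W : Ω → ℂ}

/-- The average of `f` over pairs of rotations, with weight `W`. -/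
def avgFun (m : Measure Ω) (p q : Ω → ℝ) (W : Ω → ℂ) (f : SmoothFun puncturedProd) (u : Plane) :
    ℂ := ∫ o, W o * f (unitPair (p o) (q o) u) ∂m

theorem continuous_comp_unitPair (f : SmoothFun puncturedProd) {u : Plane} (hu : u ∈ punctured) :
    Continuous fun x : ℝ × ℝ => f (unitPair x.1 x.2 u) :=
  f.contDiffOn.continuousOn.comp_continuous (continuous_unitPair.clm_apply continuous_const)
    fun x => unitPair_mem x.1 x.2 hu

theorem aestronglyMeasurable_comp_unitPair (hp : Measurable p) (hq : Measurable q)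
    (f : SmoothFun puncturedProd) {u : Plane} (hu : u ∈ punctured) :
    AEStronglyMeasurable (fun o => f (unitPair (p o) (q o) u)) m :=
  ((continuous_comp_unitPair f hu).stronglyMeasurable.comp_measurable
    (hp.prodMk hq)).aestronglyMeasurable

theorem integrable_avg (hp : Measurable p) (hq : Measurable q) (hW : Integrable W m)
    (f : SmoothFun puncturedProd) {u : Plane} (hu : u ∈ punctured) :
    Integrable (fun o => W o * f (unitPair (p o) (q o) u)) m := by
  obtain ⟨C, hC⟩ := (isCompact_annulus_prod (normSq u) (normSq u)).exists_bound_of_continuousOn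
    (f.contDiffOn.continuousOn.mono (annulus_prod_subset (normSq_pos hu)))
  exact hW.mul_bdd (aestronglyMeasurable_comp_unitPair hp hq f hu)
    (Eventually.of_forall fun o => hC _ (unitPair_mem_annulus _ _ ⟨le_rfl, le_rfl⟩))

/-- Differentiation under the integral sign. An annulus around u avoiding the origin is a
neighbourhood of u preserved by all rotations, so one bound for the derivative of f there, times ‖W‖
and the norm bound 2 of `unitPair`, dominates the integrand for all nearby points. -/
theorem hasFDerivAt_avgFun (hp : Measurable p) (hq : Measurable q) (hW : Integrable W m)
    (f : SmoothFun puncturedProd) {u : Plane} (hu : u ∈ punctured) :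
    Integrable (fun o => W o • (fderiv ℝ f (unitPair (p o) (q o) u)).comp
      (unitPair (p o) (q o))) m ∧
    HasFDerivAt (avgFun m p q W f) (∫ o, W o • (fderiv ℝ f (unitPair (p o) (q o) u)).comp
      (unitPair (p o) (q o)) ∂m) u := by
  set a := normSq u / 2 with ha
  have hu0 := normSq_pos hu
  have ha0 : 0 < a := half_pos hu0
  obtain ⟨C, hC⟩ := (isCompact_annulus_prod a (normSq u + 1)).exists_bound_of_continuousOn
    (f.contDiffOn_fderiv.continuousOn.mono (annulus_prod_subset ha0))
  have hs : annulus a (normSq u + 1) ∈ 𝓝 u := by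
    have h1 := continuous_normSq.continuousAt (x := u) |>.eventually_const_lt (u := a)
      (by rw [ha]; linarith)
    have h2 := continuous_normSq.continuousAt (x := u) |>.eventually_lt_const (u := normSq u + 1)
      (by linarith)
    filter_upwards [h1, h2] with v hv1 hv2 using ⟨hv1.le, hv2.le⟩
  have hcont : Continuous fun x : ℝ × ℝ =>
      (fderiv ℝ f (unitPair x.1 x.2 u)).comp (unitPair x.1 x.2) :=
    (f.contDiffOn_fderiv.continuousOn.comp_continuous
      (continuous_unitPair.clm_apply continuous_const)
      fun x => unitPair_mem x.1 x.2 hu).clm_comp continuous_unitPair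
  have hmeas : AEStronglyMeasurable (fun o => W o • (fderiv ℝ f (unitPair (p o) (q o) u)).comp
      (unitPair (p o) (q o))) m :=
    hW.aestronglyMeasurable.smul
      (hcont.stronglyMeasurable.comp_measurable (hp.prodMk hq)).aestronglyMeasurable
  have hbound : ∀ o, ∀ v ∈ annulus a (normSq u + 1),
      ‖W o • (fderiv ℝ f (unitPair (p o) (q o) v)).comp (unitPair (p o) (q o))‖ ≤
        ‖W o‖ * (C * 2) := by
    intro o v hv
    rw [norm_smul]
    have h1 := hC _ (unitPair_mem_annulus (p o) (q o) hv)
    have h2 := norm_unitPair_le (p o) (q o)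
    have h3 : 0 ≤ C := (norm_nonneg _).trans h1
    refine mul_le_mul_of_nonneg_left ((ContinuousLinearMap.opNorm_comp_le _ _).trans ?_)
      (norm_nonneg _)
    gcongr
  refine ⟨(hW.norm.mul_const _).mono' hmeas (Eventually.of_forall fun o =>
    hbound o u (mem_of_mem_nhds hs)), ?_⟩
  refine hasFDerivAt_integral_of_dominated_of_fderiv_le
    (F := fun u o => W o * f (unitPair (p o) (q o) u))
    (bound := fun o => ‖W o‖ * (C * 2)) hs ?_ (integrable_avg hp hq hW f hu) hmeas
    (Eventually.of_forall hbound) (hW.norm.mul_const _)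
    (Eventually.of_forall fun o v hv => ?_)
  · filter_upwards [punctured.isOpen.mem_nhds hu] with v hv
    exact (integrable_avg hp hq hW f hv).aestronglyMeasurable
  · have h1 := (f.differentiableAt (unitPair_mem (p o) (q o) (annulus_subset ha0 hv))).hasFDerivAt
    exact ((h1.comp v (unitPair (p o) (q o)).hasFDerivAt).const_mul (W o))

/-- The standard basis of the product of two planes. -/
def prodBasis : Module.Basis (Fin 2 ⊕ Fin 2) ℝ (Plane × Plane) :=
  (Pi.basisFun ℝ (Fin 2)).prod (Pi.basisFun ℝ (Fin 2))

/-- The coordinates of the images of basis vectors under a pair of rotations. -/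
def pairCoef (j : Fin 2) (κ : Fin 2 ⊕ Fin 2) (p q : ℝ) : ℝ :=
  prodBasis.repr (unitPair p q (Pi.single j 1)) κ

theorem continuous_pairCoef (j : Fin 2) (κ : Fin 2 ⊕ Fin 2) :
    Continuous fun x : ℝ × ℝ => pairCoef j κ x.1 x.2 :=
  (prodBasis.coord κ).continuous_of_finiteDimensional.comp
    (continuous_unitPair.clm_apply continuous_const)

theorem abs_pairCoef_le (j : Fin 2) (κ : Fin 2 ⊕ Fin 2) (p q : ℝ) : |pairCoef j κ p q| ≤ 1 := by
  have key : ∀ (r : ℝ) (i : Fin 2), |unitMap r (Pi.single j 1) i| ≤ 1 := by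
    intro r i
    have h := (norm_sq_le_normSq (unitMap r (Pi.single j 1))).trans_eq (normSq_unitMap r _)
    have h1 : normSq (Pi.single j 1) = 1 := by fin_cases j <;> simp [normSq]
    rw [h1] at h
    have h2 := norm_le_pi_norm (unitMap r (Pi.single j 1)) i
    rw [Real.norm_eq_abs] at h2
    nlinarith [norm_nonneg (unitMap r (Pi.single j 1))]
  rcases κ with i | i
  · simpa [pairCoef, prodBasis, unitPair_apply] using key p i
  · simpa [pairCoef, prodBasis, unitPair_apply] using key q i

theorem integrable_mul_pairCoef (hp : Measurable p) (hq : Measurable q) (hW : Integrable W m)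
    (j : Fin 2) (κ : Fin 2 ⊕ Fin 2) :
    Integrable (fun o => W o * (pairCoef j κ (p o) (q o) : ℂ)) m := by
  refine hW.mul_bdd (c := 1) ?_ (Eventually.of_forall fun o => ?_)
  · exact ((Complex.continuous_ofReal.comp (continuous_pairCoef j κ)).stronglyMeasurable.comp_measurable
      (hp.prodMk hq)).aestronglyMeasurable
  · rw [Complex.norm_real]; exact abs_pairCoef_le j κ _ _

/-- Expanding the rotated basis vector in the basis of the product shows that a derivative of an
average is a sum of averages of derivatives of f, with weights multiplied by coefficients bounded by
1. Closure of this class under differentiation drives the inductions for smoothness and for the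
seminorm estimates. -/
theorem fderiv_avgFun (hp : Measurable p) (hq : Measurable q) (hW : Integrable W m)
    (f : SmoothFun puncturedProd) {u : Plane} (hu : u ∈ punctured) (j : Fin 2) :
    fderiv ℝ (avgFun m p q W f) u (Pi.single j 1) =
      ∑ κ, avgFun m p q (fun o => W o * (pairCoef j κ (p o) (q o) : ℂ))
        (f.dirDeriv (prodBasis κ)) u := by
  obtain ⟨h1, h2⟩ := hasFDerivAt_avgFun hp hq hW f hu
  unfold avgFun at *
  rw [h2.fderiv, ContinuousLinearMap.integral_apply h1, ← integral_finsetSum _ fun κ _ =>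
    integrable_avg hp hq (integrable_mul_pairCoef hp hq hW j κ) _ hu]
  refine integral_congr_ae (Eventually.of_forall fun o => ?_)
  change W o • fderiv ℝ f (unitPair (p o) (q o) u) (unitPair (p o) (q o) (Pi.single j 1)) = _
  conv_lhs => rw [← prodBasis.sum_repr (unitPair (p o) (q o) (Pi.single j 1)), map_sum,
    Finset.smul_sum]
  refine Finset.sum_congr rfl fun κ _ => ?_
  rw [SmoothFun.dirDeriv_apply _ _ (unitPair_mem _ _ hu), map_smul, pairCoef]
  simp [mul_assoc]

theorem contDiffOn_avgFun (hp : Measurable p) (hq : Measurable q) (hW : Integrable W m)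
    (f : SmoothFun puncturedProd) : ContDiffOn ℝ ∞ (avgFun m p q W f) punctured := by
  rw [contDiffOn_infty]
  intro n
  -- A derivative changes both the weight and the function, so both must vary in the induction.
  induction n generalizing W f with
  | zero =>
    rw [Nat.cast_zero, contDiffOn_zero]
    exact fun u hu => (hasFDerivAt_avgFun hp hq hW f hu).2.continuousAt.continuousWithinAt
  | succ n ih =>
    rw [Nat.cast_succ, contDiffOn_succ_iff_fderiv_of_isOpen punctured.isOpen]
    refine ⟨fun u hu =>
      (hasFDerivAt_avgFun hp hq hW f hu).2.differentiableAt.differentiableWithinAt,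
      fun h => absurd h (by simp), ?_⟩
    have h1 : EqOn (fderiv ℝ (avgFun m p q W f)) (fun u => ∑ j : Fin 2, ∑ κ,
        ContinuousLinearMap.smulRightL ℝ Plane ℂ (ContinuousLinearMap.proj j)
          (avgFun m p q (fun o => W o * (pairCoef j κ (p o) (q o) : ℂ))
            (f.dirDeriv (prodBasis κ)) u)) punctured := by
      intro u hu
      ext z
      rw [sum_apply]
      conv_lhs => rw [← (Pi.basisFun ℝ (Fin 2)).sum_repr z, map_sum]
      refine Finset.sum_congr rfl fun j _ => ?_
      rw [map_smul, Pi.basisFun_apply, fderiv_avgFun hp hq hW f hu, Finset.smul_sum, sum_apply]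
      simp
    refine ContDiffOn.congr (ContDiffOn.sum fun j _ => ContDiffOn.sum fun κ _ => ?_) h1
    exact (ContinuousLinearMap.contDiff _).comp_contDiffOn
      (ih (integrable_mul_pairCoef hp hq hW j κ) _)

/-- The average of `f` over pairs of rotations, as a smooth function. -/
def avg (hp : Measurable p) (hq : Measurable q) (hW : Integrable W m)
    (f : SmoothFun puncturedProd) : SmoothFun punctured :=
  SmoothFun.ofContDiffOn _ (contDiffOn_avgFun hp hq hW f)

theorem avg_apply (hp : Measurable p) (hq : Measurable q) (hW : Integrable W m)
    (f : SmoothFun puncturedProd) {u : Plane} (hu : u ∈ punctured) :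
    avg hp hq hW f u = ∫ o, W o * f (unitPair (p o) (q o) u) ∂m :=
  SmoothFun.ofContDiffOn_apply _ hu

theorem dirDeriv_avg (hp : Measurable p) (hq : Measurable q) (hW : Integrable W m)
    (f : SmoothFun puncturedProd) (j : Fin 2) {u : Plane} (hu : u ∈ punctured) :
    (avg hp hq hW f).dirDeriv (Pi.single j 1) u =
      ∑ κ, avg hp hq (integrable_mul_pairCoef hp hq hW j κ) (f.dirDeriv (prodBasis κ)) u := by
  rw [SmoothFun.dirDeriv_apply _ _ hu]
  have h1 : avg hp hq hW f =ᶠ[𝓝 u] avgFun m p q W f := by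
    filter_upwards [punctured.isOpen.mem_nhds hu] with v hv
    exact SmoothFun.ofContDiffOn_apply _ hv
  rw [h1.fderiv_eq, fderiv_avgFun hp hq hW f hu]
  exact Finset.sum_congr rfl fun κ _ => (SmoothFun.ofContDiffOn_apply _ hu).symm

end Average

namespace SmoothFun

variable {E : Type*} [NormedAddCommGroup E] [NormedSpace ℝ E] {U : TopologicalSpace.Opens E}

theorem sum_apply {κ : Type*} (s : Finset κ) (g : κ → SmoothFun U) (x : E) :
    (∑ i ∈ s, g i) x = ∑ i ∈ s, g i x :=
  map_sum (AddMonoidHom.mk' (fun g : SmoothFun U => g x) fun _ _ => rfl) g s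

theorem norm_iteratedFDerivWithin_sum_le {κ : Type*} (s : Finset κ) (g : κ → SmoothFun U) (k : ℕ)
    {x : E} (hx : x ∈ U) : ‖iteratedFDerivWithin ℝ k (∑ i ∈ s, g i : SmoothFun U) U x‖ ≤
      ∑ i ∈ s, ‖iteratedFDerivWithin ℝ k (g i) U x‖ := by
  have hk : ((k : ℕ∞) : WithTop ℕ∞) ≤ ∞ := by exact_mod_cast le_top
  have e : ⇑(∑ i ∈ s, g i) = fun x => ∑ i ∈ s, g i x := funext fun x => sum_apply s g x
  rw [e, iteratedFDerivWithin_fun_sum_apply U.isOpen.uniqueDiffOn hx (f := fun i y => g i y)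
    (fun i _ => ((g i).contDiffOn.of_le hk) x hx)]
  exact norm_sum_le _ _

theorem norm_iteratedFDerivWithin_zero (f : SmoothFun U) (x : E) :
    ‖iteratedFDerivWithin ℝ 0 f U x‖ = ‖f x‖ := by simp

end SmoothFun

/-! ### Seminorm estimates and averaging operators on sections -/

section Average

variable {Ω : Type*} [MeasurableSpace Ω] {m : Measure Ω} {p q : Ω → ℝ} {W : Ω → ℂ}

/-- The constant depends neither on W nor on f, so convergence of weights in L¹ yields convergence
of the averages in every seminorm. The same annulus serves in the source and in the target because
rotations preserve it. -/
theorem exists_norm_avg_le (hp : Measurable p) (hq : Measurable q) {a b : ℝ} (ha : 0 < a) (k : ℕ) :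
    ∃ C : ℝ, 0 ≤ C ∧ ∀ (W : Ω → ℂ) (hW : Integrable W m) (f : SmoothFun puncturedProd) (c : ℝ),
      0 ≤ c → (∀ j ≤ k, ∀ y ∈ annulus a b ×ˢ annulus a b,
        ‖iteratedFDerivWithin ℝ j f puncturedProd y‖ ≤ c) →
      ∀ u ∈ annulus a b, ‖iteratedFDerivWithin ℝ k (avg hp hq hW f) punctured u‖ ≤
        C * (c * ∫ o, ‖W o‖ ∂m) := by
  induction k with
  | zero =>
    refine ⟨1, zero_le_one, fun W hW f c hc hf u hu => ?_⟩
    have hu' := annulus_subset ha hu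
    rw [SmoothFun.norm_iteratedFDerivWithin_zero, avg_apply hp hq hW f hu', one_mul, mul_comm,
      ← integral_mul_const]
    refine norm_integral_le_of_norm_le (hW.norm.mul_const c) (Eventually.of_forall fun o => ?_)
    rw [norm_mul]
    have := hf 0 le_rfl _ (unitPair_mem_annulus (p o) (q o) hu)
    rw [SmoothFun.norm_iteratedFDerivWithin_zero] at this
    gcongr
  | succ k ih =>
    obtain ⟨C, hC0, hC⟩ := ih
    obtain ⟨β, hβ0, hβ⟩ := SmoothFun.exists_norm_iteratedFDerivWithin_succ_le (U := punctured)
      (Pi.basisFun ℝ (Fin 2))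
    set M : ℝ := ∑ κ, ‖prodBasis κ‖ with hM
    refine ⟨∑ j, β j * (C * M), Finset.sum_nonneg fun j _ => mul_nonneg (hβ0 j)
      (mul_nonneg hC0 (Finset.sum_nonneg fun κ _ => norm_nonneg _)), fun W hW f c hc hf u hu => ?_⟩
    have hu' := annulus_subset ha hu
    refine (hβ _ k u hu').trans ?_
    rw [Finset.sum_mul]
    refine Finset.sum_le_sum fun j _ => ?_
    rw [mul_assoc]
    refine mul_le_mul_of_nonneg_left ?_ (hβ0 j)
    have e : (avg hp hq hW f).dirDeriv (Pi.basisFun ℝ (Fin 2) j) =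
        ∑ κ, avg hp hq (integrable_mul_pairCoef hp hq hW j κ) (f.dirDeriv (prodBasis κ)) :=
      SmoothFun.ext_on fun v hv => by
        rw [Pi.basisFun_apply, dirDeriv_avg hp hq hW f j hv, SmoothFun.sum_apply]
    rw [e, hM, Finset.mul_sum, Finset.sum_mul]
    refine (SmoothFun.norm_iteratedFDerivWithin_sum_le _ _ k hu').trans
      (Finset.sum_le_sum fun κ _ => ?_)
    have h1 := hC _ (integrable_mul_pairCoef hp hq hW j κ) (f.dirDeriv (prodBasis κ))
      (‖prodBasis κ‖ * c) (by positivity) (fun i hi y hy =>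
        (SmoothFun.norm_iteratedFDerivWithin_dirDeriv_le _ f i (annulus_prod_subset ha hy)).trans
          (mul_le_mul_of_nonneg_left (hf (i + 1) (by omega) y hy) (norm_nonneg _))) u hu
    refine h1.trans ?_
    have h2 : ∫ o, ‖W o * (pairCoef j κ (p o) (q o) : ℂ)‖ ∂m ≤ ∫ o, ‖W o‖ ∂m := by
      refine integral_mono (integrable_mul_pairCoef hp hq hW j κ).norm hW.norm fun o => ?_
      change ‖W o * (pairCoef j κ (p o) (q o) : ℂ)‖ ≤ ‖W o‖
      rw [norm_mul, Complex.norm_real]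
      exact mul_le_of_le_one_right (norm_nonneg _) (abs_pairCoef_le j κ _ _)
    calc C * (‖prodBasis κ‖ * c * ∫ o, ‖W o * (pairCoef j κ (p o) (q o) : ℂ)‖ ∂m)
        ≤ C * (‖prodBasis κ‖ * c * ∫ o, ‖W o‖ ∂m) := by gcongr
      _ = _ := by ring

/-- Scaling u scales both arguments of f by the same t: the signs cancel and the exponents add. This
is why averages land in `Sec 1 2`. -/
theorem character_mul_self (t : ℝ) (ht : t ≠ 0) :
    character (-1) 1 t * character (-1) 1 t = character 1 2 t := by
  have h0 : ((|t| : ℝ) : ℂ) ≠ 0 := by exact_mod_cast (abs_pos.2 ht).ne'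
  have h1 : (Real.sign t : ℂ) * Real.sign t = 1 := by
    rcases lt_or_gt_of_ne ht with h | h
    · simp [Real.sign_of_neg h]
    · simp [Real.sign_of_pos h]
  unfold character
  rw [if_neg (by decide), if_pos rfl, mul_one, mul_mul_mul_comm, h1, mul_one,
    ← Complex.cpow_add _ _ h0]
  norm_num

/-- The average over pairs of rotations, as an operator on sections. -/
def avgSec (hp : Measurable p) (hq : Measurable q) (hW : Integrable W m) :
    Sec₂ (-1) 1 →L[ℂ] Sec 1 2 where
  toFun f := ⟨avg hp hq hW f.1, fun t ht v => by
    by_cases hv : v ∈ punctured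
    · have hv' : t • v ∈ punctured := smul_ne_zero ht hv
      rw [avg_apply hp hq hW _ hv, avg_apply hp hq hW _ hv', ← integral_const_mul]
      refine integral_congr_ae (Eventually.of_forall fun o => ?_)
      change W o * f.1 (unitPair (p o) (q o) (t • v)) =
        character 1 2 t * (W o * f.1 (unitPair (p o) (q o) v))
      rw [map_smul, unitPair_apply, Prod.smul_mk, f.2 t t ht ht, character_mul_self t ht]
      ring
    · have hv' : v = 0 := not_not.1 hv
      rw [hv', smul_zero, SmoothFun.eq_zero _ (by simp [punctured]), mul_zero]⟩
  map_add' f g := Subtype.ext <| SmoothFun.ext_on fun u hu => by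
    change avg hp hq hW (f.1 + g.1) u = avg hp hq hW f.1 u + avg hp hq hW g.1 u
    rw [avg_apply hp hq hW _ hu, avg_apply hp hq hW _ hu, avg_apply hp hq hW _ hu,
      ← integral_add (integrable_avg hp hq hW _ hu) (integrable_avg hp hq hW _ hu)]
    exact integral_congr_ae (Eventually.of_forall fun o => mul_add _ _ _)
  map_smul' c f := Subtype.ext <| SmoothFun.ext_on fun u hu => by
    change avg hp hq hW (c • f.1) u = c * avg hp hq hW f.1 u
    rw [avg_apply hp hq hW _ hu, avg_apply hp hq hW _ hu, ← integral_const_mul]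
    exact integral_congr_ae (Eventually.of_forall fun o => mul_left_comm _ _ _)
  cont := by
    refine Continuous.subtype_mk ?_ _
    refine SmoothFun.continuous_of_bound (X := Sec₂ (-1) 1)
      { toFun := fun f => avg hp hq hW f.1
        map_add' := fun f g => SmoothFun.ext_on fun u hu => by
          change avg hp hq hW (f.1 + g.1) u = avg hp hq hW f.1 u + avg hp hq hW g.1 u
          rw [avg_apply hp hq hW _ hu, avg_apply hp hq hW _ hu, avg_apply hp hq hW _ hu,
            ← integral_add (integrable_avg hp hq hW _ hu) (integrable_avg hp hq hW _ hu)]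
          exact integral_congr_ae (Eventually.of_forall fun o => mul_add _ _ _)
        map_smul' := fun c f => SmoothFun.ext_on fun u hu => by
          change avg hp hq hW (c • f.1) u = c * avg hp hq hW f.1 u
          rw [avg_apply hp hq hW _ hu, avg_apply hp hq hW _ hu, ← integral_const_mul]
          exact integral_congr_ae (Eventually.of_forall fun o => mul_left_comm _ _ _) }
      fun k K hK hKU => ?_
    obtain ⟨a, b, ha, hab⟩ := exists_subset_annulus hK hKU
    obtain ⟨C, -, hC⟩ := exists_norm_avg_le (m := m) hp hq (b := b) ha k
    refine ⟨C * ∫ o, ‖W o‖ ∂m, k, _, isCompact_annulus_prod a b, annulus_prod_subset ha,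
      fun f c hc hf u hu => (hC W hW f.1 c hc hf u (hab hu)).trans_eq (by ring)⟩

open Classical in
/-- The average over pairs of rotations with weight `W`, set to be zero if `W` is not integrable. -/
def avgOp (m : Measure Ω) (p q : Ω → ℝ) (W : Ω → ℂ) : Sec₂ (-1) 1 →L[ℂ] Sec 1 2 :=
  if h : Measurable p ∧ Measurable q ∧ Integrable W m then avgSec h.1 h.2.1 h.2.2 else 0

theorem avgOp_eq (hp : Measurable p) (hq : Measurable q) (hW : Integrable W m) :
    avgOp m p q W = avgSec hp hq hW := dif_pos ⟨hp, hq, hW⟩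

theorem avgOp_apply (hp : Measurable p) (hq : Measurable q) (hW : Integrable W m)
    (f : Sec₂ (-1) 1) {u : Plane} (hu : u ∈ punctured) :
    (avgOp m p q W f).1 u = ∫ o, W o * f.1 (unitPair (p o) (q o) u) ∂m := by
  rw [avgOp_eq hp hq hW]
  exact avg_apply hp hq hW f.1 hu

theorem Sec.ext_on {ε : ℤˣ} {lam : ℂ} {f g : Sec ε lam} (h : ∀ u ∈ punctured, f.1 u = g.1 u) :
    f = g := Subtype.ext (SmoothFun.ext_on h)

theorem tendsto_sec_iff {ε : ℤˣ} {lam : ℂ} {ι : Type*} {l : Filter ι} {F : ι → Sec ε lam}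
    {f : Sec ε lam} : Tendsto F l (𝓝 f) ↔
      ∀ (k : ℕ) (K : Set Plane), IsCompact K → K ⊆ punctured → ∀ ε > 0, ∀ᶠ i in l,
      ∀ x ∈ K, ‖iteratedFDerivWithin ℝ k (F i - f).1 punctured x‖ < ε := by
  rw [tendsto_subtype_rng, SmoothFun.tendsto_iff_norm]
  rfl

/-- If the weight depends holomorphically on a parameter, in a dominated way, then so does the
average, in the weak sense. -/
theorem hasDerivAt_avgOp (hp : Measurable p) (hq : Measurable q) {W W' : ℂ → Ω → ℂ} {z₀ : ℂ} {δ : ℝ}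
    (hδ : 0 < δ) {B : Ω → ℝ} (hB : Integrable B m) (hW : ∀ z ∈ Metric.ball z₀ δ, Integrable (W z) m)
    (hW'm : AEStronglyMeasurable (W' z₀) m)
    (hd : ∀ᵐ o ∂m, ∀ z ∈ Metric.ball z₀ δ, HasDerivAt (fun z => W z o) (W' z o) z)
    (hb : ∀ᵐ o ∂m, ∀ z ∈ Metric.ball z₀ δ, ‖W' z o‖ ≤ B o)
    (h : Sec 1 2 →L[ℂ] ℂ) (f : Sec₂ (-1) 1) :
    HasDerivAt (fun z => h (avgOp m p q (W z) f)) (h (avgOp m p q (W' z₀) f)) z₀ := by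
  have hz₀ : z₀ ∈ Metric.ball z₀ δ := Metric.mem_ball_self hδ
  have hW' : Integrable (W' z₀) m := hB.mono' hW'm (hb.mono fun o ho => ho z₀ hz₀)
  have key : Tendsto (slope (fun z => avgOp m p q (W z) f) z₀) (𝓝[≠] z₀)
      (𝓝 (avgOp m p q (W' z₀) f)) := by
    -- V is the error of the difference quotient of the weights. The mean value inequality on the
    -- ball bounds the quotient by B, hence V by 2B, and dominated convergence makes its L¹ norm
    -- tend to 0. The error of the difference quotient of the operators is the average with weight
    -- V.
    set V : ℂ → Ω → ℂ := fun z o => (z - z₀)⁻¹ * (W z o - W z₀ o) - W' z₀ o with hV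
    have hball : ∀ᶠ z in 𝓝[≠] z₀, z ∈ Metric.ball z₀ δ :=
      mem_nhdsWithin_of_mem_nhds (Metric.ball_mem_nhds _ hδ)
    have hVi : ∀ z ∈ Metric.ball z₀ δ, Integrable (V z) m := fun z hz =>
      (((hW z hz).sub (hW z₀ hz₀)).const_mul _).sub hW'
    have hV0 : Tendsto (fun z => ∫ o, ‖V z o‖ ∂m) (𝓝[≠] z₀) (𝓝 0) := by
      rw [← integral_zero Ω ℝ (μ := m)]
      refine tendsto_integral_filter_of_dominated_convergence (fun o => 2 * B o)
        (hball.mono fun z hz => (hVi z hz).norm.aestronglyMeasurable) ?_ (hB.const_mul 2) ?_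
      · refine hball.mono fun z hz => ?_
        filter_upwards [hd, hb] with o ho1 ho2
        have h1 := (convex_ball z₀ δ).norm_image_sub_le_of_norm_hasDerivWithin_le
          (fun x hx => (ho1 x hx).hasDerivWithinAt) ho2 hz₀ hz
        rw [norm_norm]
        refine (norm_sub_le _ _).trans ?_
        have h2 := ho2 z₀ hz₀
        have h3 : ‖(z - z₀)⁻¹ * (W z o - W z₀ o)‖ ≤ B o := by
          rw [norm_mul, norm_inv]
          rcases eq_or_ne z z₀ with rfl | hne
          · simpa using (norm_nonneg _).trans h2
          · rw [inv_mul_le_iff₀ (norm_pos_iff.2 (sub_ne_zero.2 hne)), mul_comm]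
            exact h1
        linarith
      · filter_upwards [hd] with o ho
        have h1 := (hasDerivAt_iff_tendsto_slope.1 (ho z₀ hz₀)).sub_const (W' z₀ o)
        rw [sub_self] at h1
        exact (tendsto_norm_zero.comp h1).congr fun z => by
          simp [hV, slope_def_module]
    refine tendsto_sec_iff.2 fun k K hK hKU ε hε => ?_
    obtain ⟨a, b, ha, hab⟩ := exists_subset_annulus hK hKU
    obtain ⟨C, hC0, hC⟩ := exists_norm_avg_le (m := m) hp hq (b := b) ha k
    have bd : ∀ j : ℕ, ∃ c : ℝ, ∀ x ∈ annulus a b ×ˢ annulus a b,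
        ‖iteratedFDerivWithin ℝ j f.1 puncturedProd x‖ ≤ c := fun j => by
      have hj : ((j : ℕ∞) : WithTop ℕ∞) ≤ ∞ := by exact_mod_cast le_top
      exact (isCompact_annulus_prod a b).exists_bound_of_continuousOn
        ((f.1.contDiffOn.continuousOn_iteratedFDerivWithin hj
          puncturedProd.isOpen.uniqueDiffOn).mono (annulus_prod_subset ha))
    choose c hc using bd
    set c' : ℝ := ∑ j ∈ Finset.range (k + 1), |c j| with hc'
    have hc'0 : 0 ≤ c' := Finset.sum_nonneg fun j _ => abs_nonneg _
    have hfc : ∀ j ≤ k, ∀ y ∈ annulus a b ×ˢ annulus a b,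
        ‖iteratedFDerivWithin ℝ j f.1 puncturedProd y‖ ≤ c' := fun j hj y hy =>
      ((hc j y hy).trans (le_abs_self _)).trans
        (Finset.single_le_sum (f := fun j => |c j|) (fun j _ => abs_nonneg _)
          (Finset.mem_range.2 (by omega)))
    have hlim : Tendsto (fun z => C * (c' * ∫ o, ‖V z o‖ ∂m)) (𝓝[≠] z₀) (𝓝 0) := by
      simpa using (hV0.const_mul c').const_mul C
    filter_upwards [hlim.eventually_lt_const hε, hball] with z hz hzb x hx
    refine lt_of_le_of_lt ?_ hz
    have e : slope (fun z => avgOp m p q (W z) f) z₀ z - avgOp m p q (W' z₀) f =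
        avgOp m p q (V z) f := Sec.ext_on fun u hu => by
      rw [slope_def_module]
      change (z - z₀)⁻¹ * ((avgOp m p q (W z) f).1 u - (avgOp m p q (W z₀) f).1 u) -
        (avgOp m p q (W' z₀) f).1 u = _
      rw [avgOp_apply hp hq (hW z hzb) f hu, avgOp_apply hp hq (hW z₀ hz₀) f hu,
        avgOp_apply hp hq hW' f hu, avgOp_apply hp hq (hVi z hzb) f hu,
        ← integral_sub (integrable_avg hp hq (hW z hzb) _ hu)
          (integrable_avg hp hq (hW z₀ hz₀) _ hu), ← integral_const_mul]
      have i1 : Integrable (fun o => (z - z₀)⁻¹ * (W z o * f.1 (unitPair (p o) (q o) u) -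
          W z₀ o * f.1 (unitPair (p o) (q o) u))) m :=
        ((integrable_avg hp hq (hW z hzb) f.1 hu).sub
          (integrable_avg hp hq (hW z₀ hz₀) f.1 hu)).const_mul _
      rw [← integral_sub i1 (integrable_avg hp hq hW' f.1 hu)]
      refine integral_congr_ae (Eventually.of_forall fun o => ?_)
      simp only [hV]
      ring
    rw [e, avgOp_eq hp hq (hVi z hzb)]
    exact hC (V z) (hVi z hzb) f.1 c' hc'0 hfc x (hab hx)
  rw [hasDerivAt_iff_tendsto_slope]
  refine ((h.continuous.tendsto _).comp key).congr fun z => ?_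
  rw [Function.comp_apply, slope_def_module, slope_def_module, map_smul, map_sub]

end Average

/-! ### Integrable weights -/

theorem decay_le_one (p : ℝ) : decay p ≤ 1 := by
  have h := decay_sq p
  have h1 : (1 + p ^ 2)⁻¹ ≤ 1 := inv_le_one_of_one_le₀ (by nlinarith [sq_nonneg p])
  nlinarith [decay_pos p]

theorem abs_mul_decay_le (p : ℝ) : |p| * decay p ≤ 1 := by
  have h : (|p| * decay p) ^ 2 ≤ 1 := by
    rw [mul_pow, sq_abs, decay_sq, mul_inv_le_iff₀ (by positivity)]
    linarith
  have := decay_pos p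
  nlinarith [abs_nonneg p, mul_nonneg (abs_nonneg p) this.le]

theorem integrable_decay_rpow {ε : ℝ} (hε : 0 < ε) : Integrable fun p => decay p ^ (1 + ε) := by
  have h := integrable_rpow_neg_one_add_norm_sq (E := ℝ) (μ := volume) (r := 1 + ε)
    (by simpa using hε)
  refine h.congr (Eventually.of_forall fun p => ?_)
  simp only [Real.norm_eq_abs, sq_abs]
  rw [decay, Real.sqrt_eq_rpow, ← Real.rpow_neg (by positivity), ← Real.rpow_mul (by positivity)]
  congr 1
  ring

/-- At least one of |p|, |q| is s/2 or more, so the smaller decay factor is at most 2/s. Its power 1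
- ε pays for s^(ε-1), and the remaining power ε joins the larger factor to form an integrable power
1 + ε. Taking ε = 1 costs nothing for small s, while small ε gives almost the decay s⁻¹ for large s.
-/
theorem decay_mul_decay_le {ε : ℝ} (hε : 0 < ε) (hε1 : ε ≤ 1) {s : ℝ} (hs : 0 < s) {p q : ℝ}
    (h : s ≤ |p| + |q|) :
    decay p * decay q ≤ 2 * s ^ (ε - 1) * (decay p ^ (1 + ε) + decay q ^ (1 + ε)) := by
  wlog hpq : decay p ≤ decay q generalizing p q
  · rw [mul_comm (decay p), add_comm (decay p ^ _)]
    exact this (by linarith) (le_of_not_ge hpq)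
  have hp := decay_pos p
  have hq := decay_pos q
  have h1 : s * decay p ≤ 2 := by
    have := abs_mul_decay_le p
    have := abs_mul_decay_le q
    nlinarith [abs_nonneg q]
  have h2 : (s * decay p) ^ (1 - ε) ≤ 2 := by
    calc (s * decay p) ^ (1 - ε) ≤ 2 ^ (1 - ε) :=
          Real.rpow_le_rpow (by positivity) h1 (by linarith)
      _ ≤ 2 ^ (1 : ℝ) := Real.rpow_le_rpow_of_exponent_le (by norm_num) (by linarith)
      _ = 2 := by norm_num
  rw [Real.mul_rpow hs.le hp.le] at h2
  have h3 : decay p = decay p ^ (1 - ε) * decay p ^ ε := by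
    rw [← Real.rpow_add hp]; norm_num
  have h4 : decay p ^ (1 - ε) ≤ 2 * s ^ (ε - 1) := by
    have : s ^ (ε - 1) * s ^ (1 - ε) = 1 := by rw [← Real.rpow_add hs]; norm_num
    have h5 : 0 < s ^ (ε - 1) := by positivity
    calc decay p ^ (1 - ε) = s ^ (ε - 1) * (s ^ (1 - ε) * decay p ^ (1 - ε)) := by
          rw [← mul_assoc, this, one_mul]
      _ ≤ s ^ (ε - 1) * 2 := by gcongr
      _ = _ := by ring
  have h6 : decay p ^ ε * decay q ≤ decay q ^ (1 + ε) := by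
    rw [Real.rpow_add hq, Real.rpow_one, mul_comm]
    gcongr
  calc decay p * decay q = decay p ^ (1 - ε) * (decay p ^ ε * decay q) := by
        rw [← mul_assoc, ← h3]
    _ ≤ (2 * s ^ (ε - 1)) * decay q ^ (1 + ε) := by gcongr
    _ ≤ _ := by
      refine mul_le_mul_of_nonneg_left ?_ (by positivity)
      have : 0 ≤ decay p ^ (1 + ε) := by positivity
      linarith

/-- The decay of `f` along the pairs of points `p`, `p + τ s`, times a weight in `s`. -/
def pairWeight (τ : ℝ) (w : ℝ → ℂ) (x : ℝ × ℝ) : ℂ :=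
  w x.1 * ((decay x.2 * decay (x.2 + τ * x.1) : ℝ) : ℂ)

theorem measurable_second (τ : ℝ) : Measurable fun x : ℝ × ℝ => x.2 + τ * x.1 := by fun_prop

theorem measurePreserving_shear (τ : ℝ) (ν : Measure ℝ) [SFinite ν] :
    MeasurePreserving (fun x : ℝ × ℝ => (x.1, x.2 + τ * x.1)) (ν.prod volume) (ν.prod volume) :=
  (MeasurePreserving.id ν).skew_product (measurable_second τ)
    (Eventually.of_forall fun s => map_add_right_eq_self volume (τ * s))

theorem norm_pairWeight_le {τ : ℝ} (hτ : |τ| = 1) {ε : ℝ} (hε : 0 < ε) (hε1 : ε ≤ 1) (w : ℝ → ℂ)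
    {x : ℝ × ℝ} (hx : 0 < x.1) : ‖pairWeight τ w x‖ ≤
      2 * (x.1 ^ (ε - 1) * ‖w x.1‖ * decay x.2 ^ (1 + ε)) +
        2 * (x.1 ^ (ε - 1) * ‖w x.1‖ * decay (x.2 + τ * x.1) ^ (1 + ε)) := by
  have h1 : x.1 ≤ |x.2| + |x.2 + τ * x.1| := by
    have h2 : |τ * x.1| = x.1 := by rw [abs_mul, hτ, one_mul, abs_of_pos hx]
    have h3 : |τ * x.1| ≤ |x.2 + τ * x.1| + |x.2| := by
      have := abs_sub (x.2 + τ * x.1) x.2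
      rwa [add_sub_cancel_left] at this
    linarith
  have h2 := decay_mul_decay_le hε hε1 hx h1
  have hp := decay_pos x.2
  have hq := decay_pos (x.2 + τ * x.1)
  rw [pairWeight, norm_mul, Complex.norm_real, Real.norm_of_nonneg (by positivity)]
  refine (mul_le_mul_of_nonneg_left h2 (norm_nonneg _)).trans_eq (by ring)

theorem aestronglyMeasurable_pairWeight {τ : ℝ} {ν : Measure ℝ} [SFinite ν] {w : ℝ → ℂ}
    (hw : AEStronglyMeasurable w ν) : AEStronglyMeasurable (pairWeight τ w) (ν.prod volume) := by
  refine hw.comp_fst.mul (Continuous.aestronglyMeasurable ?_)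
  have := continuous_decay
  fun_prop

theorem integrable_pairWeight_bound {τ : ℝ} {ν : Measure ℝ} [SFinite ν] {ε : ℝ} (hε : 0 < ε)
    {g : ℝ → ℝ} (hg : Integrable g ν) : Integrable (fun x : ℝ × ℝ =>
      2 * (g x.1 * decay x.2 ^ (1 + ε)) + 2 * (g x.1 * decay (x.2 + τ * x.1) ^ (1 + ε)))
      (ν.prod volume) := by
  have h1 : Integrable (fun x : ℝ × ℝ => g x.1 * decay x.2 ^ (1 + ε)) (ν.prod volume) :=
    hg.mul_prod (integrable_decay_rpow hε)
  exact (h1.const_mul 2).add (((measurePreserving_shear τ ν).integrable_comp_of_integrable h1).const_mul 2)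

theorem integrable_pairWeight {τ : ℝ} (hτ : |τ| = 1) {ν : Measure ℝ} [SFinite ν]
    (hν : ∀ᵐ s ∂ν, 0 < s) {ε : ℝ} (hε : 0 < ε) (hε1 : ε ≤ 1) {w : ℝ → ℂ}
    (hw : AEStronglyMeasurable w ν) (hi : Integrable (fun s => s ^ (ε - 1) * ‖w s‖) ν) :
    Integrable (pairWeight τ w) (ν.prod volume) := by
  refine (integrable_pairWeight_bound (τ := τ) hε hi).mono' (aestronglyMeasurable_pairWeight hw) ?_
  have h : ∀ᵐ x ∂ν.prod (volume : Measure ℝ), 0 < x.1 :=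
    Measure.quasiMeasurePreserving_fst.ae hν
  exact h.mono fun x hx => norm_pairWeight_le hτ hε hε1 w hx

/-- `∫_I s^(-z-1) (⋯) ds`, as an average over pairs of rotations. -/
def powOp (τ : ℝ) (I : Set ℝ) (z : ℂ) : Sec₂ (-1) 1 →L[ℂ] Sec 1 2 :=
  avgOp ((volume.restrict I).prod volume) (fun x => x.2) (fun x => x.2 + τ * x.1)
    (pairWeight τ fun s => (s : ℂ) ^ (-z - 1))

theorem aestronglyMeasurable_cpow (I : Set ℝ) (z : ℂ) :
    AEStronglyMeasurable (fun s : ℝ => (s : ℂ) ^ (-z - 1)) (volume.restrict I) :=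
  (by fun_prop : Measurable fun s : ℝ => (s : ℂ) ^ (-z - 1)).aestronglyMeasurable

theorem norm_cpow_of_pos {s : ℝ} (hs : 0 < s) (z : ℂ) : ‖(s : ℂ) ^ (-z - 1)‖ = s ^ (-z.re - 1) := by
  rw [Complex.norm_cpow_eq_rpow_re_of_pos hs]; simp

theorem integrableOn_rpow_Ioc {r : ℝ} (hr : -1 < r) :
    IntegrableOn (fun s : ℝ => s ^ r) (Ioc 0 1) :=
  (intervalIntegrable_iff_integrableOn_Ioc_of_le zero_le_one).1
    (intervalIntegral.intervalIntegrable_rpow' hr)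

theorem ae_pos_restrict {I : Set ℝ} (hI : MeasurableSet I) (hI0 : I ⊆ Ioi 0) :
    ∀ᵐ s ∂(volume.restrict I), 0 < s := (ae_restrict_mem hI).mono fun _ hs => hI0 hs

theorem integrable_powWeight_Ioc {τ : ℝ} (hτ : |τ| = 1) {z : ℂ} (hz : z.re < 0) :
    Integrable (pairWeight τ fun s => (s : ℂ) ^ (-z - 1))
      ((volume.restrict (Ioc 0 1)).prod volume) := by
  refine integrable_pairWeight hτ (ae_pos_restrict measurableSet_Ioc Ioc_subset_Ioi_self) one_pos
    le_rfl (aestronglyMeasurable_cpow _ z) ?_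
  refine (integrableOn_rpow_Ioc (r := -z.re - 1) (by linarith)).congr_fun (fun s hs => ?_)
    measurableSet_Ioc
  simp only [sub_self, Real.rpow_zero, one_mul, norm_cpow_of_pos hs.1]

theorem integrable_powWeight_Ioi {τ : ℝ} (hτ : |τ| = 1) {z : ℂ} (hz : -1 < z.re) :
    Integrable (pairWeight τ fun s => (s : ℂ) ^ (-z - 1))
      ((volume.restrict (Ioi 1)).prod volume) := by
  -- An ε below 1 + Re z makes s^(ε-1) s^(-Re z-1) integrable at infinity; this is where the
  -- condition -1 < Re z enters.
  have hε : 0 < min 1 ((1 + z.re) / 2) := lt_min one_pos (by linarith)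
  refine integrable_pairWeight hτ
    (ae_pos_restrict measurableSet_Ioi (Ioi_subset_Ioi zero_le_one)) hε (min_le_left _ _)
    (aestronglyMeasurable_cpow _ z) ?_
  have h1 : min 1 ((1 + z.re) / 2) - 1 + (-z.re - 1) < -1 := by
    have := min_le_right 1 ((1 + z.re) / 2)
    linarith
  refine (integrableOn_Ioi_rpow_of_lt h1 one_pos).congr_fun (fun s hs => ?_) measurableSet_Ioi
  have hs0 : 0 < s := one_pos.trans hs
  simp only [norm_cpow_of_pos hs0, ← Real.rpow_add hs0]

theorem hasDerivAt_powWeight (z : ℂ) {τ : ℝ} {x : ℝ × ℝ} (hx : 0 < x.1) :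
    HasDerivAt (fun z => pairWeight τ (fun s => (s : ℂ) ^ (-z - 1)) x)
      (pairWeight τ (fun s => -(Real.log s : ℂ) * (s : ℂ) ^ (-z - 1)) x) z := by
  have h1 : HasDerivAt (fun z : ℂ => -z - 1) (-1) z := ((hasDerivAt_id z).neg).sub_const 1
  have h2 := h1.const_cpow (c := (x.1 : ℂ)) (Or.inl (by exact_mod_cast hx.ne'))
  unfold pairWeight
  refine (h2.mul_const _).congr_deriv ?_
  simp only [Complex.ofReal_log hx.le]
  ring

/-- On the ball the real part of the exponent moves by less than δ, and the logarithm is absorbed by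
a further power s^δ at the cost 1/δ; together they account for the shift 2δ. -/
theorem norm_log_mul_cpow_le_Ioc {s : ℝ} (hs : s ∈ Ioc (0 : ℝ) 1) {z z₀ : ℂ} {δ : ℝ} (hδ : 0 < δ)
    (hz : z ∈ Metric.ball z₀ δ) : ‖-(Real.log s : ℂ) * (s : ℂ) ^ (-z - 1)‖ ≤
      1 / δ * s ^ (-(z₀.re + 2 * δ) - 1) := by
  have hs0 := hs.1
  rw [norm_mul, norm_neg, Complex.norm_real, norm_cpow_of_pos hs0]
  have h1 : z.re < z₀.re + δ := by
    have := (Complex.abs_re_le_norm (z - z₀)).trans_lt (mem_ball_iff_norm.1 hz)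
    rw [Complex.sub_re] at this
    linarith [le_abs_self (z.re - z₀.re)]
  have h2 : s ^ (-z.re - 1) ≤ s ^ (-(z₀.re + δ) - 1) :=
    Real.rpow_le_rpow_of_exponent_ge hs0 hs.2 (by linarith)
  have h3 := (Real.abs_log_mul_self_rpow_lt s δ hs0 hs.2 hδ).le
  rw [abs_mul, abs_of_pos (Real.rpow_pos_of_pos hs0 δ)] at h3
  have h4 : s ^ (-(z₀.re + δ) - 1) = s ^ δ * s ^ (-(z₀.re + 2 * δ) - 1) := by
    rw [← Real.rpow_add hs0]; congr 1; ring
  rw [Real.norm_eq_abs]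
  calc |Real.log s| * s ^ (-z.re - 1) ≤ |Real.log s| * s ^ (-(z₀.re + δ) - 1) := by gcongr
    _ = (|Real.log s| * s ^ δ) * s ^ (-(z₀.re + 2 * δ) - 1) := by rw [h4]; ring
    _ ≤ _ := by gcongr

theorem norm_log_mul_cpow_le_Ioi {s : ℝ} (hs : 1 < s) {z z₀ : ℂ} {δ : ℝ} (hδ : 0 < δ)
    (hz : z ∈ Metric.ball z₀ δ) : ‖-(Real.log s : ℂ) * (s : ℂ) ^ (-z - 1)‖ ≤
      1 / δ * s ^ (-(z₀.re - 2 * δ) - 1) := by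
  have hs0 : 0 < s := one_pos.trans hs
  rw [norm_mul, norm_neg, Complex.norm_real, norm_cpow_of_pos hs0]
  have h1 : z₀.re - δ < z.re := by
    have := (Complex.abs_re_le_norm (z - z₀)).trans_lt (mem_ball_iff_norm.1 hz)
    rw [Complex.sub_re] at this
    linarith [neg_abs_le (z.re - z₀.re)]
  have h2 : s ^ (-z.re - 1) ≤ s ^ (-(z₀.re - δ) - 1) :=
    Real.rpow_le_rpow_of_exponent_le hs.le (by linarith)
  have h3 := Real.log_le_rpow_div hs0.le hδ
  have h4 : s ^ (-(z₀.re - 2 * δ) - 1) = s ^ δ * s ^ (-(z₀.re - δ) - 1) := by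
    rw [← Real.rpow_add hs0]; congr 1; ring
  rw [Real.norm_eq_abs, abs_of_nonneg (Real.log_nonneg hs.le)]
  have := Real.log_nonneg hs.le
  calc Real.log s * s ^ (-z.re - 1) ≤ (s ^ δ / δ) * s ^ (-(z₀.re - δ) - 1) := by gcongr
    _ = _ := by rw [h4]; ring

theorem norm_pairWeight_mono {τ : ℝ} {w w' : ℝ → ℂ} {x : ℝ × ℝ} (h : ‖w x.1‖ ≤ ‖w' x.1‖) :
    ‖pairWeight τ w x‖ ≤ ‖pairWeight τ w' x‖ := by
  unfold pairWeight
  rw [norm_mul, norm_mul]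
  gcongr

theorem differentiableAt_powOp_Ioc {τ : ℝ} (hτ : |τ| = 1) {z₀ : ℂ} (hz₀ : z₀.re < 0)
    (h : Sec 1 2 →L[ℂ] ℂ) (f : Sec₂ (-1) 1) :
    DifferentiableAt ℂ (fun z => h (powOp τ (Ioc 0 1) z f)) z₀ := by
  -- With this δ the dominating exponent is Re z₀ + 2δ = Re z₀/2, still negative.
  set δ : ℝ := -z₀.re / 4 with hδdef
  have hδ : 0 < δ := by rw [hδdef]; linarith
  have hae : ∀ᵐ x ∂(volume.restrict (Ioc (0 : ℝ) 1)).prod (volume : Measure ℝ), x.1 ∈ Ioc (0 : ℝ) 1 :=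
    Measure.quasiMeasurePreserving_fst.ae (ae_restrict_mem measurableSet_Ioc)
  have hB : Integrable (fun x => ‖(1 / δ : ℂ) * pairWeight τ
      (fun s => (s : ℂ) ^ (-((z₀.re + 2 * δ : ℝ) : ℂ) - 1)) x‖)
      ((volume.restrict (Ioc 0 1)).prod volume) :=
    ((integrable_powWeight_Ioc hτ (by rw [Complex.ofReal_re, hδdef]; linarith)).const_mul _).norm
  refine (hasDerivAt_avgOp measurable_snd (measurable_second τ) (W' := fun z => pairWeight τ
    fun s => -(Real.log s : ℂ) * (s : ℂ) ^ (-z - 1)) hδ hB (fun z hz => ?_) ?_ ?_ ?_ h f).differentiableAt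
  · refine integrable_powWeight_Ioc hτ ?_
    have := (Complex.abs_re_le_norm (z - z₀)).trans_lt (mem_ball_iff_norm.1 hz)
    rw [Complex.sub_re] at this
    linarith [le_abs_self (z.re - z₀.re)]
  · exact aestronglyMeasurable_pairWeight
      ((by fun_prop : Measurable fun s : ℝ =>
        -(Real.log s : ℂ) * (s : ℂ) ^ (-z₀ - 1)).aestronglyMeasurable)
  · exact hae.mono fun x hx z _ => hasDerivAt_powWeight z hx.1
  · refine hae.mono fun x hx z hz => ?_
    have h1 := norm_log_mul_cpow_le_Ioc hx hδ hz
    have e : (1 / δ : ℂ) * pairWeight τ (fun s => (s : ℂ) ^ (-((z₀.re + 2 * δ : ℝ) : ℂ) - 1)) x =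
      pairWeight τ (fun s => (1 / δ : ℂ) * (s : ℂ) ^ (-((z₀.re + 2 * δ : ℝ) : ℂ) - 1)) x := by
      unfold pairWeight; ring
    rw [e]
    refine norm_pairWeight_mono (h1.trans_eq ?_)
    rw [norm_mul, norm_cpow_of_pos hx.1, Complex.ofReal_re, norm_div, norm_one, Complex.norm_real,
      Real.norm_of_nonneg hδ.le]

theorem differentiableAt_powOp_Ioi {τ : ℝ} (hτ : |τ| = 1) {z₀ : ℂ} (hz₀ : -1 < z₀.re)
    (h : Sec 1 2 →L[ℂ] ℂ) (f : Sec₂ (-1) 1) :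
    DifferentiableAt ℂ (fun z => h (powOp τ (Ioi 1) z f)) z₀ := by
  -- Here Re z₀ - 2δ = (Re z₀ - 1)/2 still exceeds -1.
  set δ : ℝ := (1 + z₀.re) / 4 with hδdef
  have hδ : 0 < δ := by rw [hδdef]; linarith
  have hae : ∀ᵐ x ∂(volume.restrict (Ioi (1 : ℝ))).prod (volume : Measure ℝ), x.1 ∈ Ioi (1 : ℝ) :=
    Measure.quasiMeasurePreserving_fst.ae (ae_restrict_mem measurableSet_Ioi)
  have hB : Integrable (fun x => ‖(1 / δ : ℂ) * pairWeight τ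
      (fun s => (s : ℂ) ^ (-((z₀.re - 2 * δ : ℝ) : ℂ) - 1)) x‖)
      ((volume.restrict (Ioi 1)).prod volume) :=
    ((integrable_powWeight_Ioi hτ (by rw [Complex.ofReal_re, hδdef]; linarith)).const_mul _).norm
  refine (hasDerivAt_avgOp measurable_snd (measurable_second τ) (W' := fun z => pairWeight τ
    fun s => -(Real.log s : ℂ) * (s : ℂ) ^ (-z - 1)) hδ hB (fun z hz => ?_) ?_ ?_ ?_ h f).differentiableAt
  · refine integrable_powWeight_Ioi hτ ?_
    have := (Complex.abs_re_le_norm (z - z₀)).trans_lt (mem_ball_iff_norm.1 hz)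
    rw [Complex.sub_re] at this
    linarith [neg_abs_le (z.re - z₀.re)]
  · exact aestronglyMeasurable_pairWeight
      ((by fun_prop : Measurable fun s : ℝ =>
        -(Real.log s : ℂ) * (s : ℂ) ^ (-z₀ - 1)).aestronglyMeasurable)
  · exact hae.mono fun x hx z _ => hasDerivAt_powWeight z (one_pos.trans hx)
  · refine hae.mono fun x hx z hz => ?_
    have h1 := norm_log_mul_cpow_le_Ioi hx hδ hz
    have e : (1 / δ : ℂ) * pairWeight τ (fun s => (s : ℂ) ^ (-((z₀.re - 2 * δ : ℝ) : ℂ) - 1)) x =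
      pairWeight τ (fun s => (1 / δ : ℂ) * (s : ℂ) ^ (-((z₀.re - 2 * δ : ℝ) : ℂ) - 1)) x := by
      unfold pairWeight; ring
    rw [e]
    refine norm_pairWeight_mono (h1.trans_eq ?_)
    rw [norm_mul, norm_cpow_of_pos (one_pos.trans hx), Complex.ofReal_re, norm_div, norm_one,
      Complex.norm_real, Real.norm_of_nonneg hδ.le]

/-! ### Meromorphic families of operators -/

instance {ε : ℤˣ} {lam : ℂ} : ContinuousConstSMul ℂ (Sec ε lam) where
  continuous_const_smul c :=
    (continuous_subtype_val.const_smul c).subtype_mk fun f => (Sec ε lam).smul_mem c f.2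

/-- The integers, as a subset of the complex plane. -/
def integerPoints : Set ℂ := range ((↑) : ℤ → ℂ)

/-- `B` is a family of operators that depends meromorphically on the parameter in `D`, in the weak
sense, with poles at integers. -/
def IsMeroOn (D : Set ℂ) (B : ℂ → Sec₂ (-1) 1 →L[ℂ] Sec 1 2) : Prop :=
  ∀ s ∈ D, ∃ n : ℕ, (s ∉ integerPoints → n = 0) ∧ ∀ (h : Sec 1 2 →L[ℂ] ℂ) (f : Sec₂ (-1) 1),
    AnalyticAt ℂ (fun z => (z - s) ^ n * h (B z f)) s

theorem analyticAt_pow_mono {s : ℂ} {n k : ℕ} (hnk : n ≤ k) {F : ℂ → ℂ}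
    (h : AnalyticAt ℂ (fun z => (z - s) ^ n * F z) s) :
    AnalyticAt ℂ (fun z => (z - s) ^ k * F z) s := by
  have h1 : AnalyticAt ℂ (fun z => (z - s) ^ (k - n) * ((z - s) ^ n * F z)) s :=
    ((analyticAt_id.sub analyticAt_const).pow _).mul h
  refine h1.congr (Eventually.of_forall fun z => ?_)
  change (z - s) ^ (k - n) * ((z - s) ^ n * F z) = _
  rw [← mul_assoc, ← pow_add, Nat.sub_add_cancel hnk]

namespace IsMeroOn

variable {D D' : Set ℂ} {B B' : ℂ → Sec₂ (-1) 1 →L[ℂ] Sec 1 2}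

theorem of_differentiableOn (hD : IsOpen D) (h : ∀ (h : Sec 1 2 →L[ℂ] ℂ) (f : Sec₂ (-1) 1),
    ∀ z ∈ D, DifferentiableAt ℂ (fun z => h (B z f)) z) : IsMeroOn D B := fun s hs =>
  ⟨0, fun _ => rfl, fun l f => by
    have h1 : DifferentiableOn ℂ (fun z => l (B z f)) D :=
      fun z hz => (h l f z hz).differentiableWithinAt
    simpa using h1.analyticAt (hD.mem_nhds hs)⟩

theorem const (A : Sec₂ (-1) 1 →L[ℂ] Sec 1 2) : IsMeroOn D fun _ => A := fun _ _ =>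
  ⟨0, fun _ => rfl, fun l f => by simpa using analyticAt_const⟩

theorem add (h : IsMeroOn D B) (h' : IsMeroOn D B') : IsMeroOn D fun z => B z + B' z := fun s hs => by
  obtain ⟨n, hn0, hn⟩ := h s hs
  obtain ⟨k, hk0, hk⟩ := h' s hs
  refine ⟨max n k, fun hs' => by simp [hn0 hs', hk0 hs'], fun l f => ?_⟩
  refine ((analyticAt_pow_mono (le_max_left n k) (hn l f)).add
    (analyticAt_pow_mono (le_max_right n k) (hk l f))).congr (Eventually.of_forall fun z => ?_)
  simp [mul_add]

theorem sum {κ : Type*} (t : Finset κ) {B : κ → ℂ → Sec₂ (-1) 1 →L[ℂ] Sec 1 2}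
    (h : ∀ i ∈ t, IsMeroOn D (B i)) : IsMeroOn D fun z => ∑ i ∈ t, B i z := by
  classical
  induction t using Finset.induction_on with
  | empty => simpa using const (D := D) 0
  | insert i t hi ih =>
    simp_rw [Finset.sum_insert hi]
    exact (h i (Finset.mem_insert_self _ _)).add
      (ih fun j hj => h j (Finset.mem_insert_of_mem hj))

theorem comp_left (h : IsMeroOn D B) (L : Sec 1 2 →L[ℂ] Sec 1 2) :
    IsMeroOn D fun z => L.comp (B z) := fun s hs => by
  obtain ⟨n, hn0, hn⟩ := h s hs
  exact ⟨n, hn0, fun l f => hn (l.comp L) f⟩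

theorem comp_right (h : IsMeroOn D B) (R : Sec₂ (-1) 1 →L[ℂ] Sec₂ (-1) 1) :
    IsMeroOn D fun z => (B z).comp R := fun s hs => by
  obtain ⟨n, hn0, hn⟩ := h s hs
  exact ⟨n, hn0, fun l f => hn l (R f)⟩

theorem shift (h : IsMeroOn D B) (k : ℤ) : IsMeroOn {z | z + k ∈ D} fun z => B (z + k) :=
  fun s hs => by
  obtain ⟨n, hn0, hn⟩ := h (s + k) hs
  refine ⟨n, fun hs' => hn0 ?_, fun l f => ?_⟩
  · rintro ⟨j, hj⟩
    exact hs' ⟨j - k, by push_cast; rw [hj]; ring⟩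
  · have h1 : AnalyticAt ℂ (fun z : ℂ => z + k) s := analyticAt_id.add analyticAt_const
    refine ((hn l f).comp_of_eq h1 rfl).congr (Eventually.of_forall fun z => ?_)
    simp

theorem mono (h : IsMeroOn D B) (hD : D' ⊆ D) : IsMeroOn D' B := fun s hs => h s (hD hs)

theorem smul (h : IsMeroOn D B) {c : ℂ → ℂ}
    (hc : ∀ s, ∃ n : ℕ, (s ∉ integerPoints → n = 0) ∧ AnalyticAt ℂ (fun z => (z - s) ^ n * c z) s) :
    IsMeroOn D fun z => c z • B z := fun s hs => by
  obtain ⟨n, hn0, hn⟩ := h s hs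
  obtain ⟨k, hk0, hk⟩ := hc s
  refine ⟨k + n, fun hs' => by simp [hn0 hs', hk0 hs'], fun l f => ?_⟩
  refine (hk.mul (hn l f)).congr (Eventually.of_forall fun z => ?_)
  simp [pow_add]
  ring

theorem congr_of_eventuallyEq (h : IsMeroOn D B) (hB : ∀ s ∈ D, ∀ᶠ z in 𝓝 s, B z = B' z) :
    IsMeroOn D B' := fun s hs => by
  obtain ⟨n, hn0, hn⟩ := h s hs
  exact ⟨n, hn0, fun l f => (hn l f).congr ((hB s hs).mono fun z hz => by simp only [hz])⟩

end IsMeroOn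

theorem exists_order_inv_add (a : ℤ) (s : ℂ) : ∃ n : ℕ, (s ∉ integerPoints → n = 0) ∧
    AnalyticAt ℂ (fun z : ℂ => (z - s) ^ n * (z + a)⁻¹) s := by
  have h1 : AnalyticAt ℂ (fun z : ℂ => z + a) s := analyticAt_id.add analyticAt_const
  by_cases hs : s + a = 0
  -- The order 2 compensates for the value 0 of the inverse at 0: (z - s)² (z + a)⁻¹ equals z + a
  -- everywhere, whereas with order 1 the product would be 1 off s and 0 at s, hence discontinuous.
  · refine ⟨2, fun h => (h ⟨-a, by push_cast; linear_combination -hs⟩).elim, ?_⟩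
    refine h1.congr (Eventually.of_forall fun z => ?_)
    have e : z - s = z + a := by linear_combination -hs
    simp only [e]
    rcases eq_or_ne (z + a) 0 with h0 | h0
    · simp [h0]
    · field_simp
  · exact ⟨0, fun _ => rfl, (h1.inv hs).congr (Eventually.of_forall fun z => by simp)⟩

/-! ### Differential operators on sections over the product -/

instance {ε : ℤˣ} {lam : ℂ} : ContinuousConstSMul ℂ (Sec₂ ε lam) where
  continuous_const_smul c :=
    (continuous_subtype_val.const_smul c).subtype_mk fun f => (Sec₂ ε lam).smul_mem c f.2

/-- The action of a pair of scalars on a pair of planes. -/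
def scalePair (s t : ℝ) : Plane × Plane →L[ℝ] Plane × Plane :=
  (s • ContinuousLinearMap.id ℝ Plane).prodMap (t • ContinuousLinearMap.id ℝ Plane)

theorem scalePair_apply (s t : ℝ) (x : Plane × Plane) : scalePair s t x = (s • x.1, t • x.2) := rfl

theorem scalePair_mem {s t : ℝ} (hs : s ≠ 0) (ht : t ≠ 0) {x : Plane × Plane} :
    scalePair s t x ∈ puncturedProd ↔ x ∈ puncturedProd :=
  and_congr (smul_ne_zero_iff_right hs) (smul_ne_zero_iff_right ht)

theorem fderiv_scalePair {ε : ℤˣ} {lam : ℂ} (f : Sec₂ ε lam) {s t : ℝ} (hs : s ≠ 0) (ht : t ≠ 0)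
    {x : Plane × Plane} (hx : x ∈ puncturedProd) (y : Plane × Plane) :
    fderiv ℝ f.1 (scalePair s t x) (scalePair s t y) =
      character ε lam s * character ε lam t * fderiv ℝ f.1 x y := by
  have h1 := (f.1.differentiableAt ((scalePair_mem hs ht).2 hx)).hasFDerivAt.comp x
    (scalePair s t).hasFDerivAt
  have h2 := (f.1.differentiableAt hx).hasFDerivAt.const_mul
    (character ε lam s * character ε lam t)
  have h3 : ⇑f.1 ∘ ⇑(scalePair s t) = fun x => character ε lam s * character ε lam t * f.1 x :=
    funext fun x => f.2 s t hs ht x.1 x.2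
  rw [h3] at h1
  exact congrArg (fun L => L y) (h1.unique h2)

/-- The derivative of sections over the product along a pair of linear vector fields. -/
def alongPair {ε : ℤˣ} {lam : ℂ} (Y Z : Plane →L[ℝ] Plane) : Sec₂ ε lam →L[ℂ] Sec₂ ε lam :=
  ((SmoothFun.alongLinear (Y.prodMap Z)).comp (Sec₂ ε lam).subtypeL).codRestrict _
    (fun f s t hs ht v w => by
      change SmoothFun.alongLinear (Y.prodMap Z) f.1 (scalePair s t (v, w)) =
        _ * SmoothFun.alongLinear (Y.prodMap Z) f.1 (v, w)
      by_cases hx : (v, w) ∈ puncturedProd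
      · rw [SmoothFun.alongLinear_apply _ _ hx,
          SmoothFun.alongLinear_apply _ _ ((scalePair_mem hs ht).2 hx),
          ← fderiv_scalePair f hs ht hx]
        congr 1
        simp [scalePair_apply]
      · rw [SmoothFun.eq_zero _ hx, SmoothFun.eq_zero _ (mt (scalePair_mem hs ht).1 hx), mul_zero])

theorem alongPair_apply {ε : ℤˣ} {lam : ℂ} (Y Z : Plane →L[ℝ] Plane) (f : Sec₂ ε lam)
    {x : Plane × Plane} (hx : x ∈ puncturedProd) :
    (alongPair Y Z f).1 x = fderiv ℝ f.1 x (Y x.1, Z x.2) :=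
  SmoothFun.alongLinear_apply _ _ hx

theorem character_neg_one_one {t : ℝ} (ht : t ≠ 0) : character (-1) 1 t = (t : ℂ)⁻¹ := by
  unfold character
  rw [if_neg (by decide), Complex.cpow_neg_one, ← Complex.ofReal_inv, ← Complex.ofReal_inv,
    ← Complex.ofReal_mul]
  congr 1
  rcases lt_or_gt_of_ne ht with h | h
  · rw [Real.sign_of_neg h, abs_of_neg h]; field_simp
  · rw [Real.sign_of_pos h, abs_of_pos h, mul_one]

theorem smul_smul_apply (f : Sec₂ (-1) 1) {s t : ℝ} (hs : s ≠ 0) (ht : t ≠ 0) (v w : Plane) :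
    f.1 (s • v, t • w) = (s : ℂ)⁻¹ * (t : ℂ)⁻¹ * f.1 (v, w) := by
  rw [f.2 s t hs ht, character_neg_one_one hs, character_neg_one_one ht]

/-- Euler's identity in degree -1, from differentiating f(s v, w) = s⁻¹ f(v, w) at s = 1. It is what
relates the derivative along `rot u` to 1 + p ∂/∂p. -/
theorem fderiv_euler_left (f : Sec₂ (-1) 1) {v w : Plane} (hx : (v, w) ∈ puncturedProd) :
    fderiv ℝ f.1 (v, w) (v, 0) = -f.1 (v, w) := by
  have h0 : HasDerivAt (fun s : ℝ => (s • v, w)) (v, 0) 1 := by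
    simpa using ((hasDerivAt_id (1 : ℝ)).smul_const v).prodMk (hasDerivAt_const 1 w)
  have h1 := HasFDerivAt.comp_hasDerivAt_of_eq (1 : ℝ)
    (f.1.differentiableAt hx).hasFDerivAt h0 (by simp)
  have h2 : HasDerivAt (fun s : ℝ => ((s : ℂ)⁻¹) * f.1 (v, w)) (-f.1 (v, w)) 1 := by
    have h3 := ((hasDerivAt_inv (one_ne_zero (α := ℝ))).ofReal_comp).mul_const (f.1 (v, w))
    simpa using h3
  refine h1.unique (h2.congr_of_eventuallyEq ?_)
  filter_upwards [eventually_ne_nhds (one_ne_zero (α := ℝ))] with s hs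
  have := smul_smul_apply f hs one_ne_zero v w
  simpa using this

theorem fderiv_euler_right (f : Sec₂ (-1) 1) {v w : Plane} (hx : (v, w) ∈ puncturedProd) :
    fderiv ℝ f.1 (v, w) (0, w) = -f.1 (v, w) := by
  have h0 : HasDerivAt (fun s : ℝ => (v, s • w)) (0, w) 1 := by
    simpa using (hasDerivAt_const 1 v).prodMk ((hasDerivAt_id (1 : ℝ)).smul_const w)
  have h1 := HasFDerivAt.comp_hasDerivAt_of_eq (1 : ℝ)
    (f.1.differentiableAt hx).hasFDerivAt h0 (by simp)
  have h2 : HasDerivAt (fun s : ℝ => ((s : ℂ)⁻¹) * f.1 (v, w)) (-f.1 (v, w)) 1 := by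
    have h3 := ((hasDerivAt_inv (one_ne_zero (α := ℝ))).ofReal_comp).mul_const (f.1 (v, w))
    simpa using h3
  refine h1.unique (h2.congr_of_eventuallyEq ?_)
  filter_upwards [eventually_ne_nhds (one_ne_zero (α := ℝ))] with s hs
  have := smul_smul_apply f one_ne_zero hs v w
  simpa using this

/-! ### Operators with coefficients on the target -/

/-- The coefficient `u_i u_j / |u|²`. -/
def coef (u : Plane) (i j : Fin 2) : ℝ := u i * u j / normSq u

theorem contDiffOn_coef (i j : Fin 2) :
    ContDiffOn ℝ ∞ (fun u => (coef u i j : ℂ)) (punctured : Set Plane) := by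
  refine Complex.ofRealCLM.contDiff.comp_contDiffOn (ContDiffOn.div ?_ ?_ fun u hu => ?_)
  · exact ContDiff.contDiffOn (by fun_prop)
  · unfold normSq
    exact ContDiff.contDiffOn (by fun_prop)
  · exact (normSq_pos hu).ne'

/-- Multiplication by `u_i u_j / |u|²`. -/
def mulCoef (i j : Fin 2) : Sec 1 2 →L[ℂ] Sec 1 2 :=
  ((SmoothFun.mul (SmoothFun.ofContDiffOn _ (contDiffOn_coef i j))).comp
    (Sec 1 2).subtypeL).codRestrict _ (fun f t ht v => by
      change SmoothFun.ofContDiffOn _ (contDiffOn_coef i j) (t • v) * f.1 (t • v) =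
        _ * (SmoothFun.ofContDiffOn _ (contDiffOn_coef i j) v * f.1 v)
      rw [f.2 t ht]
      by_cases hv : v ∈ punctured
      · have hv' : t • v ∈ punctured := smul_ne_zero ht hv
        have e : coef (t • v) i j = coef v i j := by
          unfold coef
          rw [normSq_smul, Pi.smul_apply, Pi.smul_apply, smul_eq_mul, smul_eq_mul]
          have := normSq_pos hv
          field_simp
        rw [SmoothFun.ofContDiffOn_apply _ hv, SmoothFun.ofContDiffOn_apply _ hv', e]
        ring
      · rw [f.1.eq_zero hv]; ring)

theorem mulCoef_apply (i j : Fin 2) (f : Sec 1 2) {u : Plane} (hu : u ∈ punctured) :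
    (mulCoef i j f).1 u = coef u i j * f.1 u := by
  change SmoothFun.ofContDiffOn _ (contDiffOn_coef i j) u * f.1 u = _
  rw [SmoothFun.ofContDiffOn_apply _ hu]

/-- Families of operators, the coefficients of an operator depending on a point of the plane. -/
abbrev OpFamily := Fin 2 → Fin 2 → Sec₂ (-1) 1 →L[ℂ] Sec₂ (-1) 1

/-- The value of a family of operators at a point. -/
def OpFamily.at (A : OpFamily) (u : Plane) : Sec₂ (-1) 1 →L[ℂ] Sec₂ (-1) 1 :=
  ∑ i, ∑ j, (coef u i j : ℂ) • A i j

/-- The composition of `B` with a family of operators. -/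
def OpFamily.lift (A : OpFamily) (B : Sec₂ (-1) 1 →L[ℂ] Sec 1 2) : Sec₂ (-1) 1 →L[ℂ] Sec 1 2 :=
  ∑ i, ∑ j, (mulCoef i j).comp (B.comp (A i j))

theorem Sec.sum_apply {ε : ℤˣ} {lam : ℂ} {κ : Type*} (s : Finset κ) (g : κ → Sec ε lam) (x : Plane) :
    (∑ i ∈ s, g i).1 x = ∑ i ∈ s, (g i).1 x :=
  map_sum (AddMonoidHom.mk' (fun g : Sec ε lam => g.1 x) fun _ _ => rfl) g s

theorem Sec₂.sum_apply {ε : ℤˣ} {lam : ℂ} {κ : Type*} (s : Finset κ) (g : κ → Sec₂ ε lam)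
    (x : Plane × Plane) : (∑ i ∈ s, g i).1 x = ∑ i ∈ s, (g i).1 x :=
  map_sum (AddMonoidHom.mk' (fun g : Sec₂ ε lam => g.1 x) fun _ _ => rfl) g s

theorem OpFamily.at_apply (A : OpFamily) (u : Plane) (f : Sec₂ (-1) 1) :
    A.at u f = ∑ i, ∑ j, (coef u i j : ℂ) • A i j f := by
  simp [OpFamily.at]

theorem OpFamily.lift_apply (A : OpFamily) (B : Sec₂ (-1) 1 →L[ℂ] Sec 1 2) (f : Sec₂ (-1) 1)
    {u : Plane} (hu : u ∈ punctured) : (A.lift B f).1 u = (B (A.at u f)).1 u := by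
  have h1 : A.lift B f = ∑ i, ∑ j, mulCoef i j (B (A i j f)) := by simp [OpFamily.lift]
  rw [h1, OpFamily.at_apply, map_sum, Sec.sum_apply, Sec.sum_apply]
  refine Finset.sum_congr rfl fun i _ => ?_
  rw [map_sum, Sec.sum_apply, Sec.sum_apply]
  refine Finset.sum_congr rfl fun j _ => ?_
  rw [mulCoef_apply _ _ _ hu, map_smul]
  rfl

/-- A matrix unit. -/
def unitEnd (i j : Fin 2) : Plane →L[ℝ] Plane :=
  (ContinuousLinearMap.proj (R := ℝ) (φ := fun _ : Fin 2 => ℝ) j).smulRight (Pi.single i 1)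

theorem unitEnd_apply (i j : Fin 2) (v : Plane) : unitEnd i j v = v j • Pi.single i 1 := rfl

/-- The inverse of `rot`. -/
def rotInv : Plane →L[ℝ] Plane := -rot

/-- The matrix (u_i u_j/|u|²) is the orthogonal projection onto the line of u. It extracts p u from
`lineMap p u`, and u from `rotInv (lineMap p u)`. In this way vector fields attached to u become
combinations of fixed linear vector fields, with coefficients of degree 0 in u. -/
theorem sum_coef_unitEnd (u v : Plane) : ∑ i, ∑ j, coef u i j • unitEnd i j v =
    ((v 0 * u 0 + v 1 * u 1) / normSq u) • u := by
  ext k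
  fin_cases k <;> simp [Fin.sum_univ_two, coef, unitEnd_apply] <;> ring

theorem sum_coef_unitEnd_lineMap {u : Plane} (hu : u ∈ punctured) (p : ℝ) :
    ∑ i, ∑ j, coef u i j • unitEnd i j (lineMap p u) = p • u := by
  rw [sum_coef_unitEnd]
  congr 1
  have := (normSq_pos hu).ne'
  rw [div_eq_iff this]
  simp [normSq]
  ring

theorem sum_coef_unitEnd_rotInv {u : Plane} (hu : u ∈ punctured) (p : ℝ) :
    ∑ i, ∑ j, coef u i j • unitEnd i j (rotInv (lineMap p u)) = u := by
  rw [sum_coef_unitEnd]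
  have h : (rotInv (lineMap p u) 0 * u 0 + rotInv (lineMap p u) 1 * u 1) / normSq u = 1 := by
    rw [div_eq_one_iff_eq (normSq_pos hu).ne']
    simp [normSq, rotInv]
    ring
  rw [h, one_smul]

/-- `∂/∂p`. -/
def opDp : OpFamily := fun i j => alongPair ((unitEnd i j).comp rotInv) 0
/-- `∂/∂q`. -/
def opDq : OpFamily := fun i j => alongPair 0 ((unitEnd i j).comp rotInv)
/-- `1 + p ∂/∂p`. -/
def opP : OpFamily := fun i j => alongPair (-(rot.comp ((unitEnd i j).comp rotInv))) 0
/-- `1 + q ∂/∂q`. -/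
def opQ : OpFamily := fun i j => alongPair 0 (-(rot.comp ((unitEnd i j).comp rotInv)))
/-- `p (1 + p ∂/∂p)`. -/
def opPP : OpFamily := fun i j => alongPair (-(rot.comp (unitEnd i j))) 0
/-- `q (1 + q ∂/∂q)`. -/
def opQQ : OpFamily := fun i j => alongPair 0 (-(rot.comp (unitEnd i j)))

/-- The values of a section on the pairs of points with coordinates `p`, `q`. -/
def pencil (f : Sec₂ (-1) 1) (u : Plane) (p q : ℝ) : ℂ := f.1 (lineMap p u, lineMap q u)

theorem lineMap_pair_mem {u : Plane} (hu : u ∈ punctured) (p q : ℝ) :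
    (lineMap p u, lineMap q u) ∈ puncturedProd := ⟨lineMap_ne_zero p hu, lineMap_ne_zero q hu⟩

theorem pencil_at_alongPair {u : Plane} (hu : u ∈ punctured) (Y Z : Fin 2 → Fin 2 → Plane →L[ℝ] Plane)
    (f : Sec₂ (-1) 1) (p q : ℝ) :
    pencil (OpFamily.at (fun i j => alongPair (Y i j) (Z i j)) u f) u p q =
      fderiv ℝ f.1 (lineMap p u, lineMap q u) (∑ i, ∑ j, coef u i j • Y i j (lineMap p u),
        ∑ i, ∑ j, coef u i j • Z i j (lineMap q u)) := by
  have e : (∑ i, ∑ j, coef u i j • Y i j (lineMap p u), ∑ i, ∑ j, coef u i j • Z i j (lineMap q u)) =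
      ∑ i, ∑ j, coef u i j • (Y i j (lineMap p u), Z i j (lineMap q u)) := by
    ext k <;> simp [Fin.sum_univ_two]
  rw [pencil, OpFamily.at_apply, e, Sec₂.sum_apply, map_sum]
  refine Finset.sum_congr rfl fun i _ => ?_
  rw [Sec₂.sum_apply, map_sum]
  refine Finset.sum_congr rfl fun j _ => ?_
  rw [map_smul, Complex.real_smul]
  change (coef u i j : ℂ) * (alongPair (Y i j) (Z i j) f).1 _ = _
  rw [alongPair_apply _ _ _ (lineMap_pair_mem hu p q)]

theorem sum_coef_neg_rot (u : Plane) (x : Fin 2 → Fin 2 → Plane) :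
    ∑ i, ∑ j, coef u i j • -(rot (x i j)) = -rot (∑ i, ∑ j, coef u i j • x i j) := by
  simp only [map_sum, map_smul, smul_neg, Finset.sum_neg_distrib]

theorem hasDerivAt_lineMap (u : Plane) (p : ℝ) : HasDerivAt (fun p => lineMap p u) u p := by
  simpa [lineMap_apply] using ((hasDerivAt_id p).smul_const u).const_add (rot u)

theorem pencil_opDp {u : Plane} (hu : u ∈ punctured) (f : Sec₂ (-1) 1)
    (p q : ℝ) : pencil (opDp.at u f) u p q =
    fderiv ℝ f.1 (lineMap p u, lineMap q u) (u, 0) := by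
  refine (pencil_at_alongPair hu _ _ f p q).trans ?_
  simp only [ContinuousLinearMap.comp_apply, sum_coef_unitEnd_rotInv hu, zero_apply,
    smul_zero, Finset.sum_const_zero]

theorem pencil_opDq {u : Plane} (hu : u ∈ punctured) (f : Sec₂ (-1) 1)
    (p q : ℝ) : pencil (opDq.at u f) u p q =
    fderiv ℝ f.1 (lineMap p u, lineMap q u) (0, u) := by
  refine (pencil_at_alongPair hu _ _ f p q).trans ?_
  simp only [ContinuousLinearMap.comp_apply, sum_coef_unitEnd_rotInv hu, zero_apply,
    smul_zero, Finset.sum_const_zero]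

theorem pencil_opP_eq {u : Plane} (hu : u ∈ punctured) (f : Sec₂ (-1) 1)
    (p q : ℝ) : pencil (opP.at u f) u p q =
    -fderiv ℝ f.1 (lineMap p u, lineMap q u) (rot u, 0) := by
  refine (pencil_at_alongPair hu _ _ f p q).trans ?_
  rw [← map_neg]
  congr 1
  simp only [neg_apply, ContinuousLinearMap.comp_apply, sum_coef_neg_rot,
    sum_coef_unitEnd_rotInv hu,
    zero_apply, smul_zero, Finset.sum_const_zero, Prod.neg_mk, neg_zero]

theorem pencil_opQ_eq {u : Plane} (hu : u ∈ punctured) (f : Sec₂ (-1) 1)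
    (p q : ℝ) : pencil (opQ.at u f) u p q =
    -fderiv ℝ f.1 (lineMap p u, lineMap q u) (0, rot u) := by
  refine (pencil_at_alongPair hu _ _ f p q).trans ?_
  rw [← map_neg]
  congr 1
  simp only [neg_apply, ContinuousLinearMap.comp_apply, sum_coef_neg_rot,
    sum_coef_unitEnd_rotInv hu,
    zero_apply, smul_zero, Finset.sum_const_zero, Prod.neg_mk, neg_zero]

theorem pencil_opPP {u : Plane} (hu : u ∈ punctured) (f : Sec₂ (-1) 1)
    (p q : ℝ) : pencil (opPP.at u f) u p q = p * pencil (opP.at u f) u p q := by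
  rw [pencil_opP_eq hu]
  refine (pencil_at_alongPair hu _ _ f p q).trans ?_
  rw [mul_neg, ← Complex.real_smul, ← map_smul, ← map_neg]
  congr 1
  simp only [neg_apply, ContinuousLinearMap.comp_apply, sum_coef_neg_rot,
    sum_coef_unitEnd_lineMap hu,
    zero_apply, smul_zero, Finset.sum_const_zero, Prod.neg_mk, neg_zero,
    Prod.smul_mk, map_smul]

theorem pencil_opQQ {u : Plane} (hu : u ∈ punctured) (f : Sec₂ (-1) 1)
    (p q : ℝ) : pencil (opQQ.at u f) u p q = q * pencil (opQ.at u f) u p q := by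
  rw [pencil_opQ_eq hu]
  refine (pencil_at_alongPair hu _ _ f p q).trans ?_
  rw [mul_neg, ← Complex.real_smul, ← map_smul, ← map_neg]
  congr 1
  simp only [neg_apply, ContinuousLinearMap.comp_apply, sum_coef_neg_rot,
    sum_coef_unitEnd_lineMap hu,
    zero_apply, smul_zero, Finset.sum_const_zero, Prod.neg_mk, neg_zero,
    Prod.smul_mk, map_smul]

/-- Since `lineMap p u` = rot u + p u, Euler's identity equates minus the derivative along rot u
with f + p ∂f/∂p. The first expression contains no factor p, so 1 + p ∂/∂p maps pencils of sections
to pencils of sections and does not spoil the decay at infinity. -/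
theorem pencil_opP {u : Plane} (hu : u ∈ punctured) (f : Sec₂ (-1) 1)
    (p q : ℝ) : pencil (opP.at u f) u p q =
    pencil f u p q + p * pencil (opDp.at u f) u p q := by
  have h := fderiv_euler_left f (lineMap_pair_mem hu p q)
  have e : ((lineMap p u, 0) : Plane × Plane) = (rot u, 0) + p • (u, 0) := by
    simp [lineMap_apply]
  rw [e, map_add, map_smul, Complex.real_smul] at h
  rw [pencil_opP_eq hu, pencil_opDp hu, pencil]
  linear_combination -h

theorem pencil_opQ {u : Plane} (hu : u ∈ punctured) (f : Sec₂ (-1) 1)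
    (p q : ℝ) : pencil (opQ.at u f) u p q =
    pencil f u p q + q * pencil (opDq.at u f) u p q := by
  have h := fderiv_euler_right f (lineMap_pair_mem hu p q)
  have e : ((0, lineMap q u) : Plane × Plane) = (0, rot u) + q • (0, u) := by
    simp [lineMap_apply]
  rw [e, map_add, map_smul, Complex.real_smul] at h
  rw [pencil_opQ_eq hu, pencil_opDq hu, pencil]
  linear_combination -h

theorem hasDerivAt_pencil_left {u : Plane} (hu : u ∈ punctured) (f : Sec₂ (-1) 1)
    (p q : ℝ) : HasDerivAt (fun p => pencil f u p q)
    (pencil (opDp.at u f) u p q) p := by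
  rw [pencil_opDp hu]
  exact (f.1.differentiableAt (lineMap_pair_mem hu p q)).hasFDerivAt.comp_hasDerivAt p
    ((hasDerivAt_lineMap u p).prodMk (hasDerivAt_const p _))

theorem hasDerivAt_pencil_right {u : Plane} (hu : u ∈ punctured) (f : Sec₂ (-1) 1)
    (p q : ℝ) : HasDerivAt (fun q => pencil f u p q)
    (pencil (opDq.at u f) u p q) q := by
  rw [pencil_opDq hu]
  exact (f.1.differentiableAt (lineMap_pair_mem hu p q)).hasFDerivAt.comp_hasDerivAt q
    ((hasDerivAt_const q _).prodMk (hasDerivAt_lineMap u q))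

theorem hasDerivAt_pencil_diag {u : Plane} (hu : u ∈ punctured) (f : Sec₂ (-1) 1) (p t : ℝ) : HasDerivAt (fun p => pencil f u p (p + t))
    (pencil (opDp.at u f) u p (p + t) + pencil (opDq.at u f) u p (p + t)) p := by
  rw [pencil_opDp hu, pencil_opDq hu, ← map_add]
  have h := (f.1.differentiableAt (lineMap_pair_mem hu p (p + t))).hasFDerivAt.comp_hasDerivAt p
    ((hasDerivAt_lineMap u p).prodMk ((hasDerivAt_lineMap u (p + t)).comp_add_const p t))
  rw [Prod.mk_add_mk, add_zero, zero_add]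
  exact h

/-- With P = 1 + p ∂/∂p, the Leibniz rule gives ∂/∂p (p P f) = P f + p ∂/∂p P f = P (P f). Thus P²
is a total derivative in p, which `corr_opDp` can turn into a derivative in s. -/
theorem pencil_opDp_opPP {u : Plane} (hu : u ∈ punctured) (f : Sec₂ (-1) 1)
    (p q : ℝ) : pencil (opDp.at u (opPP.at u f)) u p q =
    pencil (opP.at u (opP.at u f)) u p q := by
  have h1 := hasDerivAt_pencil_left hu (opPP.at u f) p q
  have h2 := ((hasDerivAt_id p).ofReal_comp).mul (hasDerivAt_pencil_left hu (opP.at u f) p q)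
  rw [pencil_opP hu]
  refine h1.unique (h2.congr_of_eventuallyEq ?_ |>.congr_deriv ?_)
  · exact Eventually.of_forall fun p => pencil_opPP hu f p q
  · simp

theorem pencil_opDq_opQQ {u : Plane} (hu : u ∈ punctured) (f : Sec₂ (-1) 1)
    (p q : ℝ) : pencil (opDq.at u (opQQ.at u f)) u p q =
    pencil (opQ.at u (opQ.at u f)) u p q := by
  have h1 := hasDerivAt_pencil_right hu (opQQ.at u f) p q
  have h2 := ((hasDerivAt_id q).ofReal_comp).mul (hasDerivAt_pencil_right hu (opQ.at u f) p q)
  rw [pencil_opQ hu]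
  refine h1.unique (h2.congr_of_eventuallyEq ?_ |>.congr_deriv ?_)
  · exact Eventually.of_forall fun q => pencil_opQQ hu f p q
  · simp

theorem pencil_opP_opQQ {u : Plane} (hu : u ∈ punctured) (f : Sec₂ (-1) 1)
    (p q : ℝ) : pencil (opP.at u (opQQ.at u f)) u p q =
    q * pencil (opP.at u (opQ.at u f)) u p q := by
  have h1 := hasDerivAt_pencil_left hu (opQQ.at u f) p q
  have h2 := (hasDerivAt_pencil_left hu (opQ.at u f) p q).const_mul (q : ℂ)
  rw [pencil_opP hu, pencil_opP hu, pencil_opQQ hu, h1.unique (h2.congr_of_eventuallyEq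
    (Eventually.of_forall fun p => pencil_opQQ hu f p q))]
  ring

theorem pencil_opQ_opPP {u : Plane} (hu : u ∈ punctured) (f : Sec₂ (-1) 1)
    (p q : ℝ) : pencil (opQ.at u (opPP.at u f)) u p q =
    p * pencil (opQ.at u (opP.at u f)) u p q := by
  have h1 := hasDerivAt_pencil_right hu (opPP.at u f) p q
  have h2 := (hasDerivAt_pencil_right hu (opP.at u f) p q).const_mul (p : ℂ)
  rw [pencil_opQ hu, pencil_opQ hu, pencil_opPP hu, h1.unique (h2.congr_of_eventuallyEq
    (Eventually.of_forall fun q => pencil_opPP hu f p q))]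
  ring

/-! ### Size and continuity of the pencil -/

theorem pencil_add (f g : Sec₂ (-1) 1) (u : Plane) (p q : ℝ) :
    pencil (f + g) u p q = pencil f u p q + pencil g u p q := rfl

theorem pencil_sub (f g : Sec₂ (-1) 1) (u : Plane) (p q : ℝ) :
    pencil (f - g) u p q = pencil f u p q - pencil g u p q := rfl

theorem pencil_eq (f : Sec₂ (-1) 1) (u : Plane) (p q : ℝ) :
    pencil f u p q = ((decay p * decay q : ℝ) : ℂ) * f.1 (unitPair p q u) := by
  have hp : (decay p : ℂ) ≠ 0 := by exact_mod_cast (decay_pos p).ne'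
  have hq : (decay q : ℂ) ≠ 0 := by exact_mod_cast (decay_pos q).ne'
  rw [unitPair_apply, unitMap_apply, unitMap_apply,
    smul_smul_apply f (decay_pos p).ne' (decay_pos q).ne', pencil]
  push_cast
  field_simp

theorem exists_pencil_bound (f : Sec₂ (-1) 1) {u : Plane} (hu : u ∈ punctured) :
    ∃ C : ℝ, 0 ≤ C ∧ ∀ p q, ‖pencil f u p q‖ ≤ C * (decay p * decay q) := by
  obtain ⟨C, hC⟩ := (isCompact_annulus_prod (normSq u) (normSq u)).exists_bound_of_continuousOn
    (f.1.contDiffOn.continuousOn.mono (annulus_prod_subset (normSq_pos hu)))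
  refine ⟨max C 0, le_max_right _ _, fun p q => ?_⟩
  have hp := decay_pos p
  have hq := decay_pos q
  rw [pencil_eq, norm_mul, Complex.norm_real, Real.norm_of_nonneg (by positivity), mul_comm]
  gcongr
  exact (hC _ (unitPair_mem_annulus p q ⟨le_rfl, le_rfl⟩)).trans (le_max_left _ _)

theorem continuous_pencil (f : Sec₂ (-1) 1) {u : Plane} (hu : u ∈ punctured) :
    Continuous fun x : ℝ × ℝ => pencil f u x.1 x.2 := by
  refine f.1.contDiffOn.continuousOn.comp_continuous ?_ fun x => lineMap_pair_mem hu x.1 x.2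
  simp only [lineMap_apply]
  fun_prop

/-! ### The integral over pairs of points at a given distance -/

/-- The integral of a section over the pairs of points with coordinates `p`, `p + τ s`. -/
def corr (τ : ℝ) (f : Sec₂ (-1) 1) (u : Plane) (s : ℝ) : ℂ := ∫ p, pencil f u p (p + τ * s)

theorem decay_mul_decay_le_add (p q : ℝ) : decay p * decay q ≤ (1 + p ^ 2)⁻¹ + (1 + q ^ 2)⁻¹ := by
  rw [← decay_sq, ← decay_sq]
  nlinarith [sq_nonneg (decay p - decay q), sq_nonneg (decay p), sq_nonneg (decay q)]

theorem integrable_inv_one_add_sq_shift (t : ℝ) : Integrable fun p : ℝ => (1 + (p + t) ^ 2)⁻¹ :=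
  integrable_inv_one_add_sq.comp_add_right t

theorem integrable_pencil (f : Sec₂ (-1) 1) {u : Plane} (hu : u ∈ punctured) (t : ℝ) :
    Integrable fun p => pencil f u p (p + t) := by
  obtain ⟨C, hC0, hC⟩ := exists_pencil_bound f hu
  refine ((integrable_inv_one_add_sq.add (integrable_inv_one_add_sq_shift t)).const_mul C).mono'
    ((continuous_pencil f hu).comp (by fun_prop : Continuous fun p : ℝ => (p, p + t))).aestronglyMeasurable
    (Eventually.of_forall fun p => (hC _ _).trans ?_)
  exact mul_le_mul_of_nonneg_left (decay_mul_decay_le_add p (p + t)) hC0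

theorem corr_add (τ : ℝ) (f g : Sec₂ (-1) 1) {u : Plane} (hu : u ∈ punctured) (s : ℝ) :
    corr τ (f + g) u s = corr τ f u s + corr τ g u s :=
  integral_add (integrable_pencil f hu _) (integrable_pencil g hu _)

theorem corr_sub (τ : ℝ) (f g : Sec₂ (-1) 1) {u : Plane} (hu : u ∈ punctured) (s : ℝ) :
    corr τ (f - g) u s = corr τ f u s - corr τ g u s :=
  integral_sub (integrable_pencil f hu _) (integrable_pencil g hu _)

theorem hasDerivAt_corr {τ : ℝ} (hτ : |τ| = 1) (f : Sec₂ (-1) 1) {u : Plane} (hu : u ∈ punctured)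
    (s : ℝ) : HasDerivAt (corr τ f u) (τ * corr τ (opDq.at u f) u s) s := by
  obtain ⟨C, hC0, hC⟩ := exists_pencil_bound (opDq.at u f) hu
  have hcont : ∀ t, Continuous fun p : ℝ => (p, p + t) := fun t => by fun_prop
  unfold corr
  rw [← integral_const_mul]
  refine (hasDerivAt_integral_of_dominated_loc_of_deriv_le (μ := volume)
    (F := fun s p => pencil f u p (p + τ * s))
    (F' := fun s p => τ * pencil (opDq.at u f) u p (p + τ * s))
    -- The factor 3: if |y - y'| ≤ 1 then 1 + y² ≤ 3 (1 + y'²), so the bound at s controls the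
    -- integrand for all s' in the unit ball.
    (bound := fun p => C * ((1 + p ^ 2)⁻¹ + 3 * (1 + (p + τ * s) ^ 2)⁻¹))
    (Metric.ball_mem_nhds s one_pos)
    (Eventually.of_forall fun s => (integrable_pencil f hu _).aestronglyMeasurable)
    (integrable_pencil f hu _) ((integrable_pencil _ hu _).aestronglyMeasurable.const_mul _)
    (Eventually.of_forall fun p s' hs' => ?_)
    ((integrable_inv_one_add_sq.add ((integrable_inv_one_add_sq_shift _).const_mul 3)).const_mul C)
    (Eventually.of_forall fun p s' _ => ?_)).2
  · rw [norm_mul, Complex.norm_real, Real.norm_eq_abs, hτ, one_mul]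
    refine (hC _ _).trans (mul_le_mul_of_nonneg_left ((decay_mul_decay_le_add _ _).trans ?_) hC0)
    refine add_le_add_right ?_ _
    have h1 : |τ * (s' - s)| ≤ 1 := by
      rw [abs_mul, hτ, one_mul]
      exact (mem_ball_iff_norm.1 hs').le
    have h2 : (τ * (s' - s)) ^ 2 ≤ 1 := by rw [← sq_abs]; nlinarith [abs_nonneg (τ * (s' - s))]
    rw [← div_eq_mul_inv, inv_eq_one_div, div_le_div_iff₀ (by positivity) (by positivity)]
    nlinarith [sq_nonneg (p + τ * s' + τ * (s' - s))]
  · have h1 : HasDerivAt (fun s : ℝ => p + τ * s) τ s' := by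
      simpa using ((hasDerivAt_id s').const_mul τ).const_add p
    have h2 := (hasDerivAt_pencil_right hu f p (p + τ * s')).scomp s' h1
    rw [Complex.real_smul] at h2
    exact h2

/-- ∂/∂p + ∂/∂q is the derivative along the line q = p + τ s, and the integral of an integrable
derivative of an integrable function vanishes. -/
theorem corr_opDp (τ : ℝ) (f : Sec₂ (-1) 1) {u : Plane} (hu : u ∈ punctured) (s : ℝ) :
    corr τ (opDp.at u f) u s = -corr τ (opDq.at u f) u s := by
  have h := integral_eq_zero_of_hasDerivAt_of_integrable
    (fun p => hasDerivAt_pencil_diag hu f p (τ * s))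
    ((integrable_pencil _ hu _).add (integrable_pencil _ hu _)) (integrable_pencil f hu _)
  rw [integral_add (integrable_pencil _ hu _) (integrable_pencil _ hu _)] at h
  exact eq_neg_of_add_eq_zero_left h

theorem tendsto_decay_atTop : Tendsto decay atTop (𝓝 0) := by
  have h : Tendsto (fun p : ℝ => √(1 + p ^ 2)) atTop atTop :=
    Real.tendsto_sqrt_atTop.comp (tendsto_atTop_add_const_left _ _ (tendsto_pow_atTop two_ne_zero))
  exact h.inv_tendsto_atTop

theorem decay_neg (p : ℝ) : decay (-p) = decay p := by simp [decay]

theorem tendsto_decay_atBot : Tendsto decay atBot (𝓝 0) :=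
  (tendsto_decay_atTop.comp tendsto_neg_atBot_atTop).congr fun p => decay_neg p

/-- The function p f on the line q = p + τ s has derivative P f + Q f - f - (q - p) ∂f/∂q, where P =
1 + p ∂/∂p and Q = 1 + q ∂/∂q. It tends to 0 at both ends, as |p| `decay p` ≤ 1 while `decay q`
tends to 0, so the derivative integrates to 0. -/
theorem mul_corr_opDq (τ : ℝ) (f : Sec₂ (-1) 1) {u : Plane} (hu : u ∈ punctured) (s : ℝ) :
    ((τ * s : ℝ) : ℂ) * corr τ (opDq.at u f) u s + corr τ f u s =
      corr τ (opP.at u f) u s + corr τ (opQ.at u f) u s := by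
  obtain ⟨C, hC0, hC⟩ := exists_pencil_bound f hu
  have i := fun g => integrable_pencil g hu (τ * s)
  have hd : ∀ p : ℝ, HasDerivAt (fun p : ℝ => (p : ℂ) * pencil f u p (p + τ * s))
      (pencil (opP.at u f) u p (p + τ * s) + pencil (opQ.at u f) u p (p + τ * s) -
        (((τ * s : ℝ) : ℂ) * pencil (opDq.at u f) u p (p + τ * s) + pencil f u p (p + τ * s))) p :=
    fun p => by
    refine (((hasDerivAt_id p).ofReal_comp).mul (hasDerivAt_pencil_diag hu f p (τ * s))).congr_deriv ?_
    rw [pencil_opP hu, pencil_opQ hu]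
    push_cast
    simp only [id]
    ring
  have hlim : ∀ l : Filter ℝ, Tendsto (fun p => decay (p + τ * s)) l (𝓝 0) →
      Tendsto (fun p : ℝ => (p : ℂ) * pencil f u p (p + τ * s)) l (𝓝 0) := fun l hl => by
    refine squeeze_zero_norm (fun p => ?_) (by simpa using hl.const_mul C)
    rw [norm_mul, Complex.norm_real, Real.norm_eq_abs]
    have h1 := abs_mul_decay_le p
    have h2 := decay_pos (p + τ * s)
    calc |p| * ‖pencil f u p (p + τ * s)‖ ≤ |p| * (C * (decay p * decay (p + τ * s))) := by
          gcongr; exact hC _ _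
      _ = (|p| * decay p) * (C * decay (p + τ * s)) := by ring
      _ ≤ 1 * (C * decay (p + τ * s)) := by gcongr
      _ = _ := one_mul _
  have h := integral_of_hasDerivAt_of_tendsto hd
    (((i _).add (i _)).sub (((i _).const_mul _).add (i _)))
    (hlim atBot (tendsto_decay_atBot.comp (tendsto_atBot_add_const_right _ _ tendsto_id)))
    (hlim atTop (tendsto_decay_atTop.comp (tendsto_atTop_add_const_right _ _ tendsto_id)))
  have i1 : Integrable fun p =>
      pencil (opP.at u f) u p (p + τ * s) + pencil (opQ.at u f) u p (p + τ * s) := (i _).add (i _)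
  have i2 : Integrable fun p => ((τ * s : ℝ) : ℂ) * pencil (opDq.at u f) u p (p + τ * s) +
      pencil f u p (p + τ * s) := ((i _).const_mul _).add (i _)
  rw [integral_sub i1 i2, integral_add (i _) (i _),
    integral_add ((i _).const_mul _) (i _), integral_const_mul] at h
  unfold corr
  linear_combination -h

theorem norm_corr_le {τ : ℝ} (hτ : |τ| = 1) (f : Sec₂ (-1) 1) {u : Plane} (hu : u ∈ punctured)
    {ε : ℝ} (hε : 0 < ε) (hε1 : ε ≤ 1) :
    ∃ C : ℝ, ∀ s, 0 < s → ‖corr τ f u s‖ ≤ C * s ^ (ε - 1) := by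
  obtain ⟨C, hC0, hC⟩ := exists_pencil_bound f hu
  have i := integrable_decay_rpow hε
  refine ⟨C * (4 * ∫ p, decay p ^ (1 + ε)), fun s hs => ?_⟩
  have h1 : ∀ p : ℝ, s ≤ |p| + |p + τ * s| := fun p => by
    have h2 : |τ * s| = s := by rw [abs_mul, hτ, one_mul, abs_of_pos hs]
    have h3 := abs_sub (p + τ * s) p
    rw [add_sub_cancel_left] at h3
    linarith
  refine (norm_integral_le_of_norm_le (((i.add (i.comp_add_right (τ * s))).const_mul
    (2 * s ^ (ε - 1))).const_mul C) (Eventually.of_forall fun p => (hC _ _).trans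
      (mul_le_mul_of_nonneg_left (decay_mul_decay_le hε hε1 hs (h1 p)) hC0))).trans_eq ?_
  rw [integral_const_mul, integral_const_mul]
  simp only [Pi.add_apply]
  rw [integral_add i (i.comp_add_right (τ * s)),
    integral_add_right_eq_self (fun p => decay p ^ (1 + ε))]
  ring

/-! ### Differential equations -/

/-- The Euler operator. -/
def opE : OpFamily := fun i j => opP i j + opQ i j

/-- The first operator that lowers the exponent. -/
def opF : OpFamily := fun i j => opQQ i j - opPP i j

theorem OpFamily.at_add (A B : OpFamily) (u : Plane) (f : Sec₂ (-1) 1) :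
    OpFamily.at (fun i j => A i j + B i j) u f = A.at u f + B.at u f := by
  simp only [OpFamily.at_apply, add_apply, smul_add, Finset.sum_add_distrib]

theorem OpFamily.at_sub (A B : OpFamily) (u : Plane) (f : Sec₂ (-1) 1) :
    OpFamily.at (fun i j => A i j - B i j) u f = A.at u f - B.at u f := by
  simp only [OpFamily.at_apply, sub_apply, smul_sub, Finset.sum_sub_distrib]

theorem opE_at (u : Plane) (f : Sec₂ (-1) 1) : opE.at u f = opP.at u f + opQ.at u f :=
  OpFamily.at_add _ _ _ _

theorem opF_at (u : Plane) (f : Sec₂ (-1) 1) : opF.at u f = opQQ.at u f - opPP.at u f :=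
  OpFamily.at_sub _ _ _ _

/-- The second operator that lowers the exponent. -/
def secondAt (u : Plane) (f : Sec₂ (-1) 1) : Sec₂ (-1) 1 :=
  opP.at u (opQQ.at u f) + opQQ.at u (opP.at u f) -
    (opPP.at u (opQ.at u f) + opQ.at u (opPP.at u f))

theorem mul_deriv_corr {τ : ℝ} (hτ : |τ| = 1) (f : Sec₂ (-1) 1) {u : Plane} (hu : u ∈ punctured)
    (s : ℝ) : (s : ℂ) * deriv (corr τ f u) s + corr τ f u s = corr τ (opE.at u f) u s := by
  have h := mul_corr_opDq τ f hu s
  rw [(hasDerivAt_corr hτ f hu s).deriv, opE_at, corr_add _ _ _ hu, ← h]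
  push_cast
  ring

/-- Write E = P + Q and expand E² without commuting P and Q. The terms P² and Q² are total
derivatives of p P and q Q; since ∂/∂p and -∂/∂q agree under the integral, they combine to ∂/∂q (q Q
- p P), which is τ d/ds. The mixed terms satisfy (q - p)(PQ + QP) = `secondAt`, with q - p = τ s.
Both parts therefore gain a power of s at infinity. -/
theorem corr_opE_opE {τ : ℝ} (hτ : |τ| = 1) (f : Sec₂ (-1) 1) {u : Plane} (hu : u ∈ punctured)
    {s : ℝ} (hs : s ≠ 0) : corr τ (opE.at u (opE.at u f)) u s =
      τ * deriv (corr τ (opF.at u f) u) s + τ * (s : ℂ)⁻¹ * corr τ (secondAt u f) u s := by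
  have hτ2 : (τ : ℂ) * τ = 1 := by
    have : τ * τ = 1 := by rw [← abs_mul_abs_self, hτ, one_mul]
    exact_mod_cast this
  have e1 : ∀ g h : Sec₂ (-1) 1, (∀ p q, pencil g u p q = pencil h u p q) →
      corr τ g u s = corr τ h u s := fun g h hgh => by
    unfold corr; simp only [hgh]
  have a1 := e1 _ _ (pencil_opDp_opPP hu f)
  have a2 := e1 _ _ (pencil_opDq_opQQ hu f)
  have a3 := corr_opDp τ (opPP.at u f) hu s
  have a4 : corr τ (secondAt u f) u s = ((τ * s : ℝ) : ℂ) *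
      (corr τ (opP.at u (opQ.at u f)) u s + corr τ (opQ.at u (opP.at u f)) u s) := by
    rw [← corr_add τ _ _ hu]
    unfold corr
    rw [← integral_const_mul]
    refine integral_congr_ae (Eventually.of_forall fun p => ?_)
    simp only [secondAt, pencil_sub, pencil_add]
    rw [pencil_opP_opQQ hu, pencil_opQQ hu, pencil_opPP hu, pencil_opQ_opPP hu]
    push_cast
    ring
  have hs' : (s : ℂ) ≠ 0 := by exact_mod_cast hs
  rw [(hasDerivAt_corr hτ _ hu s).deriv, ← mul_assoc, hτ2, one_mul, a4, opF_at, map_sub,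
    corr_sub _ _ _ hu]
  simp only [opE_at, map_add, corr_add _ _ _ hu]
  push_cast
  have a5 : (τ : ℂ) * (s : ℂ)⁻¹ * (τ * s * (corr τ (opP.at u (opQ.at u f)) u s +
      corr τ (opQ.at u (opP.at u f)) u s)) = corr τ (opP.at u (opQ.at u f)) u s +
      corr τ (opQ.at u (opP.at u f)) u s := by
    field_simp
    linear_combination (corr τ (opP.at u (opQ.at u f)) u s +
      corr τ (opQ.at u (opP.at u f)) u s) * hτ2
  rw [a5, a2, ← a1, a3]
  ring

/-! ### Integration by parts -/

theorem continuous_corr {τ : ℝ} (hτ : |τ| = 1) (f : Sec₂ (-1) 1) {u : Plane} (hu : u ∈ punctured) :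
    Continuous (corr τ f u) :=
  continuous_iff_continuousAt.2 fun s => (hasDerivAt_corr hτ f hu s).continuousAt

theorem aestronglyMeasurable_cpow_mul_corr {τ : ℝ} (hτ : |τ| = 1) (f : Sec₂ (-1) 1) {u : Plane}
    (hu : u ∈ punctured) (z : ℂ) (I : Set ℝ) :
    AEStronglyMeasurable (fun s : ℝ => (s : ℂ) ^ (-z - 1) * corr τ f u s) (volume.restrict I) :=
  (aestronglyMeasurable_cpow I z).mul (continuous_corr hτ f hu).aestronglyMeasurable

theorem integrableOn_Ioc_corr {τ : ℝ} (hτ : |τ| = 1) (f : Sec₂ (-1) 1) {u : Plane}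
    (hu : u ∈ punctured) {z : ℂ} (hz : z.re < 0) :
    IntegrableOn (fun s : ℝ => (s : ℂ) ^ (-z - 1) * corr τ f u s) (Ioc 0 1) := by
  obtain ⟨C, hC⟩ := norm_corr_le hτ f hu one_pos le_rfl
  refine ((integrableOn_rpow_Ioc (r := -z.re - 1) (by linarith)).mul_const C).mono'
    (aestronglyMeasurable_cpow_mul_corr hτ f hu z _)
    ((ae_restrict_mem measurableSet_Ioc).mono fun s hs => ?_)
  have h1 := hC s hs.1
  rw [sub_self, Real.rpow_zero, mul_one] at h1
  rw [norm_mul, norm_cpow_of_pos hs.1]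
  have := hs.1
  gcongr

theorem exists_pos_exponent {r : ℝ} (hr : -1 < r) : ∃ ε, 0 < ε ∧ ε ≤ 1 ∧ ε < 1 + r :=
  ⟨min 1 ((1 + r) / 2), lt_min one_pos (by linarith), min_le_left _ _,
    (min_le_right _ _).trans_lt (by linarith)⟩

theorem integrableOn_Ioi_corr {τ : ℝ} (hτ : |τ| = 1) (f : Sec₂ (-1) 1) {u : Plane}
    (hu : u ∈ punctured) {z : ℂ} (hz : -1 < z.re) :
    IntegrableOn (fun s : ℝ => (s : ℂ) ^ (-z - 1) * corr τ f u s) (Ioi 1) := by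
  obtain ⟨ε, hε, hε1, hε2⟩ := exists_pos_exponent hz
  obtain ⟨C, hC⟩ := norm_corr_le hτ f hu hε hε1
  refine ((integrableOn_Ioi_rpow_of_lt (a := -z.re - 1 + (ε - 1)) (by linarith) one_pos).mul_const
    C).mono' (aestronglyMeasurable_cpow_mul_corr hτ f hu z _)
    ((ae_restrict_mem measurableSet_Ioi).mono fun s hs => ?_)
  have hs0 : 0 < s := one_pos.trans hs
  rw [norm_mul, norm_cpow_of_pos hs0, Real.rpow_add hs0, mul_assoc, mul_comm _ C]
  have := hC s hs0
  gcongr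

theorem tendsto_cpow_mul_corr_atTop {τ : ℝ} (hτ : |τ| = 1) (f : Sec₂ (-1) 1) {u : Plane}
    (hu : u ∈ punctured) {z : ℂ} (hz : -1 < z.re) :
    Tendsto (fun s : ℝ => (s : ℂ) ^ (-z) * corr τ f u s) atTop (𝓝 0) := by
  obtain ⟨ε, hε, hε1, hε2⟩ := exists_pos_exponent hz
  obtain ⟨C, hC⟩ := norm_corr_le hτ f hu hε hε1
  have h1 : Tendsto (fun s : ℝ => C * s ^ (-(1 + z.re - ε))) atTop (𝓝 0) := by
    simpa using (tendsto_rpow_neg_atTop (y := 1 + z.re - ε) (by linarith)).const_mul C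
  refine squeeze_zero_norm' ?_ h1
  filter_upwards [eventually_gt_atTop 0] with s hs
  have h2 := hC s hs
  rw [norm_mul, Complex.norm_cpow_eq_rpow_re_of_pos hs, Complex.neg_re]
  calc s ^ (-z.re) * ‖corr τ f u s‖ ≤ s ^ (-z.re) * (C * s ^ (ε - 1)) := by gcongr
    _ = C * (s ^ (-z.re) * s ^ (ε - 1)) := by ring
    _ = _ := by rw [← Real.rpow_add hs]; congr 2; ring

theorem hasDerivAt_cpow_mul_corr {τ : ℝ} (hτ : |τ| = 1) (f : Sec₂ (-1) 1) {u : Plane}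
    (hu : u ∈ punctured) (z : ℂ) {s : ℝ} (hs : 0 < s) :
    HasDerivAt (fun s : ℝ => (s : ℂ) ^ (-z) * corr τ f u s)
      (-z * ((s : ℂ) ^ (-z - 1) * corr τ f u s) + (s : ℂ) ^ (-z) * deriv (corr τ f u) s) s := by
  have h1 : HasDerivAt (fun s : ℝ => (s : ℂ) ^ (-z)) (-z * (s : ℂ) ^ (-z - 1)) s := by
    have h2 : HasDerivAt (fun w : ℂ => w ^ (-z)) (-z * (s : ℂ) ^ (-z - 1)) (s : ℂ) := by
      have := (hasDerivAt_id (s : ℂ)).cpow_const (c := -z) (Or.inl (by simpa using hs))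
      simpa using this
    exact h2.comp_ofReal
  have h3 := (hasDerivAt_corr hτ f hu s)
  rw [h3.deriv]
  refine (h1.mul h3).congr_deriv ?_
  ring

/-- `∫_I s^(-z-1) (⋯) ds`. -/
def powInt (τ : ℝ) (I : Set ℝ) (z : ℂ) (f : Sec₂ (-1) 1) (u : Plane) : ℂ :=
  ∫ s in I, (s : ℂ) ^ (-z - 1) * corr τ f u s

/-- Integration by parts for s^(-z) c(s). The boundary term at 0 vanishes because c is bounded and
Re z < 0, and s^(-z) is the weight belonging to z - 1. -/
theorem mul_powInt_Ioc {τ : ℝ} (hτ : |τ| = 1) (f : Sec₂ (-1) 1) {u : Plane}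
    (hu : u ∈ punctured) {z : ℂ} (hz : z.re < 0) :
    z * powInt τ (Ioc 0 1) z f u =
      -corr τ f u 1 + τ * powInt τ (Ioc 0 1) (z - 1) (opDq.at u f) u := by
  have hz1 : (z - 1).re < 0 := by simp; linarith
  have i1 := integrableOn_Ioc_corr hτ f hu hz
  have i2 := integrableOn_Ioc_corr hτ (opDq.at u f) hu hz1
  have e : -(z - 1) - 1 = -z := by ring
  rw [e] at i2
  obtain ⟨C, hC⟩ := norm_corr_le hτ f hu one_pos le_rfl
  have h := intervalIntegral.integral_eq_sub_of_hasDerivAt_of_tendsto (a := 0) (b := 1) one_pos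
    (f := fun s : ℝ => (s : ℂ) ^ (-z) * corr τ f u s)
    (f' := fun s : ℝ => -z * ((s : ℂ) ^ (-z - 1) * corr τ f u s) +
      τ * ((s : ℂ) ^ (-z) * corr τ (opDq.at u f) u s)) (fa := 0) (fb := corr τ f u 1)
    (fun s hs => (hasDerivAt_cpow_mul_corr hτ f hu z hs.1).congr_deriv (by
      rw [(hasDerivAt_corr hτ f hu s).deriv]; ring))
    ((intervalIntegrable_iff_integrableOn_Ioc_of_le zero_le_one).2
      ((i1.const_mul _).add (i2.const_mul _))) ?_ ?_
  · rw [intervalIntegral.integral_of_le zero_le_one,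
      integral_add (i1.const_mul _) (i2.const_mul _), integral_const_mul, integral_const_mul] at h
    unfold powInt
    rw [e]
    linear_combination -h
  · have h1 : Tendsto (fun s : ℝ => C * s ^ (-z.re)) (𝓝[>] 0) (𝓝 0) := by
      have h2 := (Real.continuousAt_rpow_const 0 (-z.re) (Or.inr (by linarith))).tendsto
      rw [Real.zero_rpow (by linarith)] at h2
      simpa using (h2.mono_left nhdsWithin_le_nhds).const_mul C
    refine squeeze_zero_norm' ?_ h1
    filter_upwards [self_mem_nhdsWithin] with s hs
    have h2 := hC s hs
    rw [sub_self, Real.rpow_zero, mul_one] at h2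
    rw [norm_mul, Complex.norm_cpow_eq_rpow_re_of_pos hs, Complex.neg_re, mul_comm C]
    have : (0 : ℝ) < s := hs
    gcongr
  · have h1 := (hasDerivAt_cpow_mul_corr hτ f hu z one_pos).continuousAt.tendsto
    simp only [Complex.ofReal_one, Complex.one_cpow, one_mul] at h1
    exact h1.mono_left nhdsWithin_le_nhds

/-- The derivative of s^(-z) c is s^(-z-1) (s c' - z c), and s c' + c is the `corr` of the Euler
operator applied to f. The boundary term at infinity vanishes since Re z > -1. -/
theorem mul_powInt_Ioi {τ : ℝ} (hτ : |τ| = 1) (f : Sec₂ (-1) 1) {u : Plane}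
    (hu : u ∈ punctured) {z : ℂ} (hz : -1 < z.re) :
    (z + 1) * powInt τ (Ioi 1) z f u = corr τ f u 1 + powInt τ (Ioi 1) z (opE.at u f) u := by
  have i1 := integrableOn_Ioi_corr hτ f hu hz
  have i2 := integrableOn_Ioi_corr hτ (opE.at u f) hu hz
  have h := integral_Ioi_of_hasDerivAt_of_tendsto' (a := 1)
    (f := fun s : ℝ => (s : ℂ) ^ (-z) * corr τ f u s)
    (f' := fun s : ℝ => (s : ℂ) ^ (-z - 1) * corr τ (opE.at u f) u s -
      (z + 1) * ((s : ℂ) ^ (-z - 1) * corr τ f u s))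
    (fun s hs => (hasDerivAt_cpow_mul_corr hτ f hu z (one_pos.trans_le hs)).congr_deriv ?_)
    (i2.sub (i1.const_mul _)) (tendsto_cpow_mul_corr_atTop hτ f hu hz)
  · rw [integral_sub i2 (i1.const_mul _), integral_const_mul] at h
    simp only [Complex.ofReal_one, Complex.one_cpow, one_mul] at h
    unfold powInt
    linear_combination -h
  · have hs0 : (s : ℂ) ≠ 0 := by exact_mod_cast (one_pos.trans_le (mem_Ici.1 hs)).ne'
    have e : (s : ℂ) ^ (-z) = (s : ℂ) ^ (-z - 1) * s := by
      rw [Complex.cpow_sub _ _ hs0, Complex.cpow_one, div_mul_cancel₀ _ hs0]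
    rw [← mul_deriv_corr hτ f hu s, e]
    ring

/-- Moving the derivative onto the power gains a factor s⁻¹, which is the passage from z to z + 1.
-/
theorem powInt_Ioi_deriv {τ : ℝ} (hτ : |τ| = 1) (f : Sec₂ (-1) 1) {u : Plane}
    (hu : u ∈ punctured) {z : ℂ} (hz : -1 < z.re) :
    IntegrableOn (fun s : ℝ => (s : ℂ) ^ (-z - 1) * deriv (corr τ f u) s) (Ioi 1) ∧
    ∫ s in Ioi (1 : ℝ), (s : ℂ) ^ (-z - 1) * deriv (corr τ f u) s =
      -corr τ f u 1 + (z + 1) * powInt τ (Ioi 1) (z + 1) f u := by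
  have hz1 : -1 < (z + 1).re := by simp; linarith
  have i1 := integrableOn_Ioi_corr hτ f hu hz1
  have i2 := (integrableOn_Ioi_corr hτ (opDq.at u f) hu hz).const_mul (τ : ℂ)
  have i3 : IntegrableOn (fun s : ℝ => (s : ℂ) ^ (-z - 1) * deriv (corr τ f u) s) (Ioi 1) :=
    i2.congr (Eventually.of_forall fun s => by
      simp only [(hasDerivAt_corr hτ f hu s).deriv]; ring)
  have e : -(z + 1) = -z - 1 := by ring
  refine ⟨i3, ?_⟩
  have h := integral_Ioi_of_hasDerivAt_of_tendsto' (a := 1)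
    (f := fun s : ℝ => (s : ℂ) ^ (-(z + 1)) * corr τ f u s)
    (f' := fun s : ℝ => -(z + 1) * ((s : ℂ) ^ (-(z + 1) - 1) * corr τ f u s) +
      (s : ℂ) ^ (-z - 1) * deriv (corr τ f u) s)
    (fun s hs => (hasDerivAt_cpow_mul_corr hτ f hu (z + 1) (one_pos.trans_le hs)).congr_deriv
      (by rw [e]))
    ((i1.const_mul _).add i3) (tendsto_cpow_mul_corr_atTop hτ f hu hz1)
  rw [integral_add (i1.const_mul _) i3, integral_const_mul] at h
  simp only [Complex.ofReal_one, Complex.one_cpow, one_mul] at h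
  unfold powInt
  linear_combination h

theorem powInt_Ioi_opE_opE {τ : ℝ} (hτ : |τ| = 1) (f : Sec₂ (-1) 1) {u : Plane}
    (hu : u ∈ punctured) {z : ℂ} (hz : -1 < z.re) :
    powInt τ (Ioi 1) z (opE.at u (opE.at u f)) u =
      τ * (-corr τ (opF.at u f) u 1 + (z + 1) * powInt τ (Ioi 1) (z + 1) (opF.at u f) u) +
        τ * powInt τ (Ioi 1) (z + 1) (secondAt u f) u := by
  have hz1 : -1 < (z + 1).re := by simp; linarith
  obtain ⟨i1, h1⟩ := powInt_Ioi_deriv hτ (opF.at u f) hu hz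
  have i2 := integrableOn_Ioi_corr hτ (secondAt u f) hu hz1
  rw [← h1]
  unfold powInt
  rw [← integral_const_mul, ← integral_const_mul, ← integral_add (i1.const_mul _) (i2.const_mul _)]
  refine setIntegral_congr_fun measurableSet_Ioi fun s hs => ?_
  have hs0 : s ≠ 0 := (one_pos.trans (mem_Ioi.1 hs)).ne'
  have hs1 : (s : ℂ) ≠ 0 := by exact_mod_cast hs0
  have e : (s : ℂ) ^ (-(z + 1) - 1) = (s : ℂ) ^ (-z - 1) * (s : ℂ)⁻¹ := by
    rw [show -(z + 1) - 1 = -z - 1 - 1 by ring, Complex.cpow_sub _ 1 hs1, Complex.cpow_one,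
      div_eq_mul_inv]
  simp only [corr_opE_opE hτ f hu hs0, e]
  ring

/-! ### The continued family of operators -/

theorem powOp_apply {τ : ℝ} {I : Set ℝ} {z : ℂ}
    (hW : Integrable (pairWeight τ fun s => (s : ℂ) ^ (-z - 1)) ((volume.restrict I).prod volume))
    (f : Sec₂ (-1) 1) {u : Plane} (hu : u ∈ punctured) :
    (powOp τ I z f).1 u = powInt τ I z f u := by
  have e : ∀ x : ℝ × ℝ, pairWeight τ (fun s => (s : ℂ) ^ (-z - 1)) x *
      f.1 (unitPair x.2 (x.2 + τ * x.1) u) =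
      (x.1 : ℂ) ^ (-z - 1) * pencil f u x.2 (x.2 + τ * x.1) := fun x => by
    rw [pencil_eq, pairWeight]
    push_cast
    ring
  have hi := integrable_avg measurable_snd (measurable_second τ) hW f.1 hu
  unfold powOp
  rw [avgOp_apply measurable_snd (measurable_second τ) hW f hu, integral_prod _ hi]
  simp only [e, integral_const_mul]
  rfl

theorem powOp_Ioc_apply {τ : ℝ} (hτ : |τ| = 1) {z : ℂ} (hz : z.re < 0) (f : Sec₂ (-1) 1) {u : Plane}
    (hu : u ∈ punctured) : (powOp τ (Ioc 0 1) z f).1 u = powInt τ (Ioc 0 1) z f u :=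
  powOp_apply (integrable_powWeight_Ioc hτ hz) f hu

theorem powOp_Ioi_apply {τ : ℝ} (hτ : |τ| = 1) {z : ℂ} (hz : -1 < z.re) (f : Sec₂ (-1) 1) {u : Plane}
    (hu : u ∈ punctured) : (powOp τ (Ioi 1) z f).1 u = powInt τ (Ioi 1) z f u :=
  powOp_apply (integrable_powWeight_Ioi hτ hz) f hu

/-- The integral over pairs of points at distance one. -/
def endOp (τ : ℝ) : Sec₂ (-1) 1 →L[ℂ] Sec 1 2 :=
  avgOp volume id (fun p => p + τ) fun p => ((decay p * decay (p + τ) : ℝ) : ℂ)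

theorem endOp_apply (τ : ℝ) (f : Sec₂ (-1) 1) {u : Plane} (hu : u ∈ punctured) :
    (endOp τ f).1 u = corr τ f u 1 := by
  have hi : Integrable fun p => decay p * decay (p + τ) := by
    refine (integrable_inv_one_add_sq.add (integrable_inv_one_add_sq_shift τ)).mono'
      (continuous_decay.mul (continuous_decay.comp (continuous_add_const τ))).aestronglyMeasurable
      (Eventually.of_forall fun p => ?_)
    have hp := decay_pos p
    have hq := decay_pos (p + τ)
    rw [Real.norm_of_nonneg (by positivity)]
    exact decay_mul_decay_le_add p (p + τ)
  have hi' : Integrable fun p => ((decay p * decay (p + τ) : ℝ) : ℂ) := hi.ofReal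
  rw [endOp, avgOp_apply measurable_id (measurable_add_const τ) hi' f hu]
  simp only [corr, mul_one, pencil_eq, id]

/-- The continuation of `∫_0^1 s^(-z-1) (⋯) ds` to `Re z < k`. -/
def nearOp (τ : ℝ) : ℕ → ℂ → Sec₂ (-1) 1 →L[ℂ] Sec 1 2
  | 0, z => powOp τ (Ioc 0 1) z
  | k + 1, z => z⁻¹ • ((τ : ℂ) • opDq.lift (nearOp τ k (z - 1)) - endOp τ)

/-- Composition with the second operator that lowers the exponent. -/
def secondLift (B : Sec₂ (-1) 1 →L[ℂ] Sec 1 2) : Sec₂ (-1) 1 →L[ℂ] Sec 1 2 :=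
  opQQ.lift (opP.lift B) + opP.lift (opQQ.lift B) - (opQ.lift (opPP.lift B) + opPP.lift (opQ.lift B))

/-- A lifted operator acts before B, so nested lifts compose in reverse order; the factors in
`secondLift` are arranged accordingly. -/
theorem secondLift_apply (B : Sec₂ (-1) 1 →L[ℂ] Sec 1 2) (f : Sec₂ (-1) 1) {u : Plane}
    (hu : u ∈ punctured) : (secondLift B f).1 u = (B (secondAt u f)).1 u := by
  have h : (secondLift B f).1 u = (opQQ.lift (opP.lift B) f).1 u + (opP.lift (opQQ.lift B) f).1 u -
      ((opQ.lift (opPP.lift B) f).1 u + (opPP.lift (opQ.lift B) f).1 u) := rfl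
  simp only [h, OpFamily.lift_apply _ _ _ hu, secondAt, map_add, map_sub]
  rfl

/-- The continuation of `∫_1^∞ s^(-z-1) (⋯) ds` to `Re z > -1 - k`. -/
def farOp (τ : ℝ) : ℕ → ℂ → Sec₂ (-1) 1 →L[ℂ] Sec 1 2
  | 0, z => powOp τ (Ioi 1) z
  | k + 1, z => (z + 1)⁻¹ • (endOp τ + (τ : ℂ) • opF.lift (farOp τ k (z + 1))) +
      (z + 1)⁻¹ • (z + 1)⁻¹ • (opE.lift (endOp τ) - (τ : ℂ) • opF.lift (endOp τ) +
        (τ : ℂ) • secondLift (farOp τ k (z + 1)))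

/-! ### Consistency of the continuation steps -/

theorem nearOp_succ_eq {τ : ℝ} (hτ : |τ| = 1) (k : ℕ) {z : ℂ} (hz : z.re < k) :
    nearOp τ (k + 1) z = nearOp τ k z := by
  induction k generalizing z with
  | zero =>
    have hz' : z.re < 0 := by simpa using hz
    have hz0 : z ≠ 0 := by rintro rfl; simp at hz'
    refine ContinuousLinearMap.ext fun f => Sec.ext_on fun u hu => ?_
    have h1 : (nearOp τ 1 z f).1 u = z⁻¹ * ((τ : ℂ) * (opDq.lift (powOp τ (Ioc 0 1) (z - 1)) f).1 u -
      (endOp τ f).1 u) := rfl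
    have h2 : (nearOp τ 0 z f).1 u = (powOp τ (Ioc 0 1) z f).1 u := rfl
    have h3 := mul_powInt_Ioc hτ f hu hz'
    rw [zero_add, h1, h2, OpFamily.lift_apply _ _ _ hu, endOp_apply _ _ hu, powOp_Ioc_apply hτ hz' _ hu,
      powOp_Ioc_apply hτ (by simp; linarith) _ hu, inv_mul_eq_iff_eq_mul₀ hz0, h3]
    ring
  | succ k ih =>
    have h1 : nearOp τ (k + 1) (z - 1) = nearOp τ k (z - 1) := ih (by
      push_cast at hz; simp; linarith)
    rw [nearOp, h1, nearOp]

theorem farOp_succ_eq {τ : ℝ} (hτ : |τ| = 1) (k : ℕ) {z : ℂ} (hz : -1 - k < z.re) :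
    farOp τ (k + 1) z = farOp τ k z := by
  induction k generalizing z with
  | zero =>
    have hz' : -1 < z.re := by simpa using hz
    have hz0 : z + 1 ≠ 0 := fun h => by
      have := congrArg Complex.re h
      simp at this
      linarith
    have hz1 : -1 < (z + 1).re := by simp; linarith
    refine ContinuousLinearMap.ext fun f => Sec.ext_on fun u hu => ?_
    have h1 : (farOp τ 1 z f).1 u =
      (z + 1)⁻¹ * ((endOp τ f).1 u + (τ : ℂ) * (opF.lift (powOp τ (Ioi 1) (z + 1)) f).1 u) +
      (z + 1)⁻¹ * ((z + 1)⁻¹ * ((opE.lift (endOp τ) f).1 u - (τ : ℂ) * (opF.lift (endOp τ) f).1 u +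
        (τ : ℂ) * (secondLift (powOp τ (Ioi 1) (z + 1)) f).1 u)) := rfl
    have h2 : (farOp τ 0 z f).1 u = (powOp τ (Ioi 1) z f).1 u := rfl
    -- `h3` reduces f to E f, `h4` reduces E f to E² f, and `h5` expresses E² f at z + 1.
    -- Eliminating the two intermediate integrals gives the recursion, with one factor (z+1)⁻¹ from
    -- each of `h3` and `h4`; the factor z + 1 in `h5` cancels one of them in the term with `opF`.
    have h3 := mul_powInt_Ioi hτ f hu hz'
    have h4 := mul_powInt_Ioi hτ (opE.at u f) hu hz'
    have h5 := powInt_Ioi_opE_opE hτ f hu hz'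
    rw [zero_add, h1, h2, secondLift_apply _ _ hu, OpFamily.lift_apply _ _ _ hu,
      OpFamily.lift_apply _ _ _ hu, OpFamily.lift_apply _ _ _ hu, endOp_apply _ _ hu,
      endOp_apply _ _ hu, endOp_apply _ _ hu, powOp_Ioi_apply hτ hz' _ hu, powOp_Ioi_apply hτ hz1 _ hu,
      powOp_Ioi_apply hτ hz1 _ hu]
    rw [h5] at h4
    field_simp
    linear_combination -(z + 1) * h3 - h4
  | succ k ih =>
    have h1 : farOp τ (k + 1) (z + 1) = farOp τ k (z + 1) := ih (by
      push_cast at hz; simp; linarith)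
    rw [farOp, h1, farOp]

theorem nearOp_eq {τ : ℝ} (hτ : |τ| = 1) {k j : ℕ} (hkj : k ≤ j) {z : ℂ} (hz : z.re < k) :
    nearOp τ j z = nearOp τ k z := by
  induction j, hkj using Nat.le_induction with
  | base => rfl
  | succ j hj ih =>
    rw [nearOp_succ_eq hτ j (hz.trans_le (by exact_mod_cast hj)), ih]

theorem farOp_eq {τ : ℝ} (hτ : |τ| = 1) {k j : ℕ} (hkj : k ≤ j) {z : ℂ} (hz : -1 - k < z.re) :
    farOp τ j z = farOp τ k z := by
  induction j, hkj using Nat.le_induction with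
  | base => rfl
  | succ j hj ih =>
    have : (k : ℝ) ≤ j := by exact_mod_cast hj
    rw [farOp_succ_eq hτ j (by linarith), ih]

/-! ### Meromorphy of the continued operators -/

theorem IsMeroOn.lift {D : Set ℂ} {B : ℂ → Sec₂ (-1) 1 →L[ℂ] Sec 1 2} (h : IsMeroOn D B)
    (A : OpFamily) : IsMeroOn D fun z => A.lift (B z) :=
  IsMeroOn.sum _ fun i _ => IsMeroOn.sum _ fun j _ => (h.comp_right (A i j)).comp_left (mulCoef i j)

theorem IsMeroOn.const_smul {D : Set ℂ} {B : ℂ → Sec₂ (-1) 1 →L[ℂ] Sec 1 2} (h : IsMeroOn D B)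
    (c : ℂ) : IsMeroOn D fun z => c • B z :=
  h.smul fun _ => ⟨0, fun _ => rfl, by simpa using analyticAt_const⟩

theorem IsMeroOn.sub {D : Set ℂ} {B B' : ℂ → Sec₂ (-1) 1 →L[ℂ] Sec 1 2} (h : IsMeroOn D B)
    (h' : IsMeroOn D B') : IsMeroOn D fun z => B z - B' z := by
  have h1 := h.add (h'.const_smul (-1))
  have e : ∀ z, B z + (-1 : ℂ) • B' z = B z - B' z := fun z => ContinuousLinearMap.ext fun f => by
    change B z f + (-1 : ℂ) • B' z f = B z f - B' z f
    rw [neg_one_smul, sub_eq_add_neg]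
  simpa only [e] using h1

theorem IsMeroOn.secondLift {D : Set ℂ} {B : ℂ → Sec₂ (-1) 1 →L[ℂ] Sec 1 2} (h : IsMeroOn D B) :
    IsMeroOn D fun z => secondLift (B z) :=
  (((h.lift _).lift _).add ((h.lift _).lift _)).sub (((h.lift _).lift _).add ((h.lift _).lift _))

theorem isMeroOn_nearOp {τ : ℝ} (hτ : |τ| = 1) (k : ℕ) : IsMeroOn {z | z.re < k} (nearOp τ k) := by
  induction k with
  | zero =>
    refine IsMeroOn.of_differentiableOn (isOpen_lt Complex.continuous_re continuous_const)
      fun h f z hz => differentiableAt_powOp_Ioc hτ (by simpa using hz) h f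
  | succ k ih =>
    have h1 := (ih.shift (-1)).mono (D' := {z | z.re < ((k + 1 : ℕ) : ℝ)}) fun z hz => by
      simp at hz ⊢; linarith
    have h2 := ((h1.lift opDq).const_smul (τ : ℂ)).sub (IsMeroOn.const (endOp τ))
    have h3 := h2.smul (exists_order_inv_add 0)
    simpa [nearOp, sub_eq_add_neg] using h3

theorem isMeroOn_farOp {τ : ℝ} (hτ : |τ| = 1) (k : ℕ) : IsMeroOn {z | -1 - k < z.re} (farOp τ k) := by
  induction k with
  | zero =>
    refine IsMeroOn.of_differentiableOn (isOpen_lt continuous_const Complex.continuous_re)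
      fun h f z hz => differentiableAt_powOp_Ioi hτ (by simpa using hz) h f
  | succ k ih =>
    have h1 := (ih.shift 1).mono (D' := {z | -1 - ((k + 1 : ℕ) : ℝ) < z.re}) fun z hz => by
      simp at hz ⊢; linarith
    have h2 := ((IsMeroOn.const (endOp τ)).add ((h1.lift opF).const_smul (τ : ℂ))).smul
      (exists_order_inv_add 1)
    have h3 := ((IsMeroOn.const (D := {z | -1 - ((k + 1 : ℕ) : ℝ) < z.re})
      (opE.lift (endOp τ) - (τ : ℂ) • opF.lift (endOp τ))).add (h1.secondLift.const_smul (τ : ℂ)))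
    have h4 := h2.add ((h3.smul (exists_order_inv_add 1)).smul (exists_order_inv_add 1))
    simpa [farOp] using h4

/-- The number of continuation steps that suffices at `z`. -/
def stepCount (z : ℂ) : ℕ := ⌈|z.re|⌉₊ + 1

theorem abs_re_lt_stepCount (z : ℂ) : |z.re| < stepCount z := by
  have := Nat.le_ceil |z.re|
  unfold stepCount
  push_cast
  linarith

/-- The meromorphic continuation of `∫_0^∞ s^(-z-1) (⋯) ds`. -/
def mellinOp (τ : ℝ) (z : ℂ) : Sec₂ (-1) 1 →L[ℂ] Sec 1 2 :=
  nearOp τ (stepCount z) z + farOp τ (stepCount z) z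

/-- The number of steps in `mellinOp` jumps with z. As extra steps change nothing, one fixed k
represents the operator on a whole open strip, which is what analyticity at a point requires. -/
theorem mellinOp_eq {τ : ℝ} (hτ : |τ| = 1) {k : ℕ} {z : ℂ} (h1 : z.re < k) (h2 : -1 - k < z.re) :
    mellinOp τ z = nearOp τ k z + farOp τ k z := by
  have h := abs_lt.1 (abs_re_lt_stepCount z)
  have e1 : nearOp τ (stepCount z) z = nearOp τ k z := by
    rcases le_total k (stepCount z) with hk | hk
    · exact nearOp_eq hτ hk h1
    · exact (nearOp_eq hτ hk h.2).symm
  have e2 : farOp τ (stepCount z) z = farOp τ k z := by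
    rcases le_total k (stepCount z) with hk | hk
    · exact farOp_eq hτ hk h2
    · exact (farOp_eq hτ hk (by linarith)).symm
  rw [mellinOp, e1, e2]

theorem isMeroOn_mellinOp {τ : ℝ} (hτ : |τ| = 1) : IsMeroOn univ (mellinOp τ) := fun s _ => by
  set k := stepCount s with hk
  set D : Set ℂ := {z | z.re < k} ∩ {z | -1 - k < z.re} with hD
  have hDo : IsOpen D := (isOpen_lt Complex.continuous_re continuous_const).inter
    (isOpen_lt continuous_const Complex.continuous_re)
  have h := abs_lt.1 (abs_re_lt_stepCount s)
  have hs : s ∈ D := ⟨h.2, by change -1 - (k : ℝ) < s.re; rw [hk]; linarith⟩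
  exact ((((isMeroOn_nearOp hτ k).mono inter_subset_left).add
    ((isMeroOn_farOp hτ k).mono inter_subset_right)).congr_of_eventuallyEq fun t ht =>
      (hDo.mem_nhds ht |> eventually_of_mem) fun z hz => (mellinOp_eq hτ hz.1 hz.2).symm) s hs

theorem mellinOp_apply {τ : ℝ} (hτ : |τ| = 1) {z : ℂ} (hz : z ∈ strip) (f : Sec₂ (-1) 1) {u : Plane}
    (hu : u ∈ punctured) : (mellinOp τ z f).1 u = ∫ s in Ioi (0 : ℝ), (s : ℂ) ^ (-z - 1) * corr τ f u s := by
  have h1 : (mellinOp τ z f).1 u = (powOp τ (Ioc 0 1) z f).1 u + (powOp τ (Ioi 1) z f).1 u := by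
    rw [mellinOp_eq hτ (k := 0) (by simpa using hz.2) (by simpa using hz.1)]
    rfl
  rw [h1, powOp_Ioc_apply hτ hz.2 f hu, powOp_Ioi_apply hτ hz.1 f hu, powInt, powInt,
    ← setIntegral_union (Ioc_disjoint_Ioi le_rfl) measurableSet_Ioi (integrableOn_Ioc_corr hτ f hu hz.2)
      (integrableOn_Ioi_corr hτ f hu hz.1), Ioc_union_Ioi_eq_Ioi zero_le_one]

/-! ### Changes of variables -/

/-- The involution `p ↦ z + n/(p - z)` of the line, fixing `z`. -/
def inversion (z n : ℝ) (p : ℝ) : ℝ := z + n / (p - z)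

/-- Division by 0 gives 0, so z is sent to itself and the map is a bijection of the whole line, with
no point to be removed. -/
theorem inversion_inversion (z : ℝ) {n : ℝ} (hn : n ≠ 0) (p : ℝ) :
    inversion z n (inversion z n p) = p := by
  unfold inversion
  rw [add_sub_cancel_left]
  rcases eq_or_ne p z with rfl | h
  · simp
  · have := sub_ne_zero.2 h
    field_simp
    ring

theorem measurable_inversion (z n : ℝ) : Measurable (inversion z n) := by unfold inversion; fun_prop

/-- The inversion, as an equivalence. -/
def inversionEquiv (z : ℝ) {n : ℝ} (hn : n ≠ 0) : ℝ ≃ᵐ ℝ where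
  toFun := inversion z n
  invFun := inversion z n
  left_inv := inversion_inversion z hn
  right_inv := inversion_inversion z hn
  measurable_toFun := measurable_inversion z n
  measurable_invFun := measurable_inversion z n

/-- The density of the inversion. -/
def inversionDensity (z n : ℝ) (p : ℝ) : NNReal := Real.toNNReal (n / (p - z) ^ 2)

theorem measurable_inversionDensity (z n : ℝ) : Measurable (inversionDensity z n) := by
  unfold inversionDensity; fun_prop

theorem measurePreserving_inversion (z : ℝ) {n : ℝ} (hn : 0 < n) :
    MeasurePreserving (inversionEquiv z hn.ne')
      (volume.withDensity fun p => (inversionDensity z n p : ENNReal)) volume := by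
  refine ⟨(inversionEquiv z hn.ne').measurable, Measure.ext fun A hA => ?_⟩
  have hφ : MeasurableSet (inversion z n ⁻¹' A) := measurable_inversion z n hA
  rw [Measure.map_apply (inversionEquiv z hn.ne').measurable hA]
  change (volume.withDensity fun p => (inversionDensity z n p : ENNReal)) (inversion z n ⁻¹' A) = _
  rw [withDensity_apply _ hφ]
  -- The point z, where the inversion is singular, is discarded for the change of variables; it is a
  -- null set on both sides.
  have hs : MeasurableSet (inversion z n ⁻¹' A \ {z}) := hφ.diff (measurableSet_singleton z)
  have hinj : InjOn (inversion z n) (inversion z n ⁻¹' A \ {z}) := fun a _ b _ h => by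
    rw [← inversion_inversion z hn.ne' a, h, inversion_inversion z hn.ne']
  have hz : inversion z n z = z := by simp [inversion]
  have himg : inversion z n '' (inversion z n ⁻¹' A \ {z}) = A \ {z} := by
    ext a
    constructor
    · rintro ⟨b, ⟨hb, hbz⟩, rfl⟩
      refine ⟨hb, fun h => hbz ?_⟩
      rw [mem_singleton_iff] at h ⊢
      rw [← inversion_inversion z hn.ne' b, h, hz]
    · rintro ⟨ha, haz⟩
      refine ⟨inversion z n a, ⟨?_, fun h => haz ?_⟩, inversion_inversion z hn.ne' a⟩
      · rwa [mem_preimage, inversion_inversion z hn.ne']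
      · rw [mem_singleton_iff] at h ⊢
        rw [← inversion_inversion z hn.ne' a, h, hz]
  have hd : ∀ p ∈ inversion z n ⁻¹' A \ {z},
      HasDerivWithinAt (inversion z n) (-(n / (p - z) ^ 2)) (inversion z n ⁻¹' A \ {z}) p := by
    rintro p ⟨-, hp⟩
    have hpz : p - z ≠ 0 := sub_ne_zero.2 hp
    have h1 := (((hasDerivAt_id p).sub_const z).inv hpz).const_mul n |>.const_add z
    refine (h1.congr_deriv ?_).hasDerivWithinAt
    simp only [id]
    ring
  have h := lintegral_image_eq_lintegral_abs_deriv_mul hs hd hinj (fun _ => 1)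
  rw [himg, setLIntegral_one, measure_sdiff_null (by simp)] at h
  rw [h, ← setLIntegral_congr (sdiff_null_ae_eq_self (s := inversion z n ⁻¹' A) (t := {z}) (by simp))]
  refine lintegral_congr fun p => ?_
  rw [mul_one, abs_neg, abs_of_nonneg (by positivity)]
  rfl

theorem measurePreserving_inversion_prod (z : ℝ) {n : ℝ} (hn : 0 < n) :
    MeasurePreserving ((inversionEquiv z hn.ne').prodCongr (inversionEquiv z hn.ne'))
      (volume.withDensity fun x : ℝ × ℝ =>
        ((inversionDensity z n x.1 * inversionDensity z n x.2 : NNReal) : ENNReal)) volume := by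
  have h := (measurePreserving_inversion z hn).prod (measurePreserving_inversion z hn)
  rw [prod_withDensity (measurable_inversionDensity z n).coe_nnreal_ennreal
    (measurable_inversionDensity z n).coe_nnreal_ennreal] at h
  simp only [ENNReal.coe_mul]
  exact h

theorem measurable_inversionDensity_prod (z n : ℝ) : Measurable fun x : ℝ × ℝ =>
    inversionDensity z n x.1 * inversionDensity z n x.2 :=
  ((measurable_inversionDensity z n).comp measurable_fst).mul
    ((measurable_inversionDensity z n).comp measurable_snd)

theorem integrable_inversion_iff {F : Type*} [NormedAddCommGroup F] [NormedSpace ℝ F] (z : ℝ) {n : ℝ}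
    (hn : 0 < n) (G : ℝ × ℝ → F) : Integrable G ↔ Integrable fun x : ℝ × ℝ =>
      (inversionDensity z n x.1 * inversionDensity z n x.2) •
        G (inversion z n x.1, inversion z n x.2) := by
  rw [← (measurePreserving_inversion_prod z hn).integrable_comp_emb
    (MeasurableEquiv.measurableEmbedding _),
    integrable_withDensity_iff_integrable_smul (measurable_inversionDensity_prod z n)]
  rfl

theorem integral_inversion {F : Type*} [NormedAddCommGroup F] [NormedSpace ℝ F] (z : ℝ) {n : ℝ}
    (hn : 0 < n) (G : ℝ × ℝ → F) : ∫ x, G x = ∫ x : ℝ × ℝ,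
      (inversionDensity z n x.1 * inversionDensity z n x.2) •
        G (inversion z n x.1, inversion z n x.2) := by
  rw [← (measurePreserving_inversion_prod z hn).integral_comp' G,
    integral_withDensity_eq_integral_smul (measurable_inversionDensity_prod z n)]
  rfl

theorem mul_self_of_abs_eq_one {τ : ℝ} (hτ : |τ| = 1) : τ * τ = 1 := by
  rw [← abs_mul_abs_self, hτ, one_mul]

/-- The map `(s, p) ↦ (p, p + τ s)`. -/
def pairEquiv {τ : ℝ} (hτ : |τ| = 1) : ℝ × ℝ ≃ᵐ ℝ × ℝ where
  toFun x := (x.2, x.2 + τ * x.1)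
  invFun y := (τ * (y.2 - y.1), y.1)
  left_inv x := by
    ext
    · change τ * (x.2 + τ * x.1 - x.2) = x.1
      linear_combination x.1 * mul_self_of_abs_eq_one hτ
    · rfl
  right_inv y := by
    ext
    · rfl
    · change y.1 + τ * (τ * (y.2 - y.1)) = y.2
      linear_combination (y.2 - y.1) * mul_self_of_abs_eq_one hτ
  measurable_toFun := by simp only [Equiv.coe_fn_mk]; fun_prop
  measurable_invFun := by simp only [Equiv.coe_fn_symm_mk]; fun_prop

theorem measurePreserving_pairEquiv {τ : ℝ} (hτ : |τ| = 1) :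
    MeasurePreserving (pairEquiv hτ) volume volume := by
  have h1 : MeasurePreserving (fun s : ℝ => τ * s) := by
    rcases eq_or_eq_neg_of_abs_eq hτ with rfl | rfl
    · simp only [one_mul]
      exact MeasurePreserving.id volume
    · simpa only [neg_mul, one_mul] using Measure.measurePreserving_neg (volume : Measure ℝ)
  have h2 : MeasurePreserving (fun x : ℝ × ℝ => (x.1, x.1 + τ * x.2)) volume volume :=
    (MeasurePreserving.id volume).skew_product (g := fun p s => p + τ * s) (by fun_prop)
      (Eventually.of_forall fun p => ((measurePreserving_add_left volume p).comp h1).map_eq)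
  exact h2.comp Measure.measurePreserving_swap

/-! ### The integral formula -/

/-- Homogeneity reduces to |u| = 1, where compactness gives a constant independent of u. The
explicit |u|⁻² is needed later for the growth in z of the absolute integrals, where |u|² = 1 + z².
-/
theorem exists_norm_apply_le (f : Sec₂ (-1) 1) : ∃ C : ℝ, 0 ≤ C ∧ ∀ u ∈ punctured, ∀ p q,
    ‖pencil f u p q‖ ≤ C * ((normSq u)⁻¹ * (decay p * decay q)) := by
  obtain ⟨C, hC⟩ := (isCompact_annulus_prod 1 1).exists_bound_of_continuousOn
    (f.1.contDiffOn.continuousOn.mono (annulus_prod_subset one_pos))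
  refine ⟨max C 0, le_max_right _ _, fun u hu p q => ?_⟩
  have hn := normSq_pos hu
  set r : ℝ := √(normSq u) with hr
  have hr0 : 0 < r := Real.sqrt_pos.2 hn
  have hr2 : r ^ 2 = normSq u := Real.sq_sqrt hn.le
  set w : Plane := r⁻¹ • u with hw
  have hwn : normSq w = 1 := by
    rw [hw, normSq_smul, ← hr2]
    field_simp
  have e : f.1 (unitPair p q u) = (r : ℂ)⁻¹ * (r : ℂ)⁻¹ * f.1 (unitPair p q w) := by
    have h1 : u = r • w := by rw [hw, smul_smul, mul_inv_cancel₀ hr0.ne', one_smul]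
    rw [h1, map_smul, unitPair_apply, Prod.smul_mk, smul_smul_apply f hr0.ne' hr0.ne']
  have h2 : ‖f.1 (unitPair p q w)‖ ≤ max C 0 :=
    (hC _ (unitPair_mem_annulus p q ⟨hwn.ge, hwn.le⟩)).trans (le_max_left _ _)
  have hp := decay_pos p
  have hq := decay_pos q
  rw [pencil_eq, e, norm_mul, norm_mul, norm_mul, norm_inv, Complex.norm_real, Complex.norm_real,
    Real.norm_of_nonneg (by positivity), Real.norm_of_nonneg hr0.le, ← hr2]
  calc decay p * decay q * (r⁻¹ * r⁻¹ * ‖f.1 (unitPair p q w)‖)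
      ≤ decay p * decay q * (r⁻¹ * r⁻¹ * max C 0) := by gcongr
    _ = _ := by field_simp

theorem integrable_powWeight {τ : ℝ} (hτ : |τ| = 1) {z : ℂ} (hz : z ∈ strip) :
    Integrable (pairWeight τ fun s => (s : ℂ) ^ (-z - 1)) ((volume.restrict (Ioi 0)).prod volume) := by
  rw [← Ioc_union_Ioi_eq_Ioi zero_le_one, Measure.restrict_union (Ioc_disjoint_Ioi le_rfl)
    measurableSet_Ioi, Measure.add_prod]
  exact (integrable_powWeight_Ioc hτ hz.2).add_measure (integrable_powWeight_Ioi hτ hz.1)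

/-- `s^(-mu-1)` times the values of a section on the pairs of points with coordinates `p`, `p + τ s`,
where `s > 0`. -/
def orientedPencil (τ : ℝ) (mu : ℂ) (f : Sec₂ (-1) 1) (u : Plane) (x : ℝ × ℝ) : ℂ :=
  if 0 < τ * (x.2 - x.1) then ((τ * (x.2 - x.1) : ℝ) : ℂ) ^ (-mu - 1) * pencil f u x.1 x.2 else 0

theorem orientedPencil_pairEquiv {τ : ℝ} (hτ : |τ| = 1) (mu : ℂ) (f : Sec₂ (-1) 1) (u : Plane) :
    orientedPencil τ mu f u ∘ pairEquiv hτ = (Ioi 0 ×ˢ univ).indicator fun x : ℝ × ℝ =>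
      (x.1 : ℂ) ^ (-mu - 1) * pencil f u x.2 (x.2 + τ * x.1) := by
  ext x
  have e : τ * (x.2 + τ * x.1 - x.2) = x.1 := by
    linear_combination x.1 * mul_self_of_abs_eq_one hτ
  change (if 0 < τ * (x.2 + τ * x.1 - x.2) then ((τ * (x.2 + τ * x.1 - x.2) : ℝ) : ℂ) ^ (-mu - 1) *
    pencil f u x.2 (x.2 + τ * x.1) else 0) = _
  rw [e]
  by_cases hx : 0 < x.1
  · rw [if_pos hx, indicator_of_mem (by simpa using hx)]
  · rw [if_neg hx, indicator_of_notMem (by simpa using hx)]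

theorem powWeight_mul_pencil_eq (τ : ℝ) (mu : ℂ) (f : Sec₂ (-1) 1) (u : Plane) (x : ℝ × ℝ) :
    (x.1 : ℂ) ^ (-mu - 1) * pencil f u x.2 (x.2 + τ * x.1) =
      pairWeight τ (fun s => (s : ℂ) ^ (-mu - 1)) x * f.1 (unitPair x.2 (x.2 + τ * x.1) u) := by
  rw [pencil_eq, pairWeight]
  push_cast
  ring

theorem restrict_prod_eq : ((volume : Measure ℝ).restrict (Ioi 0)).prod (volume : Measure ℝ) =
    (volume : Measure (ℝ × ℝ)).restrict (Ioi 0 ×ˢ univ) := by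
  rw [Measure.volume_eq_prod, ← Measure.prod_restrict, Measure.restrict_univ]

theorem measurableSet_half : MeasurableSet ((Ioi 0 : Set ℝ) ×ˢ (univ : Set ℝ)) :=
  measurableSet_Ioi.prod MeasurableSet.univ

theorem integrable_orientedPencil {τ : ℝ} (hτ : |τ| = 1) {mu : ℂ} (hmu : mu ∈ strip)
    (f : Sec₂ (-1) 1) {u : Plane} (hu : u ∈ punctured) : Integrable (orientedPencil τ mu f u) := by
  rw [← (measurePreserving_pairEquiv hτ).integrable_comp_emb (MeasurableEquiv.measurableEmbedding _),
    orientedPencil_pairEquiv, integrable_indicator_iff measurableSet_half, IntegrableOn,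
    ← restrict_prod_eq]
  simp only [powWeight_mul_pencil_eq]
  exact integrable_avg measurable_snd (measurable_second τ) (integrable_powWeight hτ hmu) f.1 hu

theorem integral_orientedPencil {τ : ℝ} (hτ : |τ| = 1) {mu : ℂ} (hmu : mu ∈ strip)
    (f : Sec₂ (-1) 1) {u : Plane} (hu : u ∈ punctured) :
    ∫ x, orientedPencil τ mu f u x = (mellinOp τ mu f).1 u := by
  have h1 : ∫ x, orientedPencil τ mu f u x = ∫ x, (orientedPencil τ mu f u ∘ pairEquiv hτ) x :=
    ((measurePreserving_pairEquiv hτ).integral_comp' _).symm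
  have hi := integrable_avg measurable_snd (measurable_second τ) (integrable_powWeight hτ hmu) f.1 hu
  simp only [← powWeight_mul_pencil_eq] at hi
  rw [h1, orientedPencil_pairEquiv, integral_indicator measurableSet_half, ← restrict_prod_eq,
    integral_prod _ hi, mellinOp_apply hτ hmu f hu]
  simp only [integral_const_mul]
  rfl

theorem exists_integral_norm_orientedPencil_le {τ : ℝ} (hτ : |τ| = 1) {mu : ℂ} (hmu : mu ∈ strip)
    (f : Sec₂ (-1) 1) : ∃ C : ℝ, 0 ≤ C ∧ ∀ u ∈ punctured,
      ∫ x, ‖orientedPencil τ mu f u x‖ ≤ C * (normSq u)⁻¹ := by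
  obtain ⟨C, hC0, hC⟩ := exists_norm_apply_le f
  have hW := (integrable_powWeight hτ hmu).norm
  refine ⟨C * ∫ x, ‖pairWeight τ (fun s => (s : ℂ) ^ (-mu - 1)) x‖
    ∂((volume.restrict (Ioi 0)).prod volume), mul_nonneg hC0 (integral_nonneg fun _ => norm_nonneg _),
    fun u hu => ?_⟩
  have h1 : ∫ x, ‖orientedPencil τ mu f u x‖ =
      ∫ x, ‖(orientedPencil τ mu f u ∘ pairEquiv hτ) x‖ :=
    ((measurePreserving_pairEquiv hτ).integral_comp' fun x => ‖orientedPencil τ mu f u x‖).symm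
  rw [h1, orientedPencil_pairEquiv]
  simp only [norm_indicator_eq_indicator_norm]
  rw [integral_indicator measurableSet_half, ← restrict_prod_eq, mul_right_comm, ← integral_const_mul]
  have hi := (integrable_avg measurable_snd (measurable_second τ) (integrable_powWeight hτ hmu) f.1 hu).norm
  simp only [← powWeight_mul_pencil_eq] at hi
  refine integral_mono hi (hW.const_mul _) fun x => ?_
  have hp := decay_pos x.2
  have hq := decay_pos (x.2 + τ * x.1)
  have h2 := hC u hu x.2 (x.2 + τ * x.1)
  simp only [pairWeight, norm_mul, Complex.norm_real]
  rw [Real.norm_of_nonneg (by positivity), Real.norm_of_nonneg (by positivity)]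
  calc _ ≤ ‖(x.1 : ℂ) ^ (-mu - 1)‖ * (C * ((normSq u)⁻¹ * (decay x.2 * decay (x.2 + τ * x.1)))) := by
        gcongr
    _ = _ := by ring

/-- The integrand of the symmetry breaking operators. -/
def breakingIntegrand (σ : ℤˣ) (mu : ℂ) (f : Sec₂ (-1) 1) (z : ℝ) (x : ℝ × ℝ) : ℂ :=
  coord₂ f x.1 x.2 * K σ mu x.1 x.2 z / ((x.1 - x.2 : ℝ) : ℂ)

theorem abs_unit (σ : ℤˣ) : |((σ : ℤ) : ℝ)| = 1 := by
  rcases Int.units_eq_one_or σ with rfl | rfl <;> simp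

theorem bruhat_mem (z : ℝ) : (![z, 1] : Plane) ∈ punctured := fun h => by
  have := congrFun h 1
  simp at this

theorem normSq_bruhat (z : ℝ) : normSq ![z, 1] = 1 + z ^ 2 := by simp [normSq]; ring

theorem one_add_sq_pos (z : ℝ) : 0 < 1 + z ^ 2 := by positivity

/-- `lineMap p ![z, 1]` is the vector (1 + p z, p - z); dividing by its second entry gives the
Bruhat coordinate z + (1 + z²)/(p - z). -/
theorem bruhat_inversion (z : ℝ) {p : ℝ} (hp : p ≠ z) :
    (![inversion z (1 + z ^ 2) p, 1] : Plane) = (p - z)⁻¹ • lineMap p ![z, 1] := by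
  have := sub_ne_zero.2 hp
  ext i
  fin_cases i
  · simp [inversion]
    field_simp
    ring
  · simp
    field_simp
    ring

theorem ae_ne_prod (z : ℝ) : ∀ᵐ x : ℝ × ℝ, x.1 ≠ z ∧ x.2 ≠ z := by
  have h : ∀ᵐ p : ℝ, p ≠ z := by simp [ae_iff]
  rw [Measure.volume_eq_prod]
  exact (Measure.quasiMeasurePreserving_fst.ae h).and (Measure.quasiMeasurePreserving_snd.ae h)

/-- With n = 1 + z², the Jacobian is n²/((p-z)²(q-z)²), homogeneity of f contributes (p-z)(q-z), and
1/(x-y) = (p-z)(q-z)/(n (q-p)). All factors p - z and q - z cancel, leaving n/(q-p) times the half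
power of n/(q-p). With q - p = τ s this is τ n^(1+mu) s^(-mu-1), as τ² = 1. -/
theorem breakingIntegrand_inversion (σ : ℤˣ) (mu : ℂ) (f : Sec₂ (-1) 1) (z : ℝ) {x : ℝ × ℝ}
    (hx : x.1 ≠ z ∧ x.2 ≠ z) :
    (inversionDensity z (1 + z ^ 2) x.1 * inversionDensity z (1 + z ^ 2) x.2) •
      breakingIntegrand σ mu f z (inversion z (1 + z ^ 2) x.1, inversion z (1 + z ^ 2) x.2) =
    (((σ : ℤ) : ℝ) : ℂ) * ((1 + z ^ 2 : ℝ) : ℂ) ^ (1 + mu) *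
      orientedPencil ((σ : ℤ) : ℝ) mu f ![z, 1] x := by
  obtain ⟨p, q⟩ := x
  obtain ⟨hp, hq⟩ := hx
  change p ≠ z at hp
  change q ≠ z at hq
  have hp' := sub_ne_zero.2 hp
  have hq' := sub_ne_zero.2 hq
  set τ : ℝ := ((σ : ℤ) : ℝ) with hτdef
  have hτ2 : τ * τ = 1 := mul_self_of_abs_eq_one (abs_unit σ)
  have hτ0 : τ ≠ 0 := fun h => by simp [h] at hτ2
  set n : ℝ := 1 + z ^ 2 with hn
  have hn0 : 0 < n := one_add_sq_pos z
  have hd : ∀ p, ((inversionDensity z n p : NNReal) : ℝ) = n / (p - z) ^ 2 := fun p =>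
    Real.coe_toNNReal _ (by positivity)
  have e1 : coord₂ f (inversion z n p) (inversion z n q) =
      ((p - z : ℝ) : ℂ) * ((q - z : ℝ) : ℂ) * pencil f ![z, 1] p q := by
    unfold coord₂
    rw [bruhat_inversion z hp, bruhat_inversion z hq,
      smul_smul_apply f (inv_ne_zero hp') (inv_ne_zero hq'), Complex.ofReal_inv, Complex.ofReal_inv,
      inv_inv, inv_inv, pencil]
  have e2 : inversion z n p - inversion z n q = n * (q - p) / ((p - z) * (q - z)) := by
    unfold inversion; field_simp; ring
  have e3 : (inversion z n p - z) * (inversion z n q - z) /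
      (inversion z n p - inversion z n q) = n / (q - p) := by
    rw [e2]
    unfold inversion
    rcases eq_or_ne q p with rfl | hqp
    · simp
    · have := sub_ne_zero.2 hqp
      field_simp
      ring
  have e4 : τ * (n / (q - p)) = n / (τ * (q - p)) := by
    rcases eq_or_ne (q - p) 0 with h0 | h0
    · simp [h0]
    · field_simp
      linear_combination hτ2
  rw [NNReal.smul_def, NNReal.coe_mul, hd, hd, Complex.real_smul]
  simp only [breakingIntegrand, orientedPencil, K, halfPow]
  rw [← hτdef, e3, e4, e1, e2]
  by_cases hs : 0 < τ * (q - p)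
  · have hs' : 0 < n / (τ * (q - p)) := by positivity
    rw [if_pos hs, if_pos hs']
    set s : ℝ := τ * (q - p) with hsdef
    have hqp : q - p = τ * s := by rw [hsdef]; linear_combination -(q - p) * hτ2
    have hs0 : (s : ℂ) ≠ 0 := by exact_mod_cast hs.ne'
    have hn1 : (n : ℂ) ≠ 0 := by exact_mod_cast hn0.ne'
    have hp1 : ((p - z : ℝ) : ℂ) ≠ 0 := by exact_mod_cast hp'
    have hq1 : ((q - z : ℝ) : ℂ) ≠ 0 := by exact_mod_cast hq'
    have hτ1 : (τ : ℂ) ≠ 0 := by exact_mod_cast hτ0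
    have hτ3 : (τ : ℂ) ^ 2 = 1 := by rw [pow_two]; exact_mod_cast hτ2
    have e5 : ((n / s : ℝ) : ℂ) ^ mu = (n : ℂ) ^ mu * (s : ℂ) ^ (-mu) := by
      rw [div_eq_mul_inv, Complex.ofReal_mul,
        Complex.mul_cpow_ofReal_nonneg hn0.le (inv_nonneg.2 hs.le), Complex.ofReal_inv,
        Complex.inv_cpow _ _ (by rw [Complex.arg_ofReal_of_nonneg hs.le]; exact Real.pi_ne_zero.symm),
        Complex.cpow_neg]
    rw [e5, hqp, Complex.cpow_sub _ _ hs0, Complex.cpow_add _ _ hn1, Complex.cpow_one, Complex.cpow_one]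
    simp only [Complex.ofReal_mul, Complex.ofReal_div, Complex.ofReal_pow]
    generalize ((p - z : ℝ) : ℂ) = a at *
    generalize ((q - z : ℝ) : ℂ) = b at *
    field_simp
    linear_combination -(pencil f ![z, 1] p q * (n : ℂ) ^ mu * (s : ℂ) ^ (-mu)) * hτ3
  · have hs' : ¬ 0 < n / (τ * (q - p)) := fun h => hs (by
      by_contra h1
      exact absurd h (not_lt.2 (div_nonpos_of_nonneg_of_nonpos hn0.le (not_lt.1 h1))))
    rw [if_neg hs, if_neg hs']
    simp

theorem breakingIntegrand_inversion_ae (σ : ℤˣ) (mu : ℂ) (f : Sec₂ (-1) 1) (z : ℝ) :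
    (fun x : ℝ × ℝ => (inversionDensity z (1 + z ^ 2) x.1 * inversionDensity z (1 + z ^ 2) x.2) •
      breakingIntegrand σ mu f z (inversion z (1 + z ^ 2) x.1, inversion z (1 + z ^ 2) x.2)) =ᵐ[volume]
    fun x => (((σ : ℤ) : ℝ) : ℂ) * ((1 + z ^ 2 : ℝ) : ℂ) ^ (1 + mu) *
      orientedPencil ((σ : ℤ) : ℝ) mu f ![z, 1] x :=
  (ae_ne_prod z).mono fun _ hx => breakingIntegrand_inversion σ mu f z hx

theorem integrable_breakingIntegrand (σ : ℤˣ) {mu : ℂ} (hmu : mu ∈ strip) (f : Sec₂ (-1) 1) (z : ℝ) :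
    Integrable (breakingIntegrand σ mu f z) := by
  rw [integrable_inversion_iff z (one_add_sq_pos z),
    integrable_congr (breakingIntegrand_inversion_ae σ mu f z)]
  exact (integrable_orientedPencil (abs_unit σ) hmu f (bruhat_mem z)).const_mul _

theorem integral_breakingIntegrand (σ : ℤˣ) {mu : ℂ} (hmu : mu ∈ strip) (f : Sec₂ (-1) 1) (z : ℝ) :
    ∫ x, breakingIntegrand σ mu f z x = (((σ : ℤ) : ℝ) : ℂ) * ((1 + z ^ 2 : ℝ) : ℂ) ^ (1 + mu) *
      (mellinOp ((σ : ℤ) : ℝ) mu f).1 ![z, 1] := by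
  rw [integral_inversion z (one_add_sq_pos z),
    integral_congr_ae (breakingIntegrand_inversion_ae σ mu f z), integral_const_mul,
    integral_orientedPencil (abs_unit σ) hmu f (bruhat_mem z)]

theorem exists_integral_norm_breakingIntegrand_le (σ : ℤˣ) {mu : ℂ} (hmu : mu ∈ strip)
    (f : Sec₂ (-1) 1) : ∃ C : ℝ, 0 ≤ C ∧ ∀ z : ℝ,
      ∫ x, ‖breakingIntegrand σ mu f z x‖ ≤ C * (1 + z ^ 2) ^ mu.re := by
  obtain ⟨C, hC0, hC⟩ := exists_integral_norm_orientedPencil_le (abs_unit σ) hmu f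
  refine ⟨C, hC0, fun z => ?_⟩
  have hn := one_add_sq_pos z
  have e : ∀ᵐ x : ℝ × ℝ, (inversionDensity z (1 + z ^ 2) x.1 * inversionDensity z (1 + z ^ 2) x.2) •
      ‖breakingIntegrand σ mu f z (inversion z (1 + z ^ 2) x.1, inversion z (1 + z ^ 2) x.2)‖ =
      (1 + z ^ 2) ^ (1 + mu.re) * ‖orientedPencil ((σ : ℤ) : ℝ) mu f ![z, 1] x‖ := by
    filter_upwards [breakingIntegrand_inversion_ae σ mu f z] with x hx
    have h := congrArg norm hx
    rw [norm_mul, norm_mul, Complex.norm_real, Real.norm_eq_abs, abs_unit, one_mul,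
      Complex.norm_cpow_eq_rpow_re_of_pos hn, Complex.add_re, Complex.one_re] at h
    rw [← h, NNReal.smul_def, NNReal.smul_def, norm_smul, NNReal.norm_eq]
    rfl
  rw [integral_inversion z hn, integral_congr_ae e, integral_const_mul, Real.rpow_add hn, Real.rpow_one]
  have h1 := hC _ (bruhat_mem z)
  rw [normSq_bruhat] at h1
  calc _ ≤ (1 + z ^ 2) * (1 + z ^ 2) ^ mu.re * (C * (1 + z ^ 2)⁻¹) := by gcongr
    _ = _ := by field_simp

/-! ### The symmetry breaking operators -/

/-- The meromorphic family of operators with kernel `-(2πi)⁻¹ K_σ^mu(x, y; z)/(x - y)`. -/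
def breakingOp (σ : ℤˣ) (mu : ℂ) : Sec₂ (-1) 1 →L[ℂ] Sec 1 (-2 * mu) :=
  (-1 / (2 * Real.pi * Complex.I) * (((σ : ℤ) : ℝ) : ℂ)) •
    (Sec.twist (-2 * mu)).comp (mellinOp ((σ : ℤ) : ℝ) mu)

theorem normPow_apply (s : ℂ) {u : Plane} (hu : u ∈ punctured) :
    normPow s u = (normSq u : ℂ) ^ (s / 2) := if_neg hu

theorem twist_apply {ε : ℤˣ} {lam : ℂ} (lam' : ℂ) (f : Sec ε lam) {u : Plane} (hu : u ∈ punctured) :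
    (Sec.twist lam' f).1 u = (normSq u : ℂ) ^ ((lam - lam') / 2) * f.1 u := by
  rw [← normPow_apply _ hu]
  rfl

theorem normSq_ne_zero {u : Plane} (hu : u ∈ punctured) : (normSq u : ℂ) ≠ 0 := by
  exact_mod_cast (normSq_pos hu).ne'

theorem twist_twist {ε : ℤˣ} {lam : ℂ} (lam' lam'' : ℂ) (f : Sec ε lam) :
    Sec.twist lam'' (Sec.twist lam' f) = Sec.twist lam'' f := Sec.ext_on fun u hu => by
  rw [twist_apply _ _ hu, twist_apply _ _ hu, twist_apply _ _ hu, ← mul_assoc,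
    ← Complex.cpow_add _ _ (normSq_ne_zero hu)]
  congr 2
  ring

theorem breakingOp_apply (σ : ℤˣ) (mu : ℂ) (f : Sec₂ (-1) 1) {u : Plane} (hu : u ∈ punctured) :
    (breakingOp σ mu f).1 u = -1 / (2 * Real.pi * Complex.I) * (((σ : ℤ) : ℝ) : ℂ) *
      ((normSq u : ℂ) ^ (1 + mu) * (mellinOp ((σ : ℤ) : ℝ) mu f).1 u) := by
  have h : (breakingOp σ mu f).1 u = -1 / (2 * Real.pi * Complex.I) * (((σ : ℤ) : ℝ) : ℂ) *
    (Sec.twist (-2 * mu) (mellinOp ((σ : ℤ) : ℝ) mu f)).1 u := rfl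
  rw [h, twist_apply _ _ hu]
  congr 3
  ring

theorem coord_breakingOp (σ : ℤˣ) {mu : ℂ} (hmu : mu ∈ strip) (f : Sec₂ (-1) 1) (z : ℝ) :
    coord (breakingOp σ mu f) z = -1 / (2 * Real.pi * Complex.I) * ∫ x, breakingIntegrand σ mu f z x := by
  rw [integral_breakingIntegrand σ hmu, coord, breakingOp_apply σ mu f (bruhat_mem z), normSq_bruhat]
  ring

/-- In the common trivialization the power of |u| depending on mu disappears, so meromorphy of the
family reduces to that of `mellinOp`, whose target is a fixed space. -/
theorem twist_breakingOp (σ : ℤˣ) (mu lam : ℂ) (f : Sec₂ (-1) 1) :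
    Sec.twist lam (breakingOp σ mu f) = (-1 / (2 * Real.pi * Complex.I) * (((σ : ℤ) : ℝ) : ℂ)) •
      Sec.twist lam (mellinOp ((σ : ℤ) : ℝ) mu f) := by
  rw [← twist_twist (-2 * mu) lam (mellinOp ((σ : ℤ) : ℝ) mu f), ← map_smul]
  rfl

theorem IsMeroOn.isMeromorphicFamily {B : ℂ → Sec₂ (-1) 1 →L[ℂ] Sec 1 2} (hB : IsMeroOn univ B)
    {ι : Type*} (h : ι → Sec 1 2 →L[ℂ] ℂ) (f : ι → Sec₂ (-1) 1) :
    IsMeromorphicFamily integerPoints fun i z => h i (B z (f i)) := by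
  refine ⟨fun i s hs => ?_, fun s _ => ?_⟩
  · obtain ⟨n, hn0, hn⟩ := hB s (mem_univ s)
    have h1 := hn (h i) (f i)
    rw [hn0 hs] at h1
    simp only [pow_zero, one_mul] at h1
    exact h1.differentiableAt.differentiableWithinAt
  · obtain ⟨n, -, hn⟩ := hB s (mem_univ s)
    exact ⟨n, fun i => hn (h i) (f i)⟩

/-! ### Equivariance -/

/-- Evaluation at a point. -/
def evalAt (ε : ℤˣ) (lam : ℂ) (u : Plane) : Sec ε lam →L[ℂ] ℂ where
  toFun f := f.1 u
  map_add' _ _ := rfl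
  map_smul' _ _ := rfl
  cont := by
    by_cases hu : u ∈ punctured
    · refine continuous_iff_continuousAt.2 fun f => Metric.tendsto_nhds.2 fun δ hδ => ?_
      filter_upwards [tendsto_sec_iff.1 (tendsto_id (α := Sec ε lam) (x := 𝓝 f)) 0 {u} isCompact_singleton
        (singleton_subset_iff.2 hu) δ hδ] with g hg
      have h1 := hg u rfl
      rw [SmoothFun.norm_iteratedFDerivWithin_zero] at h1
      rw [dist_eq_norm]
      exact h1
    · have : (fun f : Sec ε lam => f.1 u) = fun _ => 0 := funext fun f => f.1.eq_zero hu
      exact this ▸ continuous_const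

theorem sq_inner_decomposition (w v : Plane) : normSq v • w =
    (w 0 * rot v 0 + w 1 * rot v 1) • rot v + (w 0 * v 0 + w 1 * v 1) • v := by
  ext i
  fin_cases i <;> simp [normSq] <;> ring

/-- The pairing of w with rot v is the determinant of (w, v), which g⁻¹ preserves; for w = rot u and
v = u it equals |u|². -/
theorem invMap_rot (g : SL(2, ℝ)) (u : Plane) :
    invMap g (rot u) 0 * rot (invMap g u) 0 + invMap g (rot u) 1 * rot (invMap g u) 1 = normSq u := by
  have hdet := (g⁻¹).2
  rw [Matrix.det_fin_two] at hdet
  simp only [invMap_apply, Matrix.mulVec, dotProduct, Fin.sum_univ_two, rot_zero, rot_one, normSq]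
  linear_combination (u 0 ^ 2 + u 1 ^ 2) * hdet

/-- g⁻¹ sends the line of u, the point at infinity of the first coordinate, to the line of g⁻¹u, so
it is affine between the two coordinates. Decomposing g⁻¹(rot u) along rot (g⁻¹u) and g⁻¹u gives the
ratio from `invMap_rot` and a translation c. -/
theorem exists_invMap_lineMap (g : SL(2, ℝ)) {u : Plane} (hu : u ∈ punctured) :
    ∃ c : ℝ, ∀ p, invMap g (lineMap p u) = (normSq u / normSq (invMap g u)) •
      lineMap ((p + c) / (normSq u / normSq (invMap g u))) (invMap g u) := by
  have hn := normSq_pos hu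
  have hn' : 0 < normSq (invMap g u) := normSq_pos ((invMap_mem g u).2 hu)
  refine ⟨(invMap g (rot u) 0 * invMap g u 0 + invMap g (rot u) 1 * invMap g u 1) /
    normSq (invMap g u), fun p => ?_⟩
  have h1 : invMap g (rot u) = (normSq u / normSq (invMap g u)) • rot (invMap g u) +
      ((invMap g (rot u) 0 * invMap g u 0 + invMap g (rot u) 1 * invMap g u 1) /
        normSq (invMap g u)) • invMap g u := by
    have h := sq_inner_decomposition (invMap g (rot u)) (invMap g u)
    rw [invMap_rot] at h
    rw [div_eq_inv_mul, div_eq_inv_mul, mul_smul, mul_smul, ← smul_add, ← h, inv_smul_smul₀ hn'.ne']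
  rw [lineMap_apply, map_add, map_smul, lineMap_apply, smul_add, smul_smul, mul_div_cancel₀ _ (by positivity),
    add_smul]
  nth_rewrite 1 [h1]
  abel

theorem corr_act (τ : ℝ) (g : SL(2, ℝ)) (f : Sec₂ (-1) 1) {u : Plane} (hu : u ∈ punctured) (s : ℝ) :
    corr τ (Sec₂.act g f) u s = ((normSq u / normSq (invMap g u) : ℝ) : ℂ)⁻¹ *
      corr τ f (invMap g u) (s / (normSq u / normSq (invMap g u))) := by
  obtain ⟨c, hc⟩ := exists_invMap_lineMap g hu
  have hρ : 0 < normSq u / normSq (invMap g u) :=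
    div_pos (normSq_pos hu) (normSq_pos ((invMap_mem g u).2 hu))
  generalize normSq u / normSq (invMap g u) = ρ at hc hρ
  set u' := invMap g u
  have e : ∀ p, pencil (Sec₂.act g f) u p (p + τ * s) = (ρ : ℂ)⁻¹ * (ρ : ℂ)⁻¹ *
      pencil f u' ((p + c) / ρ) ((p + c) / ρ + τ * (s / ρ)) := fun p => by
    have h1 : pencil (Sec₂.act g f) u p (p + τ * s) =
      f.1 (invMap g (lineMap p u), invMap g (lineMap (p + τ * s) u)) := rfl
    rw [h1, hc, hc, smul_smul_apply f hρ.ne' hρ.ne', pencil]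
    congr 5
    ring
  have hρ1 : (ρ : ℂ) ≠ 0 := by exact_mod_cast hρ.ne'
  unfold corr
  simp only [e]
  rw [integral_const_mul, integral_add_right_eq_self
    (fun p => pencil f u' (p / ρ) (p / ρ + τ * (s / ρ))), Measure.integral_comp_div
    (fun p => pencil f u' p (p + τ * (s / ρ))), abs_of_pos hρ, Complex.real_smul,
    mul_assoc, inv_mul_cancel_left₀ hρ1]

/-- By `corr_act` the action replaces c(s) by ρ⁻¹ c(s/ρ), now with c taken at g⁻¹u and ρ =
|u|²/|g⁻¹u|². The Mellin transform acquires the factor ρ^(-mu-1), exactly offset by the power 1 + mu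
of |u|². -/
theorem mellinOp_act {τ : ℝ} (hτ : |τ| = 1) {mu : ℂ} (hmu : mu ∈ strip) (g : SL(2, ℝ))
    (f : Sec₂ (-1) 1) {u : Plane} (hu : u ∈ punctured) :
    (normSq u : ℂ) ^ (1 + mu) * (mellinOp τ mu (Sec₂.act g f)).1 u =
      (normSq (invMap g u) : ℂ) ^ (1 + mu) * (mellinOp τ mu f).1 (invMap g u) := by
  have hu' : invMap g u ∈ punctured := (invMap_mem g u).2 hu
  have hn := normSq_pos hu
  have hn' := normSq_pos hu'
  rw [mellinOp_apply hτ hmu _ hu, mellinOp_apply hτ hmu _ hu']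
  simp only [corr_act τ g f hu]
  set ρ : ℝ := normSq u / normSq (invMap g u) with hρdef
  have hρ : 0 < ρ := div_pos hn hn'
  have hρ1 : (ρ : ℂ) ≠ 0 := by exact_mod_cast hρ.ne'
  have h := integral_comp_mul_left_Ioi
    (fun s : ℝ => (s : ℂ) ^ (-mu - 1) * ((ρ : ℂ)⁻¹ * corr τ f (invMap g u) (s / ρ))) 0 hρ
  rw [mul_zero] at h
  have e : ∫ s in Ioi (0 : ℝ), (s : ℂ) ^ (-mu - 1) * ((ρ : ℂ)⁻¹ * corr τ f (invMap g u) (s / ρ)) =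
      (ρ : ℂ) ^ (-mu - 1) * ∫ s in Ioi (0 : ℝ), (s : ℂ) ^ (-mu - 1) * corr τ f (invMap g u) s := by
    rw [← smul_right_inj (inv_ne_zero hρ.ne'), ← h, ← integral_const_mul, Complex.real_smul,
      ← integral_const_mul]
    refine setIntegral_congr_fun measurableSet_Ioi fun s hs => ?_
    have hs0 : 0 < s := hs
    simp only [mul_div_cancel_left₀ s hρ.ne']
    rw [Complex.ofReal_mul, Complex.mul_cpow_ofReal_nonneg hρ.le hs0.le, Complex.ofReal_inv]
    ring
  have e2 : (normSq u : ℂ) ^ (1 + mu) = (ρ : ℂ) ^ (1 + mu) * (normSq (invMap g u) : ℂ) ^ (1 + mu) := by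
    rw [← Complex.mul_cpow_ofReal_nonneg hρ.le hn'.le, ← Complex.ofReal_mul, hρdef,
      div_mul_cancel₀ _ hn'.ne']
  have e3 : (ρ : ℂ) ^ (1 + mu) * (ρ : ℂ) ^ (-mu - 1) = 1 := by
    rw [← Complex.cpow_add _ _ hρ1, show 1 + mu + (-mu - 1) = 0 by ring, Complex.cpow_zero]
  rw [e, e2]
  linear_combination (normSq (invMap g u) : ℂ) ^ (1 + mu) *
    (∫ s in Ioi (0 : ℝ), (s : ℂ) ^ (-mu - 1) * corr τ f (invMap g u) s) * e3

/-! ### The exceptional set, and equivariance by analytic continuation -/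

theorem isClosed_integerPoints : IsClosed integerPoints := Complex.isClosedEmbedding_intCast.isClosed_range

theorem isDiscrete_integerPoints : IsDiscrete integerPoints :=
  ⟨Complex.isClosedEmbedding_intCast.isEmbedding.toHomeomorph.discreteTopology⟩

theorem disjoint_integerPoints_strip : Disjoint integerPoints strip := by
  refine disjoint_left.2 ?_
  rintro _ ⟨n, rfl⟩ ⟨h1, h2⟩
  rw [Complex.intCast_re] at h1 h2
  have h3 : -1 < n := by exact_mod_cast h1
  have h4 : n < 0 := by exact_mod_cast h2
  omega

theorem isPreconnected_compl_integerPoints : IsPreconnected integerPointsᶜ :=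
  ((countable_range _).isConnected_compl_of_one_lt_rank
    (by rw [Complex.rank_real_complex]; exact Cardinal.one_lt_two)).isPreconnected

theorem isOpen_strip : IsOpen strip :=
  (isOpen_lt continuous_const Complex.continuous_re).inter
    (isOpen_lt Complex.continuous_re continuous_const)

theorem analyticOnNhd_breakingOp (σ : ℤˣ) (f : Sec₂ (-1) 1) {u : Plane} (hu : u ∈ punctured) :
    AnalyticOnNhd ℂ (fun mu => (breakingOp σ mu f).1 u) integerPointsᶜ := fun mu hmu => by
  simp only [breakingOp_apply σ _ f hu]
  obtain ⟨n, hn0, hn⟩ := isMeroOn_mellinOp (abs_unit σ) mu (mem_univ mu)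
  have h1 := hn (evalAt 1 2 u) f
  rw [hn0 hmu] at h1
  simp only [pow_zero, one_mul] at h1
  have h2 : AnalyticAt ℂ (fun mu : ℂ => (normSq u : ℂ) ^ (1 + mu)) mu := by
    have h3 : ∀ z : ℂ, DifferentiableAt ℂ (fun mu : ℂ => (normSq u : ℂ) ^ (1 + mu)) z := fun z =>
      (((hasDerivAt_id z).const_add 1).const_cpow (Or.inl (normSq_ne_zero hu))).differentiableAt
    exact Differentiable.analyticAt h3 mu
  exact analyticAt_const.mul (h2.mul h1)

theorem breakingOp_act (σ : ℤˣ) {mu : ℂ} (hmu : mu ∉ integerPoints) (g : SL(2, ℝ)) (f : Sec₂ (-1) 1) :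
    breakingOp σ mu (Sec₂.act g f) = Sec.act g (breakingOp σ mu f) := Sec.ext_on fun u hu => by
  have hu' : invMap g u ∈ punctured := (invMap_mem g u).2 hu
  change _ = (breakingOp σ mu f).1 (invMap g u)
  -- Both sides are analytic off the integers pointwise in u and agree near this point of the strip,
  -- so the identity theorem applies.
  have h0 : (-1 / 2 : ℂ) ∈ strip := by constructor <;> norm_num
  refine (analyticOnNhd_breakingOp σ (Sec₂.act g f) hu).eqOn_of_preconnected_of_eventuallyEq
    (analyticOnNhd_breakingOp σ f hu') isPreconnected_compl_integerPoints
    (disjoint_right.1 disjoint_integerPoints_strip h0) ?_ hmu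
  filter_upwards [isOpen_strip.mem_nhds h0] with z hz
  rw [breakingOp_apply σ _ _ hu, breakingOp_apply σ _ _ hu', mellinOp_act (abs_unit σ) hz g f hu]

theorem isSymmetryBreakingFamily_breakingOp (σ : ℤˣ) :
    IsSymmetryBreakingFamily σ integerPoints (breakingOp (-σ)) where
  integrable _ hmu f z := integrable_breakingIntegrand (-σ) hmu f z
  formula _ hmu f z := coord_breakingOp (-σ) hmu f z
  meromorphic := by
    have h := (isMeroOn_mellinOp (abs_unit (-σ))).isMeromorphicFamily
      (fun i : (Sec 1 0 →L[ℂ] ℂ) × Sec₂ (-1) 1 =>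
        (-1 / (2 * Real.pi * Complex.I) * ((((-σ : ℤˣ) : ℤ) : ℝ) : ℂ)) •
          i.1.comp (Sec.twist (lam := 2) 0)) (fun i => i.2)
    refine (congrArg (IsMeromorphicFamily integerPoints) (funext fun i => funext fun mu => ?_)).mp h
    rw [twist_breakingOp, map_smul]
    rfl
  equivariant _ hmu g f := breakingOp_act (-σ) hmu g f

/-! ### The holographic operators -/

/-- Transport along an equality of parameters, as an operator. -/
def Sec.castL {ε : ℤˣ} {lam lam' : ℂ} (h : lam = lam') : Sec ε lam →L[ℂ] Sec ε lam' where
  toFun := Sec.cast h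
  map_add' _ _ := rfl
  map_smul' _ _ := rfl
  cont := continuous_subtype_val.subtype_mk _

/-- Transport along an equality of parameters, as an operator. -/
def Sec₂.castL {ε : ℤˣ} {lam lam' : ℂ} (h : lam = lam') : Sec₂ ε lam →L[ℂ] Sec₂ ε lam' where
  toFun := Sec₂.cast h
  map_add' _ _ := rfl
  map_smul' _ _ := rfl
  cont := continuous_subtype_val.subtype_mk _

theorem twist_cast {ε : ℤˣ} {lam lam' : ℂ} (h : lam = lam') (nu : ℂ) (f : Sec ε lam) :
    Sec.twist nu (Sec.cast h f) = Sec.twist nu f := by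
  subst h
  rfl

theorem coord_cast {ε : ℤˣ} {lam lam' : ℂ} (h : lam = lam') (f : Sec ε lam) (x : ℝ) :
    coord (Sec.cast h f) x = coord f x := rfl

/-- The symmetry breaking operators between the spaces to which the holographic operators are
dual. -/
def castOp (σ : ℤˣ) (mu : ℂ) : Sec₂ (-1) (2 - 1) →L[ℂ] Sec 1 (2 - (2 * mu + 2)) :=
  (Sec.castL (neg_two_mul_eq mu)).comp ((breakingOp σ mu).comp (Sec₂.castL one_eq_two_sub_one.symm))

theorem castOp_apply (σ : ℤˣ) (mu : ℂ) (f : Sec₂ (-1) (2 - 1)) : castOp σ mu f =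
    Sec.cast (neg_two_mul_eq mu) (breakingOp σ mu (Sec₂.cast one_eq_two_sub_one.symm f)) := rfl

/-- The holographic operators. -/
def holographicOp (σ : ℤˣ) (mu : ℂ) : DistSec 1 (2 * mu + 2) →L[ℂ] DistSec₂ (-1) 1 :=
  ContinuousLinearMap.precomp ℂ ((-(2 * Real.pi * Complex.I) : ℂ) • castOp σ mu)

theorem holographicOp_apply (σ : ℤˣ) (mu : ℂ) (h : DistSec 1 (2 * mu + 2)) (f : Sec₂ (-1) (2 - 1)) :
    holographicOp σ mu h f = -(2 * Real.pi * Complex.I) * h (castOp σ mu f) :=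
  map_smul h _ (castOp σ mu f)

theorem isDualFamily_holographicOp (σ : ℤˣ) :
    IsDualFamily integerPoints (breakingOp σ) (holographicOp σ) := fun mu _ h f =>
  holographicOp_apply σ mu h (Sec₂.cast one_eq_two_sub_one f)

theorem castOp_act (σ : ℤˣ) {mu : ℂ} (hmu : mu ∉ integerPoints) (g : SL(2, ℝ))
    (f : Sec₂ (-1) (2 - 1)) : castOp σ mu (Sec₂.act g f) = Sec.act g (castOp σ mu f) := by
  have e : Sec₂.cast one_eq_two_sub_one.symm (Sec₂.act g f) =
    Sec₂.act g (Sec₂.cast one_eq_two_sub_one.symm f) := rfl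
  rw [castOp_apply, castOp_apply, e, breakingOp_act σ hmu]
  rfl

theorem holographicOp_act (σ : ℤˣ) {mu : ℂ} (hmu : mu ∉ integerPoints) (g : SL(2, ℝ))
    (h : DistSec 1 (2 * mu + 2)) :
    holographicOp σ mu (DistSec.act g h) = DistSec₂.act g (holographicOp σ mu h) :=
  ContinuousLinearMap.ext fun f => by
    have h1 : DistSec₂.act g (holographicOp σ mu h) f = holographicOp σ mu h (Sec₂.act g⁻¹ f) := rfl
    rw [h1, holographicOp_apply, holographicOp_apply, castOp_act σ hmu]
    rfl

theorem isMeromorphicFamily_holographicOp (σ : ℤˣ) : IsMeromorphicFamily integerPoints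
    (fun (i : DistSec 1 0 × Sec₂ (-1) (2 - 1)) mu =>
      holographicOp σ mu (DistSec.twist (2 * mu + 2) i.1) i.2) := by
  have h := (isMeroOn_mellinOp (abs_unit σ)).isMeromorphicFamily
    (fun i : DistSec 1 0 × Sec₂ (-1) (2 - 1) => (-(2 * Real.pi * Complex.I) *
      (-1 / (2 * Real.pi * Complex.I) * (((σ : ℤ) : ℝ) : ℂ))) • i.1.comp (Sec.twist (lam := 2) (2 - 0)))
    (fun i => Sec₂.cast one_eq_two_sub_one.symm i.2)
  refine (congrArg (IsMeromorphicFamily integerPoints) (funext fun i => funext fun mu => ?_)).mp h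
  have h1 : DistSec.twist (2 * mu + 2) i.1 (castOp σ mu i.2) =
    i.1 (Sec.twist (2 - 0) (castOp σ mu i.2)) := rfl
  rw [holographicOp_apply, h1, castOp_apply, twist_cast, twist_breakingOp, map_smul, smul_eq_mul]
  exact mul_assoc _ _ _

/-! ### The integral formula for the holographic operators -/

theorem measurable_halfPow (σ : ℤˣ) (mu : ℂ) : Measurable fun t => halfPow σ t mu := by
  unfold halfPow
  refine Measurable.ite (measurableSet_lt measurable_const (by fun_prop)) (by fun_prop) measurable_const

theorem measurable_K (σ : ℤˣ) (mu : ℂ) :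
    Measurable fun w : ℝ × ℝ × ℝ => K σ mu w.2.1 w.2.2 w.1 :=
  (measurable_halfPow σ mu).comp (by fun_prop)

theorem norm_halfPow_le (σ : ℤˣ) {mu : ℂ} (t : ℝ) : ‖halfPow σ t mu‖ ≤ |t| ^ mu.re := by
  unfold halfPow
  split_ifs with h
  · rw [Complex.norm_cpow_eq_rpow_re_of_pos h, ← abs_of_pos h, abs_mul, abs_unit, one_mul]
  · simpa using Real.rpow_nonneg (abs_nonneg t) _

theorem exists_norm_coord_le {ε : ℤˣ} {lam : ℂ} (h : Sec ε lam) : ∃ C : ℝ, 0 ≤ C ∧ ∀ z : ℝ,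
    ‖coord h z‖ ≤ C * decay z ^ lam.re := by
  obtain ⟨C, hC0, hC⟩ := exists_bound h
  refine ⟨C, hC0, fun z => ?_⟩
  have hd := decay_pos z
  have hv : decay z • ![z, 1] ∈ unitCircle := by
    have h1 := normSq_smul (decay z) ![z, 1]
    rw [normSq_bruhat, decay_sq, inv_mul_cancel₀ (one_add_sq_pos z).ne'] at h1
    exact h1
  have e : (![z, 1] : Plane) = (decay z)⁻¹ • decay z • ![z, 1] := by
    rw [smul_smul, inv_mul_cancel₀ hd.ne', one_smul]
  have hs : ‖(if ε = 1 then 1 else (Real.sign (decay z)⁻¹ : ℂ))‖ = 1 := by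
    rw [Real.sign_of_pos (inv_pos.2 hd)]
    simp
  rw [coord, e, h.2 _ (inv_ne_zero hd.ne'), norm_mul, character, norm_mul, hs, mul_one,
    abs_of_pos (inv_pos.2 hd), Complex.norm_cpow_eq_rpow_re_of_pos (inv_pos.2 hd), Complex.neg_re,
    Real.inv_rpow hd.le, Real.rpow_neg hd.le, inv_inv, mul_comm]
  have := hC _ hv
  gcongr

/-- An integrable function that bounds `|t|^a` near the origin. -/
def localPow (a t : ℝ) : ℝ := (Ioc 0 1).indicator (fun s => s ^ a) t + (Ioc 0 1).indicator (fun s => s ^ a) (-t)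

theorem integrable_localPow {a : ℝ} (ha : -1 < a) : Integrable (localPow a) := by
  have h : Integrable ((Ioc (0 : ℝ) 1).indicator fun s => s ^ a) :=
    (integrable_indicator_iff measurableSet_Ioc).2 (integrableOn_rpow_Ioc ha)
  exact h.add h.comp_neg

theorem localPow_nonneg (a t : ℝ) : 0 ≤ localPow a t :=
  add_nonneg (indicator_nonneg (fun _ hs => Real.rpow_nonneg hs.1.le _) _)
    (indicator_nonneg (fun _ hs => Real.rpow_nonneg hs.1.le _) _)

theorem abs_rpow_le_localPow {a : ℝ} (ha : a < 0) (t : ℝ) : |t| ^ a ≤ 1 + localPow a t := by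
  rcases le_or_gt 1 |t| with h | h
  · exact (Real.rpow_le_one_of_one_le_of_nonpos h ha.le).trans (by linarith [localPow_nonneg a t])
  have key : ∀ s : ℝ, 0 ≤ (Ioc (0 : ℝ) 1).indicator (fun s => s ^ a) s := fun s =>
    indicator_nonneg (fun _ hs => Real.rpow_nonneg hs.1.le _) s
  rcases lt_trichotomy t 0 with h0 | rfl | h0
  · rw [abs_of_neg h0] at h ⊢
    have : (Ioc (0 : ℝ) 1).indicator (fun s => s ^ a) (-t) = (-t) ^ a :=
      indicator_of_mem (s := Ioc (0 : ℝ) 1) (mem_Ioc.2 ⟨neg_pos.2 h0, h.le⟩) _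
    unfold localPow
    rw [this]
    linarith [key t]
  · rw [abs_zero, Real.zero_rpow ha.ne]
    linarith [localPow_nonneg a 0]
  · rw [abs_of_pos h0] at h ⊢
    have : (Ioc (0 : ℝ) 1).indicator (fun s => s ^ a) t = t ^ a := indicator_of_mem (s := Ioc (0 : ℝ) 1) (mem_Ioc.2 ⟨h0, h.le⟩) _
    unfold localPow
    rw [this]
    linarith [key (-t)]

/-- No z is close to both x and y, and for large z both distances are comparable to `(decay z)⁻¹` =
√(1+z²). -/
theorem exists_le_abs_sub {x y : ℝ} (hxy : x ≠ y) : ∃ c : ℝ, 0 < c ∧ ∀ z : ℝ,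
    c * (decay z)⁻¹ ≤ |x - z| ∨ c * (decay z)⁻¹ ≤ |y - z| := by
  have hd : 0 < (x - y) ^ 2 := by have := sub_ne_zero.2 hxy; positivity
  -- M is a generous constant for which (x-y)² (1+z²) is at most M times the larger of (x-z)² and
  -- (y-z)².
  set M : ℝ := 8 + 8 * x ^ 2 + 8 * y ^ 2 + 2 * (x - y) ^ 2 with hM
  have hM0 : 0 < M := by positivity
  refine ⟨√((x - y) ^ 2 / M), Real.sqrt_pos.2 (by positivity), fun z => ?_⟩
  have hdz := decay_pos z
  set c : ℝ := √((x - y) ^ 2 / M) * (decay z)⁻¹ with hc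
  have hc0 : 0 ≤ c := by positivity
  have hc2 : c ^ 2 * M = (x - y) ^ 2 * (1 + z ^ 2) := by
    rw [hc, mul_pow, Real.sq_sqrt (by positivity), inv_pow, decay_sq, inv_inv]
    field_simp
  by_contra hcon
  push Not at hcon
  have h1 : (x - z) ^ 2 < c ^ 2 := by
    rw [← sq_abs (x - z)]
    exact pow_lt_pow_left₀ hcon.1 (abs_nonneg _) two_ne_zero
  have h2 : (y - z) ^ 2 < c ^ 2 := by
    rw [← sq_abs (y - z)]
    exact pow_lt_pow_left₀ hcon.2 (abs_nonneg _) two_ne_zero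
  have h3 : (x - y) ^ 2 ≤ 2 * ((x - z) ^ 2 + (y - z) ^ 2) := by nlinarith [sq_nonneg (x + y - 2 * z)]
  have h4 : z ^ 2 ≤ 2 * (x - z) ^ 2 + 2 * x ^ 2 := by nlinarith [sq_nonneg (2 * x - z)]
  have h5 : (x - y) ^ 2 * (1 + z ^ 2) ≤ (2 * ((x - z) ^ 2 + (y - z) ^ 2)) * (1 + 2 * x ^ 2) +
      (x - y) ^ 2 * (2 * (x - z) ^ 2) := by
    nlinarith [mul_le_mul_of_nonneg_left h4 hd.le, mul_le_mul_of_nonneg_right h3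
      (by positivity : (0 : ℝ) ≤ 1 + 2 * x ^ 2)]
  have h6 : (x - y) ^ 2 * (1 + z ^ 2) < c ^ 2 * M := by
    have e : (2 * ((x - z) ^ 2 + (y - z) ^ 2)) * (1 + 2 * x ^ 2) +
        (x - y) ^ 2 * (2 * (x - z) ^ 2) < c ^ 2 * (4 * (1 + 2 * x ^ 2) + 2 * (x - y) ^ 2) := by
      have p1 : (0 : ℝ) < 2 * (1 + 2 * x ^ 2) := by positivity
      nlinarith [mul_lt_mul_of_pos_right h1 p1, mul_lt_mul_of_pos_right h2 p1,
        mul_lt_mul_of_pos_left h1 hd]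
    have e2 : c ^ 2 * (4 * (1 + 2 * x ^ 2) + 2 * (x - y) ^ 2) ≤ c ^ 2 * M := by
      refine mul_le_mul_of_nonneg_left ?_ (sq_nonneg c)
      rw [hM]
      nlinarith [sq_nonneg x, sq_nonneg y]
    exact h5.trans_lt (e.trans_le e2)
  exact absurd hc2 h6.ne'

/-- Let a = Re mu. At each z one of |x-z|^a, |y-z|^a is at most a constant times `decay z ^ (-a)`,
so the product of singularities is bounded by a sum of single ones, each locally integrable as a >
-1. The decay exponent 2a + 2 of h leaves 2 + a > 1, enough at infinity. -/
theorem integrable_coord_mul_K (σ : ℤˣ) {mu : ℂ} (hmu : mu ∈ strip) (h : Sec 1 (2 * mu + 2)) {x y : ℝ}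
    (hxy : x ≠ y) : Integrable fun z => coord h z * K σ mu x y z := by
  obtain ⟨C, hC0, hC⟩ := exists_norm_coord_le h
  obtain ⟨c, hc0, hc⟩ := exists_le_abs_sub hxy
  obtain ⟨ha1, ha0⟩ := hmu
  set a : ℝ := mu.re with ha
  have hre : (2 * mu + 2 : ℂ).re = 2 * a + 2 := by simp [ha]
  have hi := integrable_decay_rpow (ε := 1 + a) (by linarith)
  have hlx : Integrable fun z => localPow a (x - z) := (integrable_localPow ha1).comp_sub_left x
  have hly : Integrable fun z => localPow a (y - z) := (integrable_localPow ha1).comp_sub_left y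
  have hbound := ((((hi.const_mul 2).add hlx).add hly).const_mul
    (C * (|x - y|⁻¹ ^ a * c ^ a)))
  have hmeas : Measurable fun z => K σ mu x y z :=
    (measurable_K σ mu).comp (by fun_prop : Measurable fun z : ℝ => (z, x, y))
  refine hbound.mono' ((continuous_coord h).aestronglyMeasurable.mul hmeas.aestronglyMeasurable)
    (Eventually.of_forall fun z => ?_)
  have hd := decay_pos z
  have hd1 := decay_le_one z
  have hxa := Real.rpow_nonneg (abs_nonneg (x - z)) a
  have hya := Real.rpow_nonneg (abs_nonneg (y - z)) a
  have hM : 0 < c * (decay z)⁻¹ := by positivity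
  have hMa := Real.rpow_nonneg hM.le a
  have hprod : |x - z| ^ a * |y - z| ^ a ≤ (c * (decay z)⁻¹) ^ a * (|x - z| ^ a + |y - z| ^ a) := by
    rcases hc z with h1 | h1
    · have h2 := Real.rpow_le_rpow_of_nonpos hM h1 ha0.le
      calc |x - z| ^ a * |y - z| ^ a ≤ (c * (decay z)⁻¹) ^ a * |y - z| ^ a := by gcongr
        _ ≤ _ := by gcongr; linarith
    · have h2 := Real.rpow_le_rpow_of_nonpos hM h1 ha0.le
      calc |x - z| ^ a * |y - z| ^ a ≤ |x - z| ^ a * (c * (decay z)⁻¹) ^ a := by gcongr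
        _ = (c * (decay z)⁻¹) ^ a * |x - z| ^ a := mul_comm _ _
        _ ≤ _ := by gcongr; linarith
  have hdec : decay z ^ (2 * a + 2) * (c * (decay z)⁻¹) ^ a = c ^ a * decay z ^ (1 + (1 + a)) := by
    rw [Real.mul_rpow hc0.le (by positivity), Real.inv_rpow hd.le, ← Real.rpow_neg hd.le, mul_left_comm,
      ← Real.rpow_add hd]
    congr 2
    ring
  have hdle : decay z ^ (1 + (1 + a)) ≤ 1 := Real.rpow_le_one hd.le hd1 (by linarith)
  have hd2 := Real.rpow_nonneg hd.le (1 + (1 + a))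
  have hfin : decay z ^ (1 + (1 + a)) * (|x - z| ^ a + |y - z| ^ a) ≤
      2 * decay z ^ (1 + (1 + a)) + localPow a (x - z) + localPow a (y - z) := by
    have h1 := abs_rpow_le_localPow ha0 (x - z)
    have h2 := abs_rpow_le_localPow ha0 (y - z)
    have h3 := localPow_nonneg a (x - z)
    have h4 := localPow_nonneg a (y - z)
    calc _ ≤ decay z ^ (1 + (1 + a)) * ((1 + localPow a (x - z)) + (1 + localPow a (y - z))) := by gcongr
      _ = 2 * decay z ^ (1 + (1 + a)) +
          decay z ^ (1 + (1 + a)) * (localPow a (x - z) + localPow a (y - z)) := by ring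
      _ ≤ 2 * decay z ^ (1 + (1 + a)) + 1 * (localPow a (x - z) + localPow a (y - z)) := by gcongr
      _ = _ := by ring
  have hK : ‖K σ mu x y z‖ ≤ |x - y|⁻¹ ^ a * (|x - z| ^ a * |y - z| ^ a) := by
    refine (norm_halfPow_le σ _).trans_eq ?_
    rw [abs_div, abs_mul, div_eq_mul_inv, Real.mul_rpow (by positivity) (by positivity),
      Real.mul_rpow (by positivity) (by positivity), mul_comm]
  have hxya : 0 ≤ |x - y|⁻¹ ^ a := by positivity
  have hh := hC z
  rw [hre] at hh
  rw [norm_mul]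
  calc ‖coord h z‖ * ‖K σ mu x y z‖
      ≤ (C * decay z ^ (2 * a + 2)) * (|x - y|⁻¹ ^ a *
          ((c * (decay z)⁻¹) ^ a * (|x - z| ^ a + |y - z| ^ a))) := by
        refine mul_le_mul hh (hK.trans (mul_le_mul_of_nonneg_left hprod hxya)) (norm_nonneg _)
          (by positivity)
    _ = C * |x - y|⁻¹ ^ a * (decay z ^ (2 * a + 2) * (c * (decay z)⁻¹) ^ a) *
          (|x - z| ^ a + |y - z| ^ a) := by ring
    _ = C * (|x - y|⁻¹ ^ a * c ^ a) * (decay z ^ (1 + (1 + a)) * (|x - z| ^ a + |y - z| ^ a)) := by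
        rw [hdec]; ring
    _ ≤ C * (|x - y|⁻¹ ^ a * c ^ a) *
          (2 * decay z ^ (1 + (1 + a)) + localPow a (x - z) + localPow a (y - z)) := by gcongr

/-! ### Fubini's theorem for the transposed operators -/

theorem ofSection_apply {ε : ℤˣ} {lam : ℂ} (h : Sec ε lam) (f : Sec ε (2 - lam)) :
    DistSec.ofSection h f = ∫ x, coord h x * coord f x := rfl

theorem continuous_coord₂ {ε : ℤˣ} {lam : ℂ} (f : Sec₂ ε lam) :
    Continuous fun x : ℝ × ℝ => coord₂ f x.1 x.2 := by
  refine f.1.contDiffOn.continuousOn.comp_continuous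
    (f := fun x : ℝ × ℝ => (![x.1, 1], ![x.2, 1])) (by fun_prop) fun x => ?_
  exact ⟨bruhat_mem x.1, bruhat_mem x.2⟩

/-- The bounds (1+z²)^(-Re mu-1) for h and (1+z²)^(Re mu) for the inner absolute integral multiply
to the integrable function (1+z²)⁻¹. -/
theorem integrable_coord_mul_breakingIntegrand (σ : ℤˣ) {mu : ℂ} (hmu : mu ∈ strip)
    (h : Sec 1 (2 * mu + 2)) (f : Sec₂ (-1) 1) :
    Integrable (fun w : ℝ × ℝ × ℝ => coord h w.1 * breakingIntegrand σ mu f w.1 w.2)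
      ((volume : Measure ℝ).prod (volume : Measure (ℝ × ℝ))) := by
  have hmeas : AEStronglyMeasurable (fun w : ℝ × ℝ × ℝ => coord h w.1 * breakingIntegrand σ mu f w.1 w.2)
      ((volume : Measure ℝ).prod (volume : Measure (ℝ × ℝ))) := by
    have h1 : Measurable fun w : ℝ × ℝ × ℝ => coord h w.1 :=
      ((continuous_coord h).comp continuous_fst).measurable
    have h2 : Measurable fun w : ℝ × ℝ × ℝ => coord₂ f w.2.1 w.2.2 :=
      ((continuous_coord₂ f).comp continuous_snd).measurable
    have h3 : Measurable fun w : ℝ × ℝ × ℝ => ((w.2.1 - w.2.2 : ℝ) : ℂ) := by fun_prop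
    exact (h1.mul ((h2.mul (measurable_K σ mu)).div h3)).aestronglyMeasurable
  obtain ⟨C, hC0, hC⟩ := exists_norm_coord_le h
  obtain ⟨D, hD0, hD⟩ := exists_integral_norm_breakingIntegrand_le σ hmu f
  refine (integrable_prod_iff hmeas).2 ⟨Eventually.of_forall fun z =>
    (integrable_breakingIntegrand σ hmu f z).const_mul (coord h z), ?_⟩
  refine (integrable_inv_one_add_sq.const_mul (C * D)).mono' hmeas.norm.integral_prod_right'
    (Eventually.of_forall fun z => ?_)
  have hn := one_add_sq_pos z
  have hd := decay_pos z
  rw [Real.norm_of_nonneg (integral_nonneg fun _ => norm_nonneg _)]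
  simp only [norm_mul]
  rw [integral_const_mul]
  have hre : (2 * mu + 2 : ℂ).re = 2 * (mu.re + 1) := by simp; ring
  have h1 := hC z
  rw [hre, Real.rpow_mul hd.le, Real.rpow_two, decay_sq, Real.inv_rpow hn.le, Real.rpow_add_one hn.ne'] at h1
  have hp := Real.rpow_pos_of_pos hn mu.re
  calc ‖coord h z‖ * ∫ x, ‖breakingIntegrand σ mu f z x‖
      ≤ (C * ((1 + z ^ 2) ^ mu.re * (1 + z ^ 2))⁻¹) * (D * (1 + z ^ 2) ^ mu.re) :=
        mul_le_mul h1 (hD z) (integral_nonneg fun _ => norm_nonneg _) (by positivity)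
    _ = _ := by field_simp

theorem integral_coord_mul_breakingIntegrand (σ : ℤˣ) (mu : ℂ) (h : Sec 1 (2 * mu + 2))
    (f : Sec₂ (-1) (2 - 1)) (x : ℝ × ℝ) :
    ∫ z, coord h z * breakingIntegrand (-σ) mu (Sec₂.cast one_eq_two_sub_one.symm f) z x =
      holographicIntegral σ mu h x.1 x.2 * coord₂ f x.1 x.2 := by
  have e : ∀ z, coord h z * breakingIntegrand (-σ) mu (Sec₂.cast one_eq_two_sub_one.symm f) z x =
      coord₂ f x.1 x.2 / ((x.1 - x.2 : ℝ) : ℂ) * (coord h z * K (-σ) mu x.1 x.2 z) := fun z => by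
    have e1 : breakingIntegrand (-σ) mu (Sec₂.cast one_eq_two_sub_one.symm f) z x =
      coord₂ f x.1 x.2 * K (-σ) mu x.1 x.2 z / ((x.1 - x.2 : ℝ) : ℂ) := rfl
    rw [e1]
    ring
  simp only [e, integral_const_mul, holographicIntegral]
  ring

theorem integrable_holographicIntegral_mul (σ : ℤˣ) {mu : ℂ} (hmu : mu ∈ strip)
    (h : Sec 1 (2 * mu + 2)) (f : Sec₂ (-1) (2 - 1)) :
    Integrable fun x : ℝ × ℝ => holographicIntegral σ mu h x.1 x.2 * coord₂ f x.1 x.2 := by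
  simp only [← integral_coord_mul_breakingIntegrand]
  exact (integrable_coord_mul_breakingIntegrand (-σ) hmu h _).integral_prod_right

theorem holographicOp_ofSection (σ : ℤˣ) {mu : ℂ} (hmu : mu ∈ strip)
    (h : Sec 1 (2 * mu + 2)) (f : Sec₂ (-1) (2 - 1)) :
    holographicOp (-σ) mu (DistSec.ofSection h) f =
      ∫ x : ℝ × ℝ, holographicIntegral σ mu h x.1 x.2 * coord₂ f x.1 x.2 := by
  have hpi : (2 * Real.pi * Complex.I : ℂ) ≠ 0 := by simp [Real.pi_ne_zero]
  have e : ∀ z, coord h z * coord (breakingOp (-σ) mu (Sec₂.cast one_eq_two_sub_one.symm f)) z =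
      -1 / (2 * Real.pi * Complex.I) * ∫ x, coord h z *
        breakingIntegrand (-σ) mu (Sec₂.cast one_eq_two_sub_one.symm f) z x := fun z => by
    rw [coord_breakingOp (-σ) hmu, integral_const_mul]
    ring
  rw [holographicOp_apply, ofSection_apply, castOp_apply]
  simp only [coord_cast, e, ← integral_coord_mul_breakingIntegrand]
  rw [integral_const_mul, integral_integral_swap (integrable_coord_mul_breakingIntegrand (-σ) hmu h _),
    ← mul_assoc, mul_div_assoc', neg_mul_neg, mul_one, div_self hpi, one_mul]

end Holographic

end

theorem mainTheorem5 (σ : ℤˣ) :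
    ∃ (S : Set ℂ)
      (T : ∀ mu : ℂ, Sec₂ (-1) 1 →L[ℂ] Sec 1 (-2 * mu))
      (H : ∀ mu : ℂ, DistSec 1 (2 * mu + 2) →L[ℂ] DistSec₂ (-1) 1),
      -- `S` is a closed discrete set, disjoint from the strip `-1 < Re mu < 0`
      IsClosed S ∧ IsDiscrete S ∧ Disjoint S strip ∧
      -- `T` is the family `T_mu^σ`, and `H` is its dual, up to the factor `-2πi`
      IsSymmetryBreakingFamily σ S T ∧
      IsDualFamily S T H ∧
      -- the operators `H_mu` are `G`-intertwining
      (∀ mu ∉ S, ∀ (g : SL(2, ℝ)) (h : DistSec 1 (2 * mu + 2)),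
        H mu (DistSec.act g h) = DistSec₂.act g (H mu h)) ∧
      -- the operators `H_mu` depend meromorphically on `mu`
      IsMeromorphicFamily S (fun (i : DistSec 1 0 × Sec₂ (-1) (2 - 1)) mu =>
        H mu (DistSec.twist (2 * mu + 2) i.1) i.2) ∧
      -- the integral formula
      (∀ mu ∈ strip, ∀ h : Sec 1 (2 * mu + 2),
        (∀ x y : ℝ, x ≠ y → Integrable (fun z : ℝ => coord h z * K (-σ) mu x y z)) ∧
        ∀ f : Sec₂ (-1) (2 - 1),
          Integrable (fun p : ℝ × ℝ => holographicIntegral σ mu h p.1 p.2 * coord₂ f p.1 p.2) ∧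
          H mu (DistSec.ofSection h) f =
            ∫ p : ℝ × ℝ, holographicIntegral σ mu h p.1 p.2 * coord₂ f p.1 p.2) :=
  -- The operator of sign σ has the kernel of sign -σ, while `breakingOp` is indexed by the sign of
  -- its kernel; hence -σ throughout.
  ⟨integerPoints, breakingOp (-σ), holographicOp (-σ), isClosed_integerPoints,
    isDiscrete_integerPoints, disjoint_integerPoints_strip, isSymmetryBreakingFamily_breakingOp σ,
    isDualFamily_holographicOp (-σ), fun _ hmu g h => holographicOp_act (-σ) hmu g h,
    isMeromorphicFamily_holographicOp (-σ), fun _ hmu h =>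
      ⟨fun _ _ hxy => integrable_coord_mul_K (-σ) hmu h hxy,
        fun f => ⟨integrable_holographicIntegral_mul σ hmu h f, holographicOp_ofSection σ hmu h f⟩⟩⟩
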